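/- All algebras are unital associative algebras over $\mathbb{C}$; $H$ is a Hopf algebra with comultiplication $\Delta(h)=\sum h_1\otimes h_2$, counit $\varepsilon$ and invertible antipode $S$. **Calculi.** A differential calculus $\Gamma(A)$ over an algebra $A$ is an $\mathbb N$-graded algebra with $\Gamma^0(A)=A$, generated as an algebra by $A$ and $dA$, with a differential $d$ of degree $1$ ($d^2=0$, graded Leibniz rule). $\Omega(A)$ is the algebra of universal differential forms. $\hat\otimes$ is the graded tensor product of calculi. $\Gamma(H)$ is right covariant if $h_0\,dh_1\cdots dh_n\mapsto \Delta(h_0)(d\otimes id)\Delta(h_1)\cdots(d\otimes id)\Delta(h_n)$ defines a coaction $\Delta^\Gamma:\Gamma(H)\to\Gamma(H)\otimes H$; the corresponding right ideal is $R=\ker\varepsilon\cap\{h:\sum S^{-1}(h_2)\,dh_1=0\}\subset H$. **Coverings.** A finite family $(K_i)_{i\in I}$ of two-sided ideals of an algebra $A$ is a complete covering if $\bigcap_i K_i=0$ and the natural map from $A$ to its covering completion $\{(a_i)\in\prod_i A/K_i : a_i=a_j \text{ in } A/(K_i+K_j)\ \forall i,j\}$ is onto. **Bundles.** A locally trivial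 quantum principal fibre bundle is a right $H$-comodule algebra $P$ with coaction $\Delta_P$, an algebra $B$ with a complete covering $(J_i)_{i\in I}$, $B_i=B/J_i$, $\pi_i:B\to B_i$, an injective homomorphism $\iota:B\to P$ with image $\{f:\Delta_P(f)=f\otimes 1\}$, and surjective homomorphisms $\chi_i:P\to B_i\otimes H$ with $(id\otimes\Delta)\chi_i=(\chi_i\otimes id)\Delta_P$ and $\chi_i\iota(b)=\pi_i(b)\otimes 1$, such that $(\ker\chi_i)_i$ is a complete covering of $P$. **Differential structure.** Let differential calculi $\Gamma(B_i)$ and a right covariant calculus $\Gamma(H)$ be given. The $\chi_i$ extend to $\Omega(P)\to\Gamma(B_i)\hat\otimes\Gamma(H)$, and the maps $\pi_i$ to $\Omega(B)\to\Gamma(B_i)$; $\Gamma(P)$, $\Gamma(B)$ are the quotients of $\Omega(P)$, $\Omega(B)$ by the intersections of the kernels of these extensions, and $\Gamma_c(P)$, $\Gamma_c(B)$ are the covering completions of $\Gamma(P)$, $\Gamma(B)$ with respect to the kernels of the induced maps. Let $\chi_{i}:\Gamma_c(P)\to\Gamma(B_i)\hat\otimes\Gamma(H)$ be the resulting extension,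 $\iota:\Gamma_c(B)\to\Gamma_c(P)$ the extension of $\iota$, $\Delta:\Gamma_c(P)\to\Gamma_c(P)\otimes H$ the coaction, induced by the $id\otimes\Delta^\Gamma$, and $\mathrm{hor}\,\Gamma_c(P)=\{\gamma\in\Gamma_c(P):\chi_i(\gamma)\in\Gamma(B_i)\hat\otimes H\ \forall i\}$. **Covariant derivatives.** A left (right) covariant derivative is a linear map $D:\mathrm{hor}\,\Gamma_c(P)\to\mathrm{hor}\,\Gamma_c(P)$ of degree $1$ with $D(1)=0$, $(D\otimes id)\Delta=\Delta D$, $D(\ker\chi_i\cap\mathrm{hor}\,\Gamma_c(P))\subset\ker\chi_i$ for all $i$, and $$D(\iota(\gamma)\alpha)=(d\iota(\gamma))\alpha+(-1)^n\iota(\gamma)D(\alpha)\quad(\gamma\in\Gamma_c^n(B),\ \alpha\in\mathrm{hor}\,\Gamma_c(P))$$ in the left case, respectively $$D(\alpha\iota(\gamma))=D(\alpha)\iota(\gamma)+(-1)^n\alpha\, d\iota(\gamma)\quad(\gamma\in\Gamma_c(B),\ \alpha\in\mathrm{hor}\,\Gamma_c^n(P))$$ in the right case. It induces $D_i$ on $\Gamma(B_i)\hat\otimes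 H$ by $D_i\chi_i=\chi_i D$, and its local maps are $A_i:H\to\Gamma(B_i)$, $A_i(h)=-(id\otimes\varepsilon)D_i(1\otimes h)$. **Connections.** A left (right) connection is a surjective homomorphism of left (right) $P$-modules $\mathrm{hor}:\Gamma_c^1(P)\to\mathrm{hor}\,\Gamma^1_c(P)$ with $\mathrm{hor}^2=\mathrm{hor}$, $(\mathrm{hor}\otimes id)\Delta=\Delta\,\mathrm{hor}$ and $\mathrm{hor}(\ker\chi_i|_{\Gamma_c^1(P)})\subset\ker\chi_i$ for all $i\in I$. **Proposition.** The relation $D|_P=\mathrm{hor}\circ d|_P$ sets up a bijection between the left connections on $P$ and the left covariant derivatives $D$ with $R\subset\ker A_i$ for all $i\in I$, and likewise a bijection between the right connections on $P$ and the right covariant derivatives $D$ with $S^{-1}(R)\subset\ker A_i$ for all $i\in I$. -/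

import Mathlib

open scoped TensorProduct

noncomputable section

namespace QuantumBundle

universe u v w x y z t

/-- A differential calculus `Γ(A)` over the `k`-algebra `A`: an `ℕ`-graded algebra with `Γ⁰(A) = A`,
a differential `d` (a graded derivation of degree one with `d² = 0`), generated as an algebra by `A`
and `dA`. -/
structure DifferentialCalculus (k : Type u) (A : Type v) [Field k] [Ring A] [Algebra k A] where
  /-- the algebra `Γ(A)` of all forms -/
  Form : Type w
  [ring : Ring Form]
  [algebra : Algebra k Form]
  /-- the subspaces `Γⁿ(A)` -/
  deg : ℕ → Submodule k Form
  [graded : GradedAlgebra deg]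
  /-- the identification of `A` with `Γ⁰(A)` -/
  inj : A →ₐ[k] Form
  inj_injective : Function.Injective inj
  range_inj : LinearMap.range inj.toLinearMap = deg 0
  /-- the differential -/
  d : Form →ₗ[k] Form
  d_mem : ∀ (n : ℕ) (ω : Form), ω ∈ deg n → d ω ∈ deg (n + 1)
  d_d : ∀ ω : Form, d (d ω) = 0
  leibniz : ∀ (n : ℕ) (ω η : Form), ω ∈ deg n →
    d (ω * η) = d ω * η + (-1 : k) ^ n • (ω * d η)
  generated : Algebra.adjoin k (Set.range inj ∪ Set.range fun a => d (inj a)) = ⊤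

attribute [instance] DifferentialCalculus.ring DifferentialCalculus.algebra
  DifferentialCalculus.graded

namespace DifferentialCalculus

section Basic

variable {k : Type u} {A : Type v} [Field k] [Ring A] [Algebra k A]
variable (Γ : DifferentialCalculus.{u, v, w} k A)

theorem inj_mem (a : A) : Γ.inj a ∈ Γ.deg 0 := by
  rw [← Γ.range_inj]; exact ⟨a, rfl⟩

theorem d_inj_mem (a : A) : Γ.d (Γ.inj a) ∈ Γ.deg 1 := Γ.d_mem 0 _ (Γ.inj_mem a)

theorem d_inj_mul (a b : A) :
    Γ.d (Γ.inj (a * b)) = Γ.d (Γ.inj a) * Γ.inj b + Γ.inj a * Γ.d (Γ.inj b) := by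
  rw [map_mul, Γ.leibniz 0 _ _ (Γ.inj_mem a)]; simp

theorem d_one : Γ.d 1 = 0 := by
  have h := Γ.d_inj_mul 1 1
  simpa using h

/-- The sign operator, multiplication by `(-1)ⁿ` on `Γⁿ(A)`. -/
def sign : Γ.Form →ₗ[k] Γ.Form :=
  DirectSum.toModule k ℕ Γ.Form (fun n => (-1 : k) ^ n • (Γ.deg n).subtype) ∘ₗ
    (DirectSum.decomposeLinearEquiv Γ.deg).toLinearMap

theorem sign_of_mem {n : ℕ} {ω : Γ.Form} (h : ω ∈ Γ.deg n) : Γ.sign ω = (-1 : k) ^ n • ω := by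
  lift ω to Γ.deg n using h
  simp [sign]

/-- A graded family of subspaces of the `Γⁿ(A)` which contains `A` and `dA` is everything. -/
theorem deg_le (W : ℕ → Submodule k Γ.Form) [SetLike.GradedMonoid W]
    (hW : ∀ n, W n ≤ Γ.deg n) (h0 : ∀ a, Γ.inj a ∈ W 0) (h1 : ∀ a, Γ.d (Γ.inj a) ∈ W 1) (n : ℕ) :
    Γ.deg n ≤ W n := by
  have htop : (DirectSum.coeAlgHom W).range = ⊤ := by
    rw [← top_le_iff, ← Γ.generated]
    refine Algebra.adjoin_le ?_
    rintro _ (⟨a, rfl⟩ | ⟨a, rfl⟩)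
    · exact ⟨DirectSum.of (fun i => W i) 0 ⟨_, h0 a⟩, by simp⟩
    · exact ⟨DirectSum.of (fun i => W i) 1 ⟨_, h1 a⟩, by simp⟩
  intro ω hω
  obtain ⟨z, rfl⟩ : ω ∈ (DirectSum.coeAlgHom W).range := htop ▸ Algebra.mem_top
  have key : ∀ z : DirectSum ℕ (fun i => W i),
      ((DirectSum.decompose Γ.deg (DirectSum.coeAlgHom W z) n : Γ.deg n) : Γ.Form) ∈ W n := by
    intro z
    induction z using DirectSum.induction_on with
    | zero => simp
    | of i y =>
      have hy : DirectSum.coeAlgHom W (DirectSum.of (fun i => W i) i y) = (y : Γ.Form) := by simp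
      rw [hy]
      by_cases h : i = n
      · subst h
        rw [DirectSum.decompose_of_mem_same _ (hW i y.2)]
        exact y.2
      · rw [DirectSum.decompose_of_mem_ne _ (hW i y.2) h]
        exact zero_mem _
    | add x y hx hy =>
      rw [map_add, DirectSum.decompose_add, DirectSum.add_apply, Submodule.coe_add]
      exact add_mem hx hy
  have h : ((DirectSum.decompose Γ.deg _ n : Γ.deg n) : Γ.Form) ∈ W n := key z
  erw [DirectSum.decompose_of_mem_same _ hω] at h
  exact h

end Basic

/-! ### The graded tensor product of two calculi -/

section Tensor

variable {k : Type u} {A : Type v} {C : Type x} [Field k] [Ring A] [Algebra k A] [Ring C]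
  [Algebra k C]
variable (Γ : DifferentialCalculus.{u, v, w} k A) (Λ : DifferentialCalculus.{u, x, y} k C)

/-- The algebra underlying `Γ(A) ⊗̂ Γ(C)`, with the product
`(γ ⊗ ρ)(ω ⊗ τ) = (-1)^{mn} γω ⊗ ρτ` for `ω` of degree `n` and `ρ` of degree `m`. -/
abbrev TensorForm : Type _ := GradedTensorProduct k Γ.deg Λ.deg

variable {Γ Λ} in
/-- `γ ⊗ ρ` as an element of `Γ(A) ⊗̂ Γ(C)`. -/
def tm (γ : Γ.Form) (ρ : Λ.Form) : TensorForm Γ Λ :=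
  GradedTensorProduct.of k Γ.deg Λ.deg (γ ⊗ₜ[k] ρ)

variable {Γ Λ}

theorem tm_add_left (γ γ' : Γ.Form) (ρ : Λ.Form) : tm (γ + γ') ρ = tm γ ρ + tm γ' ρ := by
  simp only [tm, TensorProduct.add_tmul, map_add]

theorem tm_add_right (γ : Γ.Form) (ρ ρ' : Λ.Form) : tm γ (ρ + ρ') = tm γ ρ + tm γ ρ' := by
  simp only [tm, TensorProduct.tmul_add, map_add]

theorem tm_smul_left (c : k) (γ : Γ.Form) (ρ : Λ.Form) : tm (c • γ) ρ = c • tm γ ρ := by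
  simp only [tm, ← TensorProduct.smul_tmul', map_smul]

theorem tm_smul_right (c : k) (γ : Γ.Form) (ρ : Λ.Form) : tm γ (c • ρ) = c • tm γ ρ := by
  simp only [tm, TensorProduct.tmul_smul, map_smul]

theorem tm_zero_left (ρ : Λ.Form) : tm (0 : Γ.Form) ρ = 0 := by
  simp only [tm, TensorProduct.zero_tmul, map_zero]

theorem tm_zero_right (γ : Γ.Form) : tm γ (0 : Λ.Form) = 0 := by
  simp only [tm, TensorProduct.tmul_zero, map_zero]

theorem tm_mul_tm {m n : ℕ} (γ : Γ.Form) {ρ : Λ.Form} (hρ : ρ ∈ Λ.deg m) {ω : Γ.Form}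
    (hω : ω ∈ Γ.deg n) (τ : Λ.Form) :
    tm γ ρ * tm ω τ = (-1 : k) ^ (m * n) • tm (γ * ω) (ρ * τ) := by
  have h := GradedTensorProduct.tmul_coe_mul_coe_tmul (R := k) Γ.deg Λ.deg γ ⟨ρ, hρ⟩ ⟨ω, hω⟩ τ
  refine h.trans ?_
  rw [← uzpow_natCast (R := ℕ)]
  rcases Nat.even_or_odd (m * n) with he | he
  · simp [he.neg_one_pow, tm]
  · simp [he.neg_one_pow, tm]

theorem one_eq_tm : (1 : TensorForm Γ Λ) = tm 1 1 := rfl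

theorem tm_mul_tm_zero {m : ℕ} (γ : Γ.Form) {ρ : Λ.Form} (hρ : ρ ∈ Λ.deg m) {ω : Γ.Form}
    (hω : ω ∈ Γ.deg 0) (τ : Λ.Form) : tm γ ρ * tm ω τ = tm (γ * ω) (ρ * τ) := by
  rw [tm_mul_tm γ hρ hω τ]; simp

/-- Homogeneous decomposable tensors span. -/
theorem tensor_induction {p : TensorForm Γ Λ → Prop} (zero : p 0)
    (add : ∀ a b, p a → p b → p (a + b))
    (hom : ∀ (m n : ℕ) (γ : Γ.Form) (ρ : Λ.Form), γ ∈ Γ.deg m → ρ ∈ Λ.deg n → p (tm γ ρ))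
    (z : TensorForm Γ Λ) : p z := by
  have pure : ∀ (γ : Γ.Form) (ρ : Λ.Form), p (tm γ ρ) := by
    intro γ ρ
    induction γ using DirectSum.Decomposition.inductionOn Γ.deg with
    | zero => rw [tm_zero_left]; exact zero
    | add a b ha hb => rw [tm_add_left]; exact add _ _ ha hb
    | homogeneous a =>
      induction ρ using DirectSum.Decomposition.inductionOn Λ.deg with
      | zero => rw [tm_zero_right]; exact zero
      | add a b ha hb => rw [tm_add_right]; exact add _ _ ha hb
      | homogeneous b => exact hom _ _ _ _ a.2 b.2
  have := TensorProduct.induction_on (motive := fun t => p (GradedTensorProduct.of k Γ.deg Λ.deg t))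
    ((GradedTensorProduct.of k Γ.deg Λ.deg).symm z) (by simpa using zero) pure
    (fun a b ha hb => by rw [map_add]; exact add _ _ ha hb)
  simpa using this

variable (Γ Λ)

/-- Elements of total degree `n`. -/
def tensorDeg (n : ℕ) : Submodule k (TensorForm Γ Λ) :=
  Submodule.span k {z | ∃ (p q : ℕ) (γ : Γ.Form) (ρ : Λ.Form),
    p + q = n ∧ γ ∈ Γ.deg p ∧ ρ ∈ Λ.deg q ∧ z = tm γ ρ}

variable {Γ Λ}

theorem tm_mem_tensorDeg {p q n : ℕ} {γ : Γ.Form} {ρ : Λ.Form} (h : p + q = n)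
    (hγ : γ ∈ Γ.deg p) (hρ : ρ ∈ Λ.deg q) : tm γ ρ ∈ tensorDeg Γ Λ n :=
  Submodule.subset_span ⟨p, q, γ, ρ, h, hγ, hρ, rfl⟩

theorem tensorDeg_mul {m n : ℕ} {a b : TensorForm Γ Λ} (ha : a ∈ tensorDeg Γ Λ m)
    (hb : b ∈ tensorDeg Γ Λ n) : a * b ∈ tensorDeg Γ Λ (m + n) := by
  induction ha using Submodule.span_induction with
  | zero => simp
  | add x y _ _ hx hy => rw [add_mul]; exact add_mem hx hy
  | smul c x _ hx => rw [smul_mul_assoc]; exact Submodule.smul_mem _ _ hx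
  | mem x hx =>
    obtain ⟨p, q, γ, ρ, rfl, hγ, hρ, rfl⟩ := hx
    induction hb using Submodule.span_induction with
    | zero => simp
    | add x y _ _ hx hy => rw [mul_add]; exact add_mem hx hy
    | smul c x _ hx => rw [mul_smul_comm]; exact Submodule.smul_mem _ _ hx
    | mem x hx =>
      obtain ⟨p', q', γ', ρ', rfl, hγ', hρ', rfl⟩ := hx
      rw [tm_mul_tm γ hρ hγ' ρ']
      exact Submodule.smul_mem _ _ (tm_mem_tensorDeg (by omega) (SetLike.mul_mem_graded hγ hγ')
        (SetLike.mul_mem_graded hρ hρ'))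

/-- The homogeneous components of a tensor. -/
def tensorDecompose : TensorForm Γ Λ →ₗ[k] DirectSum ℕ fun n => tensorDeg Γ Λ n :=
  TensorProduct.lift
    (DirectSum.toModule k ℕ _ fun p => LinearMap.flip <| DirectSum.toModule k ℕ _ fun q =>
      LinearMap.mk₂ k (fun (ρ : Λ.deg q) (γ : Γ.deg p) =>
        DirectSum.lof k ℕ (fun n => tensorDeg Γ Λ n) (p + q)
          ⟨tm (γ : Γ.Form) (ρ : Λ.Form), tm_mem_tensorDeg rfl γ.2 ρ.2⟩)
        (fun a b c => by rw [← map_add]; exact congrArg _ (Subtype.ext (tm_add_right _ _ _)))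
        (fun a b c => by rw [← map_smul]; exact congrArg _ (Subtype.ext (tm_smul_right _ _ _)))
        (fun a b c => by rw [← map_add]; exact congrArg _ (Subtype.ext (tm_add_left _ _ _)))
        (fun a b c => by rw [← map_smul]; exact congrArg _ (Subtype.ext (tm_smul_left _ _ _)))) ∘ₗ
  (GradedTensorProduct.auxEquiv k Γ.deg Λ.deg).toLinearMap

theorem tensorDecompose_tm {p q n : ℕ} {γ : Γ.Form} {ρ : Λ.Form} (h : p + q = n)
    (hγ : γ ∈ Γ.deg p) (hρ : ρ ∈ Λ.deg q) :
    tensorDecompose (tm γ ρ) =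
      DirectSum.lof k ℕ (fun n => tensorDeg Γ Λ n) n ⟨tm γ ρ, tm_mem_tensorDeg h hγ hρ⟩ := by
  subst h
  lift γ to Γ.deg p using hγ
  lift ρ to Λ.deg q using hρ
  have h1 : GradedTensorProduct.auxEquiv k Γ.deg Λ.deg (tm (γ : Γ.Form) (ρ : Λ.Form)) =
      DirectSum.lof k ℕ (fun i => Γ.deg i) p γ ⊗ₜ[k] DirectSum.lof k ℕ (fun i => Λ.deg i) q ρ := by
    refine (GradedTensorProduct.auxEquiv_tmul Γ.deg Λ.deg _ _).trans ?_
    rw [DirectSum.decompose_coe, DirectSum.decompose_coe]; rfl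
  rw [tensorDecompose, LinearMap.comp_apply, LinearEquiv.coe_coe, h1, TensorProduct.lift.tmul,
    DirectSum.toModule_lof, LinearMap.flip_apply, DirectSum.toModule_lof]
  rfl

instance tensorGraded : GradedAlgebra (tensorDeg Γ Λ) where
  one_mem := tm_mem_tensorDeg (p := 0) (q := 0) rfl SetLike.GradedOne.one_mem
    SetLike.GradedOne.one_mem
  mul_mem _ _ _ _ ha hb := tensorDeg_mul ha hb
  toDecomposition := DirectSum.Decomposition.ofLinearMap _ tensorDecompose
    (by
      refine LinearMap.ext fun z => ?_
      change DirectSum.coeLinearMap _ (tensorDecompose z) = z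
      induction z using tensor_induction with
      | zero => simp
      | add a b ha hb => rw [map_add, map_add, ha, hb]
      | hom m n γ ρ hγ hρ =>
        rw [tensorDecompose_tm rfl hγ hρ]; simp)
    (by
      ext n ⟨z, hz⟩ : 2
      change tensorDecompose (DirectSum.coeLinearMap _ (DirectSum.lof k ℕ _ n ⟨z, hz⟩)) =
        DirectSum.lof k ℕ _ n ⟨z, hz⟩
      rw [DirectSum.coeLinearMap_lof]
      change tensorDecompose z = _
      induction hz using Submodule.span_induction with
      | zero => rw [map_zero]; exact (map_zero _).symm
      | add x y hx hy ihx ihy => rw [map_add, ihx, ihy, ← map_add]; rfl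
      | smul c x hx ih => rw [map_smul, ih, ← map_smul]; rfl
      | mem x hx =>
        obtain ⟨p, q, γ, ρ, h, hγ, hρ, rfl⟩ := hx
        exact tensorDecompose_tm h hγ hρ)

variable (Γ Λ) in
/-- The differential of `Γ(A) ⊗̂ Γ(C)`: `d(γ ⊗ ρ) = dγ ⊗ ρ + (-1)ⁿ γ ⊗ dρ` for `γ ∈ Γⁿ(A)`. -/
def tensorD : TensorForm Γ Λ →ₗ[k] TensorForm Γ Λ :=
  (GradedTensorProduct.of k Γ.deg Λ.deg).toLinearMap ∘ₗ
    (TensorProduct.map Γ.d LinearMap.id + TensorProduct.map Γ.sign Λ.d) ∘ₗ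
    (GradedTensorProduct.of k Γ.deg Λ.deg).symm.toLinearMap

theorem tensorD_tm {n : ℕ} {γ : Γ.Form} (hγ : γ ∈ Γ.deg n) (ρ : Λ.Form) :
    tensorD Γ Λ (tm γ ρ) = tm (Γ.d γ) ρ + (-1 : k) ^ n • tm γ (Λ.d ρ) := by
  rw [← tm_smul_left, ← Γ.sign_of_mem hγ]
  simp only [tensorD, tm, LinearMap.comp_apply, LinearEquiv.coe_coe,
    GradedTensorProduct.of_symm_of, LinearMap.add_apply, TensorProduct.map_tmul, map_add,
    LinearMap.id_apply]

variable (Γ Λ) in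
/-- The inclusion `A ⊗ C → Γ(A) ⊗̂ Γ(C)`. -/
def tensorInj : A ⊗[k] C →ₐ[k] TensorForm Γ Λ :=
  Algebra.TensorProduct.lift
    ((GradedTensorProduct.includeLeft Γ.deg Λ.deg).comp Γ.inj)
    ((GradedTensorProduct.includeRight Γ.deg Λ.deg).comp Λ.inj)
    (fun a c => by
      change tm (Γ.inj a) 1 * tm 1 (Λ.inj c) = tm 1 (Λ.inj c) * tm (Γ.inj a) 1
      rw [tm_mul_tm_zero _ (SetLike.GradedOne.one_mem) (SetLike.GradedOne.one_mem),
        tm_mul_tm_zero _ (Λ.inj_mem c) (Γ.inj_mem a)]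
      simp)

theorem tensorInj_tmul (a : A) (c : C) :
    tensorInj Γ Λ (a ⊗ₜ c) = tm (Γ.inj a) (Λ.inj c) := by
  rw [tensorInj, Algebra.TensorProduct.lift_tmul]
  change tm (Γ.inj a) 1 * tm 1 (Λ.inj c) = _
  rw [tm_mul_tm_zero _ (SetLike.GradedOne.one_mem) (SetLike.GradedOne.one_mem)]
  simp

theorem tensorInj_eq : (tensorInj Γ Λ).toLinearMap =
    (GradedTensorProduct.of k Γ.deg Λ.deg).toLinearMap ∘ₗ
      TensorProduct.map Γ.inj.toLinearMap Λ.inj.toLinearMap := by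
  exact TensorProduct.ext' fun a c => tensorInj_tmul a c

variable (Γ Λ) in
/-- The differential calculus `Γ(A) ⊗̂ Γ(C)` over `A ⊗ C`. -/
def tensor : DifferentialCalculus k (A ⊗[k] C) where
  Form := TensorForm Γ Λ
  deg := tensorDeg Γ Λ
  inj := tensorInj Γ Λ
  inj_injective := by
    change Function.Injective (tensorInj Γ Λ).toLinearMap
    rw [tensorInj_eq]
    refine (GradedTensorProduct.of k Γ.deg Λ.deg).injective.comp ?_
    exact TensorProduct.map_injective_of_flat_flat _ _ Γ.inj_injective Λ.inj_injective
  range_inj := by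
    apply le_antisymm
    · rintro _ ⟨z, rfl⟩
      induction z using TensorProduct.induction_on with
      | zero => rw [map_zero]; exact zero_mem _
      | add a b ha hb => rw [map_add]; exact add_mem ha hb
      | tmul a c =>
        rw [AlgHom.toLinearMap_apply, tensorInj_tmul]
        exact tm_mem_tensorDeg (by rfl) (Γ.inj_mem a) (Λ.inj_mem c)
    · refine Submodule.span_le.2 ?_
      rintro _ ⟨p, q, γ, ρ, h, hγ, hρ, rfl⟩
      obtain ⟨rfl, rfl⟩ : p = 0 ∧ q = 0 := by omega
      rw [← Γ.range_inj] at hγ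
      rw [← Λ.range_inj] at hρ
      obtain ⟨a, rfl⟩ := hγ
      obtain ⟨c, rfl⟩ := hρ
      exact ⟨a ⊗ₜ c, tensorInj_tmul a c⟩
  d := tensorD Γ Λ
  d_mem n ω hω := by
    induction hω using Submodule.span_induction with
    | zero => rw [map_zero]; exact zero_mem _
    | add x y _ _ hx hy => rw [map_add]; exact add_mem hx hy
    | smul c x _ hx => rw [map_smul]; exact Submodule.smul_mem _ _ hx
    | mem x hx =>
      obtain ⟨p, q, γ, ρ, rfl, hγ, hρ, rfl⟩ := hx
      rw [tensorD_tm hγ]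
      exact add_mem (tm_mem_tensorDeg (by omega) (Γ.d_mem _ _ hγ) hρ)
        (Submodule.smul_mem _ _ (tm_mem_tensorDeg (by omega) hγ (Λ.d_mem _ _ hρ)))
  d_d ω := by
    induction ω using tensor_induction with
    | zero => simp
    | add a b ha hb => rw [map_add, map_add, ha, hb, add_zero]
    | hom m n γ ρ hγ hρ =>
      rw [tensorD_tm hγ, map_add, map_smul, tensorD_tm (Γ.d_mem _ _ hγ), tensorD_tm hγ, Γ.d_d,
        Λ.d_d, tm_zero_left, tm_zero_right, pow_succ]
      module
  leibniz n ω η hω := by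
    induction hω using Submodule.span_induction with
    | zero => simp
    | add x y _ _ hx hy => rw [add_mul, map_add, map_add, hx, hy, add_mul, add_mul]; module
    | smul c x _ hx =>
      rw [smul_mul_assoc, map_smul, map_smul, hx, smul_mul_assoc, smul_mul_assoc]; module
    | mem x hx =>
      obtain ⟨p, q, γ, ρ, rfl, hγ, hρ, rfl⟩ := hx
      induction η using tensor_induction with
      | zero => simp
      | add a b ha hb => rw [mul_add, map_add, map_add, ha, hb, mul_add, mul_add]; module
      | hom p' q' γ' ρ' hγ' hρ' =>
        rw [tm_mul_tm γ hρ hγ' ρ', map_smul, tensorD_tm (SetLike.mul_mem_graded hγ hγ'),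
          tensorD_tm hγ, tensorD_tm hγ', add_mul, mul_add, smul_mul_assoc, mul_smul_comm,
          tm_mul_tm _ hρ hγ', tm_mul_tm _ (Λ.d_mem _ _ hρ) hγ', tm_mul_tm _ hρ (Γ.d_mem _ _ hγ'),
          tm_mul_tm _ hρ hγ', Γ.leibniz p _ _ hγ, Λ.leibniz q _ _ hρ, tm_add_left, tm_add_right,
          tm_smul_left, tm_smul_right]
        have e1 : ((-1 : k) ^ q) * (-1) ^ q = 1 := by rw [← mul_pow]; simp
        have e2 : (-1 : k) ^ (q * p') * (-1) ^ p = (-1) ^ (p + q) * (-1) ^ (q * (p' + 1)) := by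
          rw [mul_add, mul_one, pow_add, pow_add]
          linear_combination (-(-1 : k) ^ p * (-1) ^ (q * p')) * e1
        have e3 : (-1 : k) ^ (q * p') * (-1) ^ (p + p') = (-1) ^ p * (-1) ^ ((q + 1) * p') := by
          rw [add_mul, one_mul, pow_add, pow_add]; ring
        have e4 : (-1 : k) ^ (q * p') * ((-1) ^ (p + p') * (-1) ^ q) =
            (-1) ^ (p + q) * ((-1) ^ p' * (-1) ^ (q * p')) := by
          rw [pow_add, pow_add]; ring
        simp only [smul_add, smul_smul]
        rw [e2, e3, e4]
        abel
  generated := by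
    set S := Algebra.adjoin k (Set.range (tensorInj Γ Λ) ∪
      Set.range fun z => tensorD Γ Λ (tensorInj Γ Λ z)) with hS
    have hl : ∀ γ : Γ.Form, tm γ 1 ∈ S := by
      have : (⊤ : Subalgebra k Γ.Form) ≤
          S.comap (GradedTensorProduct.includeLeft Γ.deg Λ.deg) := by
        rw [← Γ.generated]
        refine Algebra.adjoin_le ?_
        rintro _ (⟨a, rfl⟩ | ⟨a, rfl⟩)
        · refine Algebra.subset_adjoin (Or.inl ⟨a ⊗ₜ 1, ?_⟩)
          rw [tensorInj_tmul, map_one]; rfl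
        · refine Algebra.subset_adjoin (Or.inr ⟨a ⊗ₜ 1, ?_⟩)
          dsimp only
          rw [tensorInj_tmul, map_one, tensorD_tm (Γ.inj_mem a), Λ.d_one, tm_zero_right, smul_zero,
            add_zero]; rfl
      exact fun γ => this Algebra.mem_top
    have hr : ∀ ρ : Λ.Form, tm 1 ρ ∈ S := by
      have : (⊤ : Subalgebra k Λ.Form) ≤
          S.comap (GradedTensorProduct.includeRight Γ.deg Λ.deg) := by
        rw [← Λ.generated]
        refine Algebra.adjoin_le ?_
        rintro _ (⟨a, rfl⟩ | ⟨a, rfl⟩)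
        · refine Algebra.subset_adjoin (Or.inl ⟨1 ⊗ₜ a, ?_⟩)
          rw [tensorInj_tmul, map_one]; rfl
        · refine Algebra.subset_adjoin (Or.inr ⟨1 ⊗ₜ a, ?_⟩)
          dsimp only
          rw [tensorInj_tmul, map_one, tensorD_tm SetLike.GradedOne.one_mem, Γ.d_one, tm_zero_left,
            pow_zero, one_smul, zero_add]; rfl
      exact fun ρ => this Algebra.mem_top
    rw [← top_le_iff]
    intro z _
    induction z using tensor_induction with
    | zero => exact zero_mem _
    | add a b ha hb => exact add_mem (ha Algebra.mem_top) (hb Algebra.mem_top)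
    | hom m n γ ρ hγ hρ =>
      have : tm γ ρ = tm γ 1 * tm 1 ρ := by
        rw [tm_mul_tm_zero _ (SetLike.GradedOne.one_mem) (SetLike.GradedOne.one_mem)]; simp
      rw [this]
      exact mul_mem (hl γ) (hr ρ)

end Tensor

end DifferentialCalculus

/-! ### Coactions and right covariant calculi -/

/-- A right `H`-comodule algebra structure on `P`. -/
structure RightCoaction (k : Type u) (H : Type v) (P : Type w) [Field k] [Ring H] [HopfAlgebra k H]
    [Ring P] [Algebra k P] where
  /-- the coaction `Δ_P : P → P ⊗ H`, a homomorphism of algebras -/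
  coact : P →ₐ[k] P ⊗[k] H
  coassoc : ∀ p : P, TensorProduct.assoc k P H H (coact.toLinearMap.rTensor H (coact p)) =
    (Coalgebra.comul (R := k) (A := H)).lTensor P (coact p)
  counit : ∀ p : P,
    TensorProduct.rid k P ((Coalgebra.counit (R := k) (A := H)).lTensor P (coact p)) = p

/-- A right covariant structure on a differential calculus over the Hopf algebra `H`: a right
`H`-comodule algebra structure on `Γ(H)` with
`Δ^Γ(h₀ dh₁ ⋯ dhₙ) = Δ(h₀) (d ⊗ id)Δ(h₁) ⋯ (d ⊗ id)Δ(hₙ)`. -/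
structure RightCovariant {k : Type u} {H : Type v} [Field k] [Ring H] [HopfAlgebra k H]
    (Λ : DifferentialCalculus.{u, v, w} k H) extends RightCoaction k H Λ.Form where
  coact_inj : ∀ h : H, coact (Λ.inj h) = Λ.inj.toLinearMap.rTensor H (Coalgebra.comul (R := k) h)
  coact_d : ∀ h : H, coact (Λ.d (Λ.inj h)) =
    (Λ.d ∘ₗ Λ.inj.toLinearMap).rTensor H (Coalgebra.comul (R := k) h)

section Contract

variable {k : Type u} {H : Type v} {M : Type w} {N : Type x} [Field k] [AddCommGroup H] [Module k H]
  [AddCommGroup M] [Module k M] [AddCommGroup N] [Module k N]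

/-- `id ⊗ φ : M ⊗ H → M` for a functional `φ` on `H`. -/
def contract (φ : H →ₗ[k] k) : M ⊗[k] H →ₗ[k] M :=
  (TensorProduct.rid k M).toLinearMap ∘ₗ φ.lTensor M

@[simp] theorem contract_tmul (φ : H →ₗ[k] k) (m : M) (h : H) :
    contract φ (m ⊗ₜ[k] h) = φ h • m := by
  simp [contract]

theorem contract_rTensor (φ : H →ₗ[k] k) (f : M →ₗ[k] N) (z : M ⊗[k] H) :
    contract φ (f.rTensor H z) = f (contract φ z) := by
  induction z using TensorProduct.induction_on with
  | zero => simp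
  | add a b ha hb => simp only [map_add, ha, hb]
  | tmul m h => simp

theorem eq_zero_of_contract {z : M ⊗[k] H} (h : ∀ φ : H →ₗ[k] k, contract φ z = 0) : z = 0 := by
  classical
  let b := Module.Basis.ofVectorSpace k H
  apply (TensorProduct.equivFinsuppOfBasisRight (M := M) b).injective
  rw [map_zero]
  ext i
  have key : ∀ z : M ⊗[k] H,
      TensorProduct.equivFinsuppOfBasisRight (M := M) b z i = contract (b.coord i) z := by
    intro z
    induction z using TensorProduct.induction_on with
    | zero => simp
    | add a b ha hb => simp only [map_add, Finsupp.add_apply, ha, hb]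
    | tmul m h => rw [TensorProduct.equivFinsuppOfBasisRight_apply_tmul_apply]; simp
  rw [key, h]; rfl

/-- A tensor all of whose contractions lie in `N` comes from `N ⊗ H`. -/
theorem mem_range_of_contract (N : Submodule k M) {z : M ⊗[k] H}
    (h : ∀ φ : H →ₗ[k] k, contract φ z ∈ N) : z ∈ LinearMap.range (N.subtype.rTensor H) := by
  have hex := rTensor_exact H (LinearMap.exact_subtype_mkQ N) N.mkQ_surjective
  rw [← hex.linearMap_ker_eq, LinearMap.mem_ker]
  refine eq_zero_of_contract fun φ => ?_
  rw [contract_rTensor, Submodule.mkQ_apply, Submodule.Quotient.mk_eq_zero]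
  exact h φ

theorem rTensor_subtype_injective (N : Submodule k M) :
    Function.Injective (N.subtype.rTensor H) :=
  Module.Flat.rTensor_preserves_injective_linearMap _ N.injective_subtype

/-- The restriction `N → N ⊗ H` of a map `δ : M → M ⊗ H` to a subspace `N` with `δ(N) ⊆ N ⊗ H`
(the latter being expressed through contractions). -/
def restrictCoaction (δ : M →ₗ[k] M ⊗[k] H) (N : Submodule k M)
    (hN : ∀ φ : H →ₗ[k] k, ∀ m ∈ N, contract φ (δ m) ∈ N) : N →ₗ[k] N ⊗[k] H :=
  (LinearEquiv.ofInjective (N.subtype.rTensor H) (rTensor_subtype_injective N)).symm.toLinearMap ∘ₗ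
    (δ ∘ₗ N.subtype).codRestrict (LinearMap.range (N.subtype.rTensor H))
      fun m => mem_range_of_contract N fun φ => hN φ m m.2

theorem rTensor_restrictCoaction (δ : M →ₗ[k] M ⊗[k] H) (N : Submodule k M)
    (hN : ∀ φ : H →ₗ[k] k, ∀ m ∈ N, contract φ (δ m) ∈ N) (m : N) :
    N.subtype.rTensor H (restrictCoaction δ N hN m) = δ m := by
  have := LinearEquiv.apply_symm_apply
    (LinearEquiv.ofInjective (N.subtype.rTensor H) (rTensor_subtype_injective N))
    ((δ ∘ₗ N.subtype).codRestrict (LinearMap.range (N.subtype.rTensor H))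
      (fun m => mem_range_of_contract N fun φ => hN φ m m.2) m)
  exact congrArg Subtype.val this

end Contract

namespace DifferentialCalculus

section TensorCoaction

variable {k : Type u} {A : Type v} {H : Type x} [Field k] [Ring A] [Algebra k A] [Ring H]
  [HopfAlgebra k H]
variable {Γ : DifferentialCalculus.{u, v, w} k A} {Λ : DifferentialCalculus.{u, x, y} k H}
variable (cov : RightCovariant Λ)


theorem coact_mem {n : ℕ} {θ : Λ.Form} (hθ : θ ∈ Λ.deg n) :
    cov.coact θ ∈ LinearMap.range ((Λ.deg n).subtype.rTensor H) := by
  let W : ℕ → Submodule k Λ.Form := fun n =>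
    Λ.deg n ⊓ (LinearMap.range ((Λ.deg n).subtype.rTensor H)).comap cov.coact.toLinearMap
  have hmul : ∀ (m n : ℕ) (z : Λ.deg m ⊗[k] H) (z' : Λ.deg n ⊗[k] H),
      (Λ.deg m).subtype.rTensor H z * (Λ.deg n).subtype.rTensor H z' ∈
        LinearMap.range ((Λ.deg (m + n)).subtype.rTensor H) := by
    intro m n z z'
    induction z using TensorProduct.induction_on with
    | zero => simp
    | add a b ha hb => rw [map_add, add_mul]; exact add_mem ha hb
    | tmul a h =>
      induction z' using TensorProduct.induction_on with
      | zero => simp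
      | add a b ha hb => rw [map_add, mul_add]; exact add_mem ha hb
      | tmul a' h' =>
        exact ⟨(⟨a * a', SetLike.mul_mem_graded a.2 a'.2⟩ : Λ.deg (m + n)) ⊗ₜ (h * h'), by simp⟩
  have hW : SetLike.GradedMonoid W :=
    { one_mem := by
        refine ⟨SetLike.GradedOne.one_mem, ?_⟩
        refine ⟨(⟨1, SetLike.GradedOne.one_mem⟩ : Λ.deg 0) ⊗ₜ 1, ?_⟩
        simp [Algebra.TensorProduct.one_def]
      mul_mem := by
        rintro m n a b ⟨ha, z, hz⟩ ⟨hb, z', hz'⟩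
        refine ⟨SetLike.mul_mem_graded ha hb, ?_⟩
        rw [AlgHom.toLinearMap_apply] at hz hz'
        rw [SetLike.mem_coe, Submodule.mem_comap, AlgHom.toLinearMap_apply, map_mul, ← hz, ← hz']
        exact hmul m n z z' }
  have hr : ∀ (n : ℕ) (f : H →ₗ[k] Λ.Form) (_ : ∀ h, f h ∈ Λ.deg n) (z : H ⊗[k] H),
      f.rTensor H z ∈ LinearMap.range ((Λ.deg n).subtype.rTensor H) := by
    intro n f hf z
    refine mem_range_of_contract _ fun φ => ?_
    rw [contract_rTensor]
    exact hf _
  have := Λ.deg_le W (fun n => inf_le_left)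
    (fun a => ⟨Λ.inj_mem a, by
      rw [SetLike.mem_coe, Submodule.mem_comap, AlgHom.toLinearMap_apply, cov.coact_inj]
      exact hr _ _ (fun h => Λ.inj_mem h) _⟩)
    (fun a => ⟨Λ.d_inj_mem a, by
      rw [SetLike.mem_coe, Submodule.mem_comap, AlgHom.toLinearMap_apply, cov.coact_d]
      exact hr _ _ (fun h => Λ.d_inj_mem h) _⟩) n hθ
  exact this.2

theorem contract_coact_mem {n : ℕ} {θ : Λ.Form} (hθ : θ ∈ Λ.deg n) (φ : H →ₗ[k] k) :
    contract φ (cov.coact θ) ∈ Λ.deg n := by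
  obtain ⟨z, hz⟩ := coact_mem cov hθ
  rw [← hz, contract_rTensor]
  exact (contract φ z).2

variable (Γ)

/-- The coaction `id ⊗ Δ^Γ` of `H` on `Γ(A) ⊗̂ Γ(H)`. -/
def tensorCoact : TensorForm Γ Λ →ₐ[k] TensorForm Γ Λ ⊗[k] H :=
  GradedTensorProduct.lift Γ.deg Λ.deg
    (Algebra.TensorProduct.includeLeft.comp (GradedTensorProduct.includeLeft Γ.deg Λ.deg))
    ((Algebra.TensorProduct.map (GradedTensorProduct.includeRight Γ.deg Λ.deg)
      (AlgHom.id k H)).comp cov.coact)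
    (by
      intro i j a b
      obtain ⟨z, hz⟩ := coact_mem cov b.2
      change (tm (a : Γ.Form) (1 : Λ.Form) ⊗ₜ[k] (1 : H)) * _ =
        (-1 : ℤˣ) ^ (j * i) • (_ * (tm (a : Γ.Form) (1 : Λ.Form) ⊗ₜ[k] (1 : H)))
      rw [AlgHom.comp_apply, ← hz]
      clear hz
      induction z using TensorProduct.induction_on with
      | zero => simp
      | add x y hx hy => simp only [map_add, mul_add, add_mul, smul_add, hx, hy]
      | tmul c h =>
        rw [LinearMap.rTensor_tmul, Algebra.TensorProduct.map_tmul]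
        change (tm (a : Γ.Form) (1 : Λ.Form) ⊗ₜ[k] (1 : H)) *
          (tm (1 : Γ.Form) (c : Λ.Form) ⊗ₜ[k] h) = (-1 : ℤˣ) ^ (j * i) •
          ((tm (1 : Γ.Form) (c : Λ.Form) ⊗ₜ[k] h) * (tm (a : Γ.Form) (1 : Λ.Form) ⊗ₜ[k] (1 : H)))
        rw [Algebra.TensorProduct.tmul_mul_tmul, Algebra.TensorProduct.tmul_mul_tmul,
          tm_mul_tm_zero _ SetLike.GradedOne.one_mem SetLike.GradedOne.one_mem,
          tm_mul_tm _ c.2 a.2, ← uzpow_natCast (R := ℕ)]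
        rcases Nat.even_or_odd (j * i) with he | he
        · simp [he.neg_one_pow]
        · simp [he.neg_one_pow, TensorProduct.neg_tmul])

variable {Γ}

/-- `ρ ↦ tm γ ρ` as a linear map. -/
def tmRight (Λ : DifferentialCalculus.{u, x, y} k H) (γ : Γ.Form) : Λ.Form →ₗ[k] TensorForm Γ Λ where
  toFun := tm γ
  map_add' := tm_add_right γ
  map_smul' c := tm_smul_right c γ

theorem tensorCoact_tm (γ : Γ.Form) (θ : Λ.Form) :
    tensorCoact Γ cov (tm γ θ) = (tmRight Λ γ).rTensor H (cov.coact θ) := by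
  refine (GradedTensorProduct.lift_tmul Γ.deg Λ.deg _ _ _ γ θ).trans ?_
  change (tm γ (1 : Λ.Form) ⊗ₜ[k] (1 : H)) * Algebra.TensorProduct.map
    (GradedTensorProduct.includeRight Γ.deg Λ.deg) (AlgHom.id k H) (cov.coact θ) = _
  generalize cov.coact θ = z
  induction z using TensorProduct.induction_on with
  | zero => simp
  | add x y hx hy => simp only [map_add, mul_add, hx, hy]
  | tmul c h =>
    rw [LinearMap.rTensor_tmul, Algebra.TensorProduct.map_tmul]
    change (tm (γ : Γ.Form) (1 : Λ.Form) ⊗ₜ[k] (1 : H)) *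
          (tm (1 : Γ.Form) (c : Λ.Form) ⊗ₜ[k] h) = tm γ c ⊗ₜ h
    rw [Algebra.TensorProduct.tmul_mul_tmul,
      tm_mul_tm_zero _ SetLike.GradedOne.one_mem SetLike.GradedOne.one_mem]
    simp

theorem contract_tensorCoact_tm (φ : H →ₗ[k] k) (γ : Γ.Form) (θ : Λ.Form) :
    contract φ (tensorCoact Γ cov (tm γ θ)) = tm γ (contract φ (cov.coact θ)) := by
  rw [tensorCoact_tm, contract_rTensor]; rfl

theorem contract_tensorCoact_mem (φ : H →ₗ[k] k) {n : ℕ} {z : TensorForm Γ Λ}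
    (hz : z ∈ tensorDeg Γ Λ n) : contract φ (tensorCoact Γ cov z) ∈ tensorDeg Γ Λ n := by
  induction hz using Submodule.span_induction with
  | zero => simp
  | add x y _ _ hx hy => rw [map_add, map_add]; exact add_mem hx hy
  | smul c x _ hx => rw [map_smul, map_smul]; exact Submodule.smul_mem _ _ hx
  | mem x hx =>
    obtain ⟨p, q, γ, ρ, h, hγ, hρ, rfl⟩ := hx
    rw [contract_tensorCoact_tm]
    exact tm_mem_tensorDeg h hγ (contract_coact_mem cov hρ φ)

theorem tensorCoact_inj (z : A ⊗[k] H) : tensorCoact Γ cov (tensorInj Γ Λ z) =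
    (tensorInj Γ Λ).toLinearMap.rTensor H ((TensorProduct.assoc k A H H).symm
      ((Coalgebra.comul (R := k) (A := H)).lTensor A z)) := by
  induction z using TensorProduct.induction_on with
  | zero => simp
  | add x y hx hy => simp only [map_add, hx, hy]
  | tmul a h =>
    rw [tensorInj_tmul, tensorCoact_tm, cov.coact_inj, LinearMap.lTensor_tmul]
    generalize Coalgebra.comul (R := k) h = w
    induction w using TensorProduct.induction_on with
    | zero => simp
    | add x y hx hy => simp only [map_add, TensorProduct.tmul_add, hx, hy]
    | tmul h h' =>
      simp only [LinearMap.rTensor_tmul, TensorProduct.assoc_symm_tmul, AlgHom.toLinearMap_apply,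
        tensorInj_tmul]
      rfl

theorem tensorCoact_d (z : A ⊗[k] H) : tensorCoact Γ cov (tensorD Γ Λ (tensorInj Γ Λ z)) =
    (tensorD Γ Λ ∘ₗ (tensorInj Γ Λ).toLinearMap).rTensor H ((TensorProduct.assoc k A H H).symm
      ((Coalgebra.comul (R := k) (A := H)).lTensor A z)) := by
  induction z using TensorProduct.induction_on with
  | zero => simp
  | add x y hx hy => simp only [map_add, hx, hy]
  | tmul a h =>
    rw [tensorInj_tmul, tensorD_tm (Γ.inj_mem a), map_add, map_smul, tensorCoact_tm, tensorCoact_tm,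
      cov.coact_inj, cov.coact_d, LinearMap.lTensor_tmul]
    generalize Coalgebra.comul (R := k) h = w
    induction w using TensorProduct.induction_on with
    | zero => simp
    | add x y hx hy =>
      simp only [map_add, TensorProduct.tmul_add, ← hx, ← hy, smul_add]
      abel
    | tmul h h' =>
      simp only [LinearMap.rTensor_tmul, TensorProduct.assoc_symm_tmul, AlgHom.toLinearMap_apply,
        tensorInj_tmul, LinearMap.comp_apply, tensorD_tm (Γ.inj_mem a), pow_zero, one_smul,
        TensorProduct.add_tmul]
      rfl

end TensorCoaction

end DifferentialCalculus

/-! ### The universal calculus, coverings and adapted calculi -/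

section Universal

variable {k : Type u} {A : Type v} [Field k] [Ring A] [Algebra k A]

variable (k A) in
/-- The relations between the generators `a` (left summand) and `da` (right summand) of the universal
differential calculus: the algebra structure of `A`, linearity of `d` and the Leibniz rule. -/
inductive UniversalRel : FreeAlgebra k (A ⊕ A) → FreeAlgebra k (A ⊕ A) → Prop
  | scalar (c : k) : UniversalRel (FreeAlgebra.ι k (Sum.inl (algebraMap k A c)))
      (algebraMap k (FreeAlgebra k (A ⊕ A)) c)
  | plus (a b : A) : UniversalRel (FreeAlgebra.ι k (Sum.inl (a + b)))
      (FreeAlgebra.ι k (Sum.inl a) + FreeAlgebra.ι k (Sum.inl b))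
  | times (a b : A) : UniversalRel (FreeAlgebra.ι k (Sum.inl (a * b)))
      (FreeAlgebra.ι k (Sum.inl a) * FreeAlgebra.ι k (Sum.inl b))
  | d_plus (a b : A) : UniversalRel (FreeAlgebra.ι k (Sum.inr (a + b)))
      (FreeAlgebra.ι k (Sum.inr a) + FreeAlgebra.ι k (Sum.inr b))
  | d_smul (c : k) (a : A) : UniversalRel (FreeAlgebra.ι k (Sum.inr (c • a)))
      (c • FreeAlgebra.ι k (Sum.inr a))
  | d_times (a b : A) : UniversalRel (FreeAlgebra.ι k (Sum.inr (a * b)))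
      (FreeAlgebra.ι k (Sum.inr a) * FreeAlgebra.ι k (Sum.inl b) +
        FreeAlgebra.ι k (Sum.inl a) * FreeAlgebra.ι k (Sum.inr b))

variable (k A) in
/-- The algebra `Ω(A)` of universal differential forms: the algebra generated by `A` and symbols
`da` which are linear in `a` and satisfy the Leibniz rule. -/
abbrev UniversalForms : Type _ := RingQuot (UniversalRel k A)

namespace UniversalForms

variable (k) in
/-- The inclusion `A → Ω(A)`. -/
def inj : A →ₐ[k] UniversalForms k A where
  toFun a := RingQuot.mkAlgHom k (UniversalRel k A) (FreeAlgebra.ι k (Sum.inl a))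
  map_one' := by
    have := RingQuot.mkAlgHom_rel k (UniversalRel.scalar (k := k) (A := A) 1)
    simpa using this
  map_mul' a b := by rw [RingQuot.mkAlgHom_rel k (UniversalRel.times a b), map_mul]
  map_zero' := by
    have := RingQuot.mkAlgHom_rel k (UniversalRel.scalar (k := k) (A := A) 0)
    simpa using this
  map_add' a b := by rw [RingQuot.mkAlgHom_rel k (UniversalRel.plus a b), map_add]
  commutes' c := by rw [RingQuot.mkAlgHom_rel k (UniversalRel.scalar c), AlgHom.commutes]

variable (k) in
/-- The differential `A → Ω¹(A)`. -/
def d : A →ₗ[k] UniversalForms k A where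
  toFun a := RingQuot.mkAlgHom k (UniversalRel k A) (FreeAlgebra.ι k (Sum.inr a))
  map_add' a b := by rw [RingQuot.mkAlgHom_rel k (UniversalRel.d_plus a b), map_add]
  map_smul' c a := by
    rw [RingQuot.mkAlgHom_rel k (UniversalRel.d_smul c a), map_smul, RingHom.id_apply]

theorem d_mul (a b : A) : d k (a * b) = d k a * inj k b + inj k a * d k b := by
  change RingQuot.mkAlgHom k (UniversalRel k A) _ = _
  rw [RingQuot.mkAlgHom_rel k (UniversalRel.d_times a b), map_add, map_mul, map_mul]; rfl

variable {T : Type w} [Ring T] [Algebra k T]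

/-- The universal property of `Ω(A)`. -/
def lift (f : A →ₐ[k] T) (δ : A →ₗ[k] T) (h : ∀ a b, δ (a * b) = δ a * f b + f a * δ b) :
    UniversalForms k A →ₐ[k] T :=
  RingQuot.liftAlgHom k ⟨FreeAlgebra.lift k (Sum.elim f δ), by
    intro x y hxy
    cases hxy <;> simp [h]⟩

@[simp] theorem lift_inj (f : A →ₐ[k] T) (δ : A →ₗ[k] T)
    (h : ∀ a b, δ (a * b) = δ a * f b + f a * δ b) (a : A) : lift f δ h (inj k a) = f a := by
  refine (RingQuot.liftAlgHom_mkAlgHom_apply _ _ _ _).trans ?_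
  simp

@[simp] theorem lift_d (f : A →ₐ[k] T) (δ : A →ₗ[k] T)
    (h : ∀ a b, δ (a * b) = δ a * f b + f a * δ b) (a : A) : lift f δ h (d k a) = δ a := by
  refine (RingQuot.liftAlgHom_mkAlgHom_apply _ _ _ _).trans ?_
  simp

theorem hom_ext {f g : UniversalForms k A →ₐ[k] T} (h0 : ∀ a, f (inj k a) = g (inj k a))
    (h1 : ∀ a, f (d k a) = g (d k a)) : f = g := by
  apply RingQuot.ringQuot_ext'
  apply FreeAlgebra.hom_ext
  funext x
  rcases x with a | a
  · exact h0 a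
  · exact h1 a

end UniversalForms

end Universal

section Covering

variable {k : Type u} {A : Type v} {I : Type w} [Field k] [Ring A] [Algebra k A]

instance sup_isTwoSided (K L : Ideal A) [K.IsTwoSided] [L.IsTwoSided] : (K ⊔ L).IsTwoSided := by
  refine ⟨fun {a} b ha => ?_⟩
  obtain ⟨x, hx, y, hy, rfl⟩ := Submodule.mem_sup.1 ha
  rw [add_mul]
  exact Submodule.add_mem_sup (K.mul_mem_right b hx) (L.mul_mem_right b hy)

variable (k) in
/-- The covering completion of `A` with respect to a family of ideals: the gluing of the algebras
`A/Kᵢ` along the algebras `A/(Kᵢ + Kⱼ)`. -/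
def coveringCompletion (K : I → Ideal A) [∀ i, (K i).IsTwoSided] :
    Subalgebra k (∀ i, A ⧸ K i) where
  carrier := {b | ∀ i j,
    Ideal.Quotient.factor (le_sup_left : K i ≤ K i ⊔ K j) (b i) =
      Ideal.Quotient.factor (le_sup_right : K j ≤ K i ⊔ K j) (b j)}
  mul_mem' ha hb i j := by simp only [Pi.mul_apply, map_mul, ha i j, hb i j]
  add_mem' ha hb i j := by simp only [Pi.add_apply, map_add, ha i j, hb i j]
  algebraMap_mem' c i j := rfl

variable (k) in
/-- The family `K` of ideals is a complete covering of `A`: the intersection of the `Kᵢ` vanishes and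
every element of the covering completion comes from `A`. -/
def IsCompleteCovering (K : I → Ideal A) [∀ i, (K i).IsTwoSided] : Prop :=
  ⨅ i, K i = ⊥ ∧ ∀ b ∈ coveringCompletion k K, ∃ a : A, ∀ i, Ideal.Quotient.mk (K i) a = b i

end Covering

section Adapted

variable {k : Type u} {A : Type v} {I : Type w} [Field k] [Ring A] [Algebra k A]
variable {C : I → Type x} [∀ i, Ring (C i)] [∀ i, Algebra k (C i)]
variable (f : ∀ i, A →ₐ[k] C i) (Γ : ∀ i, DifferentialCalculus.{u, x, y} k (C i))

/-- The extension `Ω(A) → Γ(Cᵢ)` of `fᵢ : A → Cᵢ`. -/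
def extUniversal (i : I) : UniversalForms k A →ₐ[k] (Γ i).Form :=
  UniversalForms.lift ((Γ i).inj.comp (f i)) ((Γ i).d ∘ₗ (Γ i).inj.toLinearMap ∘ₗ (f i).toLinearMap)
    (fun a b => by
      simp only [LinearMap.comp_apply, AlgHom.toLinearMap_apply, AlgHom.comp_apply, map_mul (f i),
        (Γ i).d_inj_mul])

@[simp] theorem extUniversal_inj (i : I) (a : A) :
    extUniversal f Γ i (UniversalForms.inj k a) = (Γ i).inj (f i a) :=
  UniversalForms.lift_inj _ _ _ a

@[simp] theorem extUniversal_d (i : I) (a : A) :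
    extUniversal f Γ i (UniversalForms.d k a) = (Γ i).d ((Γ i).inj (f i a)) :=
  UniversalForms.lift_d _ _ _ a

/-- The ideal `J(A) = ⋂ᵢ ker (Ω(A) → Γ(Cᵢ))`. -/
def adaptedIdeal : Ideal (UniversalForms k A) := ⨅ i, RingHom.ker (extUniversal f Γ i)

instance : (adaptedIdeal f Γ).IsTwoSided :=
  inferInstanceAs (⨅ i, RingHom.ker (extUniversal f Γ i)).IsTwoSided

/-- The algebra `Γ(A) = Ω(A)/J(A)` of the differential calculus over `A` adapted to the calculi
`Γ(Cᵢ)`. -/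
abbrev AdaptedForms : Type _ := UniversalForms k A ⧸ adaptedIdeal f Γ

/-- The extension `Γ(A) → Γ(Cᵢ)` of `fᵢ : A → Cᵢ`. -/
def extForm (i : I) : AdaptedForms f Γ →ₐ[k] (Γ i).Form :=
  Ideal.Quotient.liftₐ (adaptedIdeal f Γ) (extUniversal f Γ i)
    (fun _ ha => (Submodule.mem_iInf _).1 ha i)

/-- The covering completion `Γ_c(A)` of `Γ(A)` with respect to the kernels of `Γ(A) → Γ(Cᵢ)`. It is
regarded as an algebra of families `(γᵢ)` of forms `γᵢ ∈ Γ(Cᵢ)`, by means of the embeddings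
`Γ(A)/ker → Γ(Cᵢ)`; the extension `Γ_c(A) → Γ(Cᵢ)` of `fᵢ` is then the projection `γ ↦ γᵢ`, and the
product, the grading and the differential are those of the components. -/
def localForms : Subalgebra k (∀ i, (Γ i).Form) :=
  (coveringCompletion k fun i => RingHom.ker (extForm f Γ i)).map
    (AlgHom.pi fun i => (Ideal.kerLiftAlg (extForm f Γ i)).comp (Pi.evalAlgHom k _ i))

theorem mem_localForms {γ : ∀ i, (Γ i).Form} : γ ∈ localForms f Γ ↔
    ∀ i j, ∃ ω : UniversalForms k A, extUniversal f Γ i ω = γ i ∧ extUniversal f Γ j ω = γ j := by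
  constructor
  · rintro ⟨b, hb, rfl⟩ i j
    obtain ⟨x, hx⟩ := Ideal.Quotient.mk_surjective (b i)
    obtain ⟨y, hy⟩ := Ideal.Quotient.mk_surjective (b j)
    have h := hb i j
    rw [← hx, ← hy, Ideal.Quotient.factor_mk, Ideal.Quotient.factor_mk, Ideal.Quotient.eq] at h
    obtain ⟨u, hu, v, hv, huv⟩ := Submodule.mem_sup.1 h
    obtain ⟨ω, hω⟩ := Ideal.Quotient.mk_surjective (x - u)
    have hu' : extForm f Γ i u = 0 := hu
    have hv' : extForm f Γ j v = 0 := hv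
    have e1 : extForm f Γ i (x - u) = extForm f Γ i x := by rw [map_sub, hu', sub_zero]
    have e2 : extForm f Γ j (x - u) = extForm f Γ j y := by
      have hxy : x - u = y + v := by
        rw [eq_sub_iff_add_eq] at huv
        rw [← huv]; abel
      rw [hxy, map_add, hv', add_zero]
    refine ⟨ω, ?_, ?_⟩
    · have : extUniversal f Γ i ω = extForm f Γ i (Ideal.Quotient.mk _ ω) := rfl
      rw [this, hω, e1]
      change _ = Ideal.kerLiftAlg (extForm f Γ i) (b i)
      rw [← hx]; rfl
    · have : extUniversal f Γ j ω = extForm f Γ j (Ideal.Quotient.mk _ ω) := rfl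
      rw [this, hω, e2]
      change _ = Ideal.kerLiftAlg (extForm f Γ j) (b j)
      rw [← hy]; rfl
  · intro h
    choose ω hω using h
    refine ⟨fun i => Ideal.Quotient.mk _ (Ideal.Quotient.mk _ (ω i i)), ?_, ?_⟩
    · intro i j
      rw [Ideal.Quotient.factor_mk, Ideal.Quotient.factor_mk, Ideal.Quotient.eq, Submodule.mem_sup]
      refine ⟨Ideal.Quotient.mk _ (ω i i) - Ideal.Quotient.mk _ (ω i j), ?_,
        Ideal.Quotient.mk _ (ω i j) - Ideal.Quotient.mk _ (ω j j), ?_, by abel⟩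
      · change extForm f Γ i _ = 0
        rw [map_sub]
        change extUniversal f Γ i _ - extUniversal f Γ i _ = 0
        rw [(hω i i).1, (hω i j).1, sub_self]
      · change extForm f Γ j _ = 0
        rw [map_sub]
        change extUniversal f Γ j _ - extUniversal f Γ j _ = 0
        rw [(hω j j).1, (hω i j).2, sub_self]
    · funext i
      exact (hω i i).1

/-- The differential, componentwise. -/
def localD : (∀ i, (Γ i).Form) →ₗ[k] ∀ i, (Γ i).Form := LinearMap.pi fun i => (Γ i).d ∘ₗ LinearMap.proj i

@[simp] theorem localD_apply (γ : ∀ i, (Γ i).Form) (i : I) : localD Γ γ i = (Γ i).d (γ i) := rfl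

/-- The families of forms of degree `n`. -/
def localDeg (n : ℕ) : Submodule k (∀ i, (Γ i).Form) := Submodule.pi Set.univ fun i => (Γ i).deg n

theorem mem_localDeg {n : ℕ} {γ : ∀ i, (Γ i).Form} :
    γ ∈ localDeg Γ n ↔ ∀ i, γ i ∈ (Γ i).deg n := by
  simp [localDeg]

/-- The algebra `A` as the degree zero part of `Γ_c(A)`. -/
def localInj : A →ₐ[k] ∀ i, (Γ i).Form := AlgHom.pi fun i => (Γ i).inj.comp (f i)

@[simp] theorem localInj_apply (a : A) (i : I) : localInj f Γ a i = (Γ i).inj (f i a) := rfl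

theorem localInj_mem (a : A) : localInj f Γ a ∈ localForms f Γ :=
  (mem_localForms f Γ).2 fun i j => ⟨UniversalForms.inj k a, by simp, by simp⟩

theorem localD_localInj_mem (a : A) : localD Γ (localInj f Γ a) ∈ localForms f Γ :=
  (mem_localForms f Γ).2 fun i j => ⟨UniversalForms.d k a, by simp, by simp⟩

theorem extUniversal_surjective (hf : ∀ i, Function.Surjective (f i)) (i : I) :
    Function.Surjective (extUniversal f Γ i) := by
  rw [← AlgHom.range_eq_top, ← top_le_iff, ← (Γ i).generated]
  refine Algebra.adjoin_le ?_
  rintro _ (⟨c, rfl⟩ | ⟨c, rfl⟩)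
  · obtain ⟨a, rfl⟩ := hf i c
    exact ⟨UniversalForms.inj k a, by simp⟩
  · obtain ⟨a, rfl⟩ := hf i c
    exact ⟨UniversalForms.d k a, by simp⟩

theorem extUniversal_mem (ω : UniversalForms k A) :
    (fun i => extUniversal f Γ i ω) ∈ localForms f Γ :=
  (mem_localForms f Γ).2 fun _ _ => ⟨ω, rfl, rfl⟩

end Adapted

/-! ### Locally trivial quantum principal fibre bundles -/

/-- A locally trivial quantum principal fibre bundle over the algebra `B` with the (finite) complete
covering `(Jᵢ)`, with structure group the Hopf algebra `H` and total space the algebra `P`. -/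
structure PrincipalBundle (k : Type u) (H : Type v) (P : Type w) {B : Type x} {I : Type y} [Field k]
    [Ring H] [HopfAlgebra k H] [Ring P] [Algebra k P] [Ring B] [Algebra k B]
    (J : I → Ideal B) [∀ i, (J i).IsTwoSided] extends RightCoaction k H P where
  base_covering : IsCompleteCovering k J
  /-- the local trivializations -/
  χ : ∀ i, P →ₐ[k] (B ⧸ J i) ⊗[k] H
  χ_surjective : ∀ i, Function.Surjective (χ i)
  /-- the embedding of the base -/
  ι : B →ₐ[k] P
  ι_injective : Function.Injective ι
  χ_coact : ∀ i p, TensorProduct.assoc k (B ⧸ J i) H H ((χ i).toLinearMap.rTensor H (coact p)) =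
    (Coalgebra.comul (R := k) (A := H)).lTensor (B ⧸ J i) (χ i p)
  χ_ι : ∀ i b, χ i (ι b) = Ideal.Quotient.mk (J i) b ⊗ₜ[k] 1
  total_covering : IsCompleteCovering k fun i => RingHom.ker (χ i)
  range_ι : ∀ p, p ∈ ι.range ↔ coact p = p ⊗ₜ[k] 1

/-- The data which determine a differential structure on a locally trivial quantum principal fibre
bundle: differential calculi `Γ(Bᵢ)` over the algebras `Bᵢ = B/Jᵢ` and a right covariant differential
calculus `Γ(H)`. -/
structure DifferentialStructure (k : Type u) (H : Type v) {B : Type x} {I : Type y} [Field k]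
    [Ring H] [HopfAlgebra k H] [Ring B] [Algebra k B] (J : I → Ideal B)
    [∀ i, (J i).IsTwoSided] where
  /-- the calculi `Γ(Bᵢ)` -/
  base : ∀ i, DifferentialCalculus.{u, x, z} k (B ⧸ J i)
  /-- the calculus `Γ(H)` -/
  fibre : DifferentialCalculus.{u, v, t} k H
  /-- the right covariance of `Γ(H)` -/
  cov : RightCovariant fibre

section Horizontal

open DifferentialCalculus

variable {k : Type u} {A : Type v} {H : Type x} [Field k] [Ring A] [Algebra k A] [Ring H]
  [HopfAlgebra k H]
variable (Γ : DifferentialCalculus.{u, v, w} k A) (Λ : DifferentialCalculus.{u, x, y} k H)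

/-- The embedding `Γ(A) ⊗ H → Γ(A) ⊗̂ Γ(H)`. -/
def horEmb : Γ.Form ⊗[k] H →ₗ[k] (Γ.tensor Λ).Form :=
  (GradedTensorProduct.of k Γ.deg Λ.deg).toLinearMap ∘ₗ Λ.inj.toLinearMap.lTensor Γ.Form

theorem horEmb_tmul (γ : Γ.Form) (h : H) : horEmb Γ Λ (γ ⊗ₜ h) = tm γ (Λ.inj h) := rfl

theorem horEmb_injective : Function.Injective (horEmb Γ Λ) :=
  (GradedTensorProduct.of k Γ.deg Λ.deg).injective.comp
    (Module.Flat.lTensor_preserves_injective_linearMap _ Λ.inj_injective)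

theorem tm_inj_mul (γ γ' : Γ.Form) (h h' : H) :
    (tm γ (Λ.inj h) : TensorForm Γ Λ) * tm γ' (Λ.inj h') = tm (γ * γ') (Λ.inj (h * h')) := by
  induction γ' using DirectSum.Decomposition.inductionOn Γ.deg with
  | zero => rw [tm_zero_left, mul_zero, mul_zero, tm_zero_left]
  | add a b ha hb => rw [tm_add_left, mul_add, mul_add, tm_add_left, ha, hb]
  | homogeneous a =>
    rw [tm_mul_tm γ (Λ.inj_mem h) a.2]; simp

theorem horEmb_mul (a b : Γ.Form ⊗[k] H) : horEmb Γ Λ (a * b) = horEmb Γ Λ a * horEmb Γ Λ b := by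
  induction a using TensorProduct.induction_on with
  | zero => simp
  | add x y hx hy => rw [add_mul, map_add, map_add, hx, hy, add_mul]
  | tmul γ h =>
    induction b using TensorProduct.induction_on with
    | zero => simp
    | add x y hx hy => rw [mul_add, map_add, map_add, hx, hy, mul_add]
    | tmul γ' h' =>
      rw [Algebra.TensorProduct.tmul_mul_tmul, horEmb_tmul, horEmb_tmul, horEmb_tmul]
      exact (tm_inj_mul Γ Λ γ γ' h h').symm

/-- The horizontal forms `Γ(A) ⊗̂ H ⊆ Γ(A) ⊗̂ Γ(H)` of the trivial bundle `A ⊗ H`. -/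
def horizontal : Subalgebra k (Γ.tensor Λ).Form where
  carrier := LinearMap.range (horEmb Γ Λ)
  mul_mem' := by
    rintro _ _ ⟨a, rfl⟩ ⟨b, rfl⟩
    exact ⟨a * b, horEmb_mul Γ Λ a b⟩
  add_mem' := fun ha hb => add_mem ha hb
  algebraMap_mem' c := by
    refine ⟨(algebraMap k Γ.Form c) ⊗ₜ 1, ?_⟩
    rw [horEmb_tmul, map_one]; rfl

theorem mem_horizontal {ω : (Γ.tensor Λ).Form} :
    ω ∈ horizontal Γ Λ ↔ ∃ a, horEmb Γ Λ a = ω := Iff.rfl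

theorem inj_mem_horizontal (a : A ⊗[k] H) : (Γ.tensor Λ).inj a ∈ horizontal Γ Λ := by
  change tensorInj Γ Λ a ∈ _
  induction a using TensorProduct.induction_on with
  | zero => rw [map_zero]; exact zero_mem _
  | add x y hx hy => rw [map_add]; exact add_mem hx hy
  | tmul a h => exact ⟨Γ.inj a ⊗ₜ h, (tensorInj_tmul a h).symm⟩

/-- The embedding `γ ↦ γ ⊗ 1`. -/
def pieceIncl : Γ.Form →ₐ[k] (Γ.tensor Λ).Form :=
  GradedTensorProduct.includeLeft Γ.deg Λ.deg

theorem pieceIncl_inj (a : A) : pieceIncl Γ Λ (Γ.inj a) = (Γ.tensor Λ).inj (a ⊗ₜ 1) := by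
  refine Eq.trans ?_ (tensorInj_tmul a (1 : H)).symm
  rw [map_one]; rfl

theorem pieceIncl_d (a : A) :
    pieceIncl Γ Λ (Γ.d (Γ.inj a)) = (Γ.tensor Λ).d ((Γ.tensor Λ).inj (a ⊗ₜ 1)) := by
  change _ = tensorD Γ Λ (tensorInj Γ Λ (a ⊗ₜ 1))
  rw [tensorInj_tmul, map_one, tensorD_tm (Γ.inj_mem _), Λ.d_one, tm_zero_right,
    smul_zero, add_zero]; rfl

variable {Λ}

/-- The coaction `id ⊗ Δ^Γ` of `H` on `Γ(A) ⊗̂ Γ(H)`. -/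
def pieceCoact (cov : RightCovariant Λ) :
    (Γ.tensor Λ).Form →ₐ[k] (Γ.tensor Λ).Form ⊗[k] H :=
  tensorCoact Γ cov

theorem pieceCoact_inj (cov : RightCovariant Λ) (z : A ⊗[k] H) :
    pieceCoact Γ cov ((Γ.tensor Λ).inj z) =
      (Γ.tensor Λ).inj.toLinearMap.rTensor H ((TensorProduct.assoc k A H H).symm
        ((Coalgebra.comul (R := k) (A := H)).lTensor A z)) :=
  tensorCoact_inj cov z

theorem pieceCoact_d (cov : RightCovariant Λ) (z : A ⊗[k] H) :
    pieceCoact Γ cov ((Γ.tensor Λ).d ((Γ.tensor Λ).inj z)) =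
      ((Γ.tensor Λ).d ∘ₗ (Γ.tensor Λ).inj.toLinearMap).rTensor H
        ((TensorProduct.assoc k A H H).symm
          ((Coalgebra.comul (R := k) (A := H)).lTensor A z)) :=
  tensorCoact_d cov z

theorem contract_pieceCoact_deg (cov : RightCovariant Λ) (φ : H →ₗ[k] k) {n : ℕ}
    {z : (Γ.tensor Λ).Form} (hz : z ∈ (Γ.tensor Λ).deg n) :
    contract φ (pieceCoact Γ cov z) ∈ (Γ.tensor Λ).deg n :=
  contract_tensorCoact_mem cov φ hz

theorem contract_mem_horizontal (cov : RightCovariant Λ) (φ : H →ₗ[k] k) {ω : (Γ.tensor Λ).Form}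
    (hω : ω ∈ horizontal Γ Λ) : contract φ (pieceCoact Γ cov ω) ∈ horizontal Γ Λ := by
  obtain ⟨a, rfl⟩ := hω
  induction a using TensorProduct.induction_on with
  | zero => rw [map_zero, map_zero, map_zero]; exact zero_mem _
  | add x y hx hy => rw [map_add, map_add, map_add]; exact add_mem hx hy
  | tmul γ h =>
    refine ⟨γ ⊗ₜ contract φ (Coalgebra.comul (R := k) h), ?_⟩
    refine Eq.trans ?_ (contract_tensorCoact_tm cov φ γ (Λ.inj h)).symm
    rw [cov.coact_inj, contract_rTensor]; rfl

end Horizontal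

section Bundle

open DifferentialCalculus

variable {k : Type u} {H : Type v} {P : Type w} {B : Type x} {I : Type y} [Field k]
    [Ring H] [HopfAlgebra k H] [Ring P] [Algebra k P] [Ring B] [Algebra k B]
    {J : I → Ideal B} [∀ i, (J i).IsTwoSided]

/-- The calculi `Γ(Bᵢ) ⊗̂ Γ(H)` over the trivial pieces `Bᵢ ⊗ H`. -/
abbrev DifferentialStructure.piece (D : DifferentialStructure.{u, v, x, y, z, t} k H J) (i : I) :
    DifferentialCalculus k ((B ⧸ J i) ⊗[k] H) :=
  (D.base i).tensor D.fibre

/-- The algebra `⊕ᵢ Γ(Bᵢ) ⊗̂ Γ(H)` in which `Γ_c(P)` lies. -/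
abbrev Families (D : DifferentialStructure.{u, v, x, y, z, t} k H J) : Type _ :=
  ∀ i, (D.piece i).Form

/-- `Γ_c(B)`, the covering completion of the calculus on the base. -/
abbrev baseForms (D : DifferentialStructure.{u, v, x, y, z, t} k H J) :
    Subalgebra k (∀ i, (D.base i).Form) :=
  localForms (fun i => Ideal.Quotient.mkₐ k (J i)) D.base

variable (X : PrincipalBundle k H P J) (D : DifferentialStructure.{u, v, x, y, z, t} k H J)

/-- `Γ_c(P)`, the covering completion of the differential structure `Γ(P)` on the bundle. -/
abbrev totalForms : Subalgebra k (Families D) := localForms X.χ D.piece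

/-- The subalgebra `hor Γ_c(P)` of horizontal forms. -/
def horForms : Subalgebra k (Families D) :=
  totalForms X D ⊓ ⨅ i, (horizontal (D.base i) D.fibre).comap (Pi.evalAlgHom k _ i)

theorem mem_horForms {γ : Families D} : γ ∈ horForms X D ↔
    γ ∈ totalForms X D ∧ ∀ i, γ i ∈ horizontal (D.base i) D.fibre := by
  simp [horForms, Algebra.mem_inf, Algebra.mem_iInf]

/-- The one-forms `Γ¹_c(P)`. -/
def oneForms : Submodule k (Families D) :=
  Subalgebra.toSubmodule (totalForms X D) ⊓ localDeg D.piece 1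

/-- The horizontal one-forms `hor Γ¹_c(P)`. -/
def horOneForms : Submodule k (Families D) :=
  Subalgebra.toSubmodule (horForms X D) ⊓ localDeg D.piece 1

theorem horOneForms_le : horOneForms X D ≤ oneForms X D :=
  inf_le_inf_right _ fun _ h => ((mem_horForms X D).1 h).1

theorem horOneForms_le_hor : horOneForms X D ≤ Subalgebra.toSubmodule (horForms X D) := inf_le_left

/-! #### The base and the total space inside the forms -/

/-- The embedding `γ ↦ (γᵢ ⊗ 1)`. -/
def familyIncl : (∀ i, (D.base i).Form) →ₐ[k] Families D :=
  AlgHom.pi fun i => (pieceIncl (D.base i) D.fibre).comp (Pi.evalAlgHom k _ i)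

theorem familyIncl_apply (γ : ∀ i, (D.base i).Form) (i : I) :
    familyIncl D γ i = pieceIncl (D.base i) D.fibre (γ i) := rfl

/-- The extension `Ω(B) → Ω(P)` of `ι`. -/
def universalIncl : UniversalForms k B →ₐ[k] UniversalForms k P :=
  UniversalForms.lift ((UniversalForms.inj k).comp X.ι) (UniversalForms.d k ∘ₗ X.ι.toLinearMap)
    (fun a b => by
      simp only [LinearMap.comp_apply, AlgHom.toLinearMap_apply, AlgHom.comp_apply, map_mul X.ι,
        UniversalForms.d_mul])

theorem extUniversal_incl (i : I) (ω : UniversalForms k B) :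
    extUniversal X.χ D.piece i (universalIncl X ω) =
      pieceIncl (D.base i) D.fibre
        (extUniversal (fun i => Ideal.Quotient.mkₐ k (J i)) D.base i ω) := by
  have : (extUniversal X.χ D.piece i).comp (universalIncl X) =
      (pieceIncl (D.base i) D.fibre).comp
        (extUniversal (fun i => Ideal.Quotient.mkₐ k (J i)) D.base i) := by
    apply UniversalForms.hom_ext
    · intro a
      have h1 : universalIncl X (UniversalForms.inj k a) = UniversalForms.inj k (X.ι a) :=
        UniversalForms.lift_inj _ _ _ a
      rw [AlgHom.comp_apply, AlgHom.comp_apply, h1, extUniversal_inj, extUniversal_inj, X.χ_ι,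
        pieceIncl_inj]; rfl
    · intro a
      have h1 : universalIncl X (UniversalForms.d k a) = UniversalForms.d k (X.ι a) :=
        UniversalForms.lift_d _ _ _ a
      rw [AlgHom.comp_apply, AlgHom.comp_apply, h1, extUniversal_d, extUniversal_d, X.χ_ι,
        pieceIncl_d]; rfl
  exact DFunLike.congr_fun this ω

theorem familyIncl_mem {γ : ∀ i, (D.base i).Form} (hγ : γ ∈ baseForms D) :
    familyIncl D γ ∈ horForms X D := by
  rw [mem_horForms]
  refine ⟨(mem_localForms _ _).2 fun i j => ?_, fun i => ?_⟩
  · obtain ⟨ω, h1, h2⟩ := (mem_localForms _ _).1 hγ i j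
    exact ⟨universalIncl X ω, by rw [extUniversal_incl, h1]; rfl,
      by rw [extUniversal_incl, h2]; rfl⟩
  · exact ⟨γ i ⊗ₜ 1, by rw [horEmb_tmul, map_one]; rfl⟩

/-- The embedding `ι_{Γ_c} : Γ_c(B) → hor Γ_c(P)`. -/
def baseIncl : baseForms D →ₐ[k] horForms X D :=
  ((familyIncl D).comp (baseForms D).val).codRestrict _ fun γ => familyIncl_mem X D γ.2

theorem localInj_mem_horForms (p : P) : localInj X.χ D.piece p ∈ horForms X D :=
  (mem_horForms X D).2 ⟨localInj_mem _ _ p, fun _ => inj_mem_horizontal _ _ _⟩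

/-- The total space `P` as the degree zero part of `hor Γ_c(P)`. -/
def totalIncl : P →ₐ[k] horForms X D :=
  (localInj X.χ D.piece).codRestrict _ (localInj_mem_horForms X D)

/-- The differential `d : P → Γ¹_c(P)`. -/
def totalD : P →ₗ[k] oneForms X D :=
  (localD D.piece ∘ₗ (localInj X.χ D.piece).toLinearMap).codRestrict _ fun p =>
    ⟨localD_localInj_mem _ _ p, (mem_localDeg _).2 fun i => (D.piece i).d_inj_mem _⟩

/-- The left multiplication of one-forms by elements of `P`. -/
def leftMul (p : P) (γ : oneForms X D) : oneForms X D :=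
  ⟨localInj X.χ D.piece p * γ, (totalForms X D).mul_mem (localInj_mem _ _ p) γ.2.1, (mem_localDeg _).2 fun i => by
    have := SetLike.mul_mem_graded ((D.piece i).inj_mem (X.χ i p)) ((mem_localDeg _).1 γ.2.2 i)
    rwa [zero_add] at this⟩

/-- The right multiplication of one-forms by elements of `P`. -/
def rightMul (γ : oneForms X D) (p : P) : oneForms X D :=
  ⟨γ * localInj X.χ D.piece p, (totalForms X D).mul_mem γ.2.1 (localInj_mem _ _ p), (mem_localDeg _).2 fun i => by
    have := SetLike.mul_mem_graded ((mem_localDeg _).1 γ.2.2 i) ((D.piece i).inj_mem (X.χ i p))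
    rwa [add_zero] at this⟩

/-! #### The coaction on the forms -/

/-- The extension `Ω(P) → Ω(P) ⊗ H` of the coaction. -/
def universalCoact : UniversalForms k P →ₐ[k] UniversalForms k P ⊗[k] H :=
  UniversalForms.lift (T := UniversalForms k P ⊗[k] H)
    ((Algebra.TensorProduct.map (UniversalForms.inj (A := P) k) (AlgHom.id k H)).comp X.coact)
    (LinearMap.rTensor H (UniversalForms.d (A := P) k) ∘ₗ X.coact.toLinearMap)
    (fun a b => by
      rw [LinearMap.comp_apply, LinearMap.comp_apply, LinearMap.comp_apply,
        AlgHom.toLinearMap_apply, AlgHom.toLinearMap_apply, AlgHom.toLinearMap_apply, map_mul,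
        AlgHom.comp_apply, AlgHom.comp_apply]
      generalize X.coact a = a'
      generalize X.coact b = b'
      induction a' using TensorProduct.induction_on with
      | zero => simp
      | add x y hx hy =>
        rw [add_mul, map_add, map_add, map_add, hx, hy, add_mul, add_mul]; abel
      | tmul p h =>
        induction b' using TensorProduct.induction_on with
        | zero => simp
        | add x y hx hy =>
          rw [mul_add, map_add, map_add, map_add, hx, hy, mul_add, mul_add]; abel
        | tmul q h' =>
          simp [UniversalForms.d_mul, TensorProduct.add_tmul])

theorem extUniversal_coact (i : I) (ω : UniversalForms k P) :
    (extUniversal X.χ D.piece i).toLinearMap.rTensor H (universalCoact X ω) =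
      pieceCoact (D.base i) D.cov (extUniversal X.χ D.piece i ω) := by
  have hlin : ∀ z, (extUniversal X.χ D.piece i).toLinearMap.rTensor H z =
      Algebra.TensorProduct.map (extUniversal X.χ D.piece i) (AlgHom.id k H) z := fun z => rfl
  have hχ : ∀ a, (TensorProduct.assoc k (B ⧸ J i) H H).symm
      ((Coalgebra.comul (R := k) (A := H)).lTensor (B ⧸ J i) (X.χ i a)) =
        (X.χ i).toLinearMap.rTensor H (X.coact a) := by
    intro a
    rw [← X.χ_coact, LinearEquiv.symm_apply_apply]
  have : (Algebra.TensorProduct.map (extUniversal X.χ D.piece i) (AlgHom.id k H)).comp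
      (universalCoact X) = (pieceCoact (D.base i) D.cov).comp (extUniversal X.χ D.piece i) := by
    apply UniversalForms.hom_ext
    · intro a
      rw [AlgHom.comp_apply, AlgHom.comp_apply, extUniversal_inj]
      refine Eq.trans ?_ (pieceCoact_inj (D.base i) D.cov (X.χ i a)).symm
      rw [hχ, universalCoact, UniversalForms.lift_inj, AlgHom.comp_apply]
      generalize X.coact a = z
      induction z using TensorProduct.induction_on with
      | zero => simp
      | add x y hx hy => simp only [map_add, hx, hy]
      | tmul p h =>
        rw [Algebra.TensorProduct.map_tmul, Algebra.TensorProduct.map_tmul, extUniversal_inj]; rfl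
    · intro a
      rw [AlgHom.comp_apply, AlgHom.comp_apply, extUniversal_d]
      refine Eq.trans ?_ (pieceCoact_d (D.base i) D.cov (X.χ i a)).symm
      rw [hχ, universalCoact, UniversalForms.lift_d, LinearMap.comp_apply,
        AlgHom.toLinearMap_apply]
      generalize X.coact a = z
      induction z using TensorProduct.induction_on with
      | zero => simp
      | add x y hx hy => simp only [map_add, hx, hy]
      | tmul p h =>
        rw [LinearMap.rTensor_tmul, Algebra.TensorProduct.map_tmul, extUniversal_d]; rfl
  rw [hlin]
  exact DFunLike.congr_fun this ω

variable [Fintype I] [DecidableEq I]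

/-- The coaction `(γᵢ) ↦ ((id ⊗ Δ^Γ)(γᵢ))` on families of forms. -/
def familyCoact : Families D →ₗ[k] Families D ⊗[k] H :=
  ∑ i, (LinearMap.single k (fun i => (D.piece i).Form) i).rTensor H ∘ₗ
    (pieceCoact (D.base i) D.cov).toLinearMap ∘ₗ LinearMap.proj i

theorem rTensor_proj_familyCoact (i : I) (γ : Families D) :
    (LinearMap.proj i : Families D →ₗ[k] (D.piece i).Form).rTensor H (familyCoact D γ) =
      pieceCoact (D.base i) D.cov (γ i) := by
  rw [familyCoact, LinearMap.sum_apply, map_sum, Finset.sum_eq_single i]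
  · rw [LinearMap.comp_apply, ← LinearMap.comp_apply, ← LinearMap.rTensor_comp,
      LinearMap.proj_comp_single_same, LinearMap.rTensor_id]; rfl
  · intro j _ hj
    rw [LinearMap.comp_apply, ← LinearMap.comp_apply, ← LinearMap.rTensor_comp,
      LinearMap.proj_comp_single_ne _ _ _ _ hj.symm, LinearMap.rTensor_zero]; rfl
  · simp

theorem contract_familyCoact (φ : H →ₗ[k] k) (γ : Families D) (i : I) :
    contract φ (familyCoact D γ) i = contract φ (pieceCoact (D.base i) D.cov (γ i)) := by
  rw [← rTensor_proj_familyCoact, contract_rTensor]; rfl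

theorem contract_mem_totalForms (φ : H →ₗ[k] k) {γ : Families D} (hγ : γ ∈ totalForms X D) :
    contract φ (familyCoact D γ) ∈ totalForms X D := by
  refine (mem_localForms _ _).2 fun i j => ?_
  obtain ⟨ω, h1, h2⟩ := (mem_localForms _ _).1 hγ i j
  refine ⟨contract φ (universalCoact X ω), ?_, ?_⟩
  · rw [contract_familyCoact, ← h1, ← extUniversal_coact, contract_rTensor]; rfl
  · rw [contract_familyCoact, ← h2, ← extUniversal_coact, contract_rTensor]; rfl

theorem contract_mem_localDeg (φ : H →ₗ[k] k) {n : ℕ} {γ : Families D}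
    (hγ : γ ∈ localDeg D.piece n) : contract φ (familyCoact D γ) ∈ localDeg D.piece n := by
  rw [mem_localDeg] at hγ ⊢
  intro i
  rw [contract_familyCoact]
  exact contract_pieceCoact_deg _ D.cov φ (hγ i)

theorem contract_mem_horForms (φ : H →ₗ[k] k) {γ : Families D} (hγ : γ ∈ horForms X D) :
    contract φ (familyCoact D γ) ∈ horForms X D := by
  rw [mem_horForms] at hγ ⊢
  refine ⟨contract_mem_totalForms X D φ hγ.1, fun i => ?_⟩
  rw [contract_familyCoact]
  exact contract_mem_horizontal _ D.cov φ (hγ.2 i)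

/-- The coaction `Δ_P^{Γ_c} : Γ_c(P) → Γ_c(P) ⊗ H`. -/
def totalCoact : totalForms X D →ₗ[k] totalForms X D ⊗[k] H :=
  restrictCoaction (familyCoact D) (Subalgebra.toSubmodule (totalForms X D))
    fun φ _ h => contract_mem_totalForms X D φ h

/-- The restriction of the coaction to `hor Γ_c(P)`. -/
def horCoact : horForms X D →ₗ[k] horForms X D ⊗[k] H :=
  restrictCoaction (familyCoact D) (Subalgebra.toSubmodule (horForms X D))
    fun φ _ h => contract_mem_horForms X D φ h

/-- The restriction of the coaction to `Γ¹_c(P)`. -/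
def oneCoact : oneForms X D →ₗ[k] oneForms X D ⊗[k] H :=
  restrictCoaction (familyCoact D) (oneForms X D)
    fun φ _ h => ⟨contract_mem_totalForms X D φ h.1, contract_mem_localDeg D φ h.2⟩

/-- The restriction of the coaction to `hor Γ¹_c(P)`. -/
def horOneCoact : horOneForms X D →ₗ[k] horOneForms X D ⊗[k] H :=
  restrictCoaction (familyCoact D) (horOneForms X D)
    fun φ _ h => ⟨contract_mem_horForms X D φ h.1, contract_mem_localDeg D φ h.2⟩

end Bundle

/-! ### Covariant derivatives -/

section Derivative

open DifferentialCalculus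

variable {k : Type u} {H : Type v} {P : Type w} {B : Type x} {I : Type y} [Field k]
    [Ring H] [HopfAlgebra k H] [Ring P] [Algebra k P] [Ring B] [Algebra k B]
    {J : I → Ideal B} [∀ i, (J i).IsTwoSided]

variable (X : PrincipalBundle k H P J) (D : DifferentialStructure.{u, v, x, y, z, t} k H J)

/-- The local trivialization `hor Γ_c(P) → Γ(Bᵢ) ⊗ H`, the restriction of the extension of `χᵢ` to
the horizontal forms. -/
def horProj (i : I) : horForms X D →ₗ[k] (D.base i).Form ⊗[k] H :=
  (LinearEquiv.ofInjective (horEmb (D.base i) D.fibre)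
      (horEmb_injective (D.base i) D.fibre)).symm.toLinearMap ∘ₗ
    (LinearMap.proj i ∘ₗ (horForms X D).val.toLinearMap).codRestrict
      (LinearMap.range (horEmb (D.base i) D.fibre)) fun α => ((mem_horForms X D).1 α.2).2 i

theorem horEmb_horProj (i : I) (α : horForms X D) :
    horEmb (D.base i) D.fibre (horProj X D i α) = (α : Families D) i := by
  have := LinearEquiv.apply_symm_apply
    (LinearEquiv.ofInjective (horEmb (D.base i) D.fibre) (horEmb_injective (D.base i) D.fibre))
    ((LinearMap.proj i ∘ₗ (horForms X D).val.toLinearMap).codRestrict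
      (LinearMap.range (horEmb (D.base i) D.fibre)) (fun α => ((mem_horForms X D).1 α.2).2 i) α)
  exact congrArg Subtype.val this

theorem horProj_eq_zero {i : I} {α : horForms X D} :
    horProj X D i α = 0 ↔ (α : Families D) i = 0 := by
  rw [← horEmb_horProj, map_eq_zero_iff _ (horEmb_injective (D.base i) D.fibre)]

theorem horProj_surjective (i : I) : Function.Surjective (horProj X D i) := by
  rw [← LinearMap.range_eq_top, ← top_le_iff]
  intro z _
  induction z using TensorProduct.induction_on with
  | zero => exact zero_mem _
  | add a b ha hb => exact add_mem (ha trivial) (hb trivial)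
  | tmul γ h =>
    obtain ⟨p, hp⟩ := X.χ_surjective i (1 ⊗ₜ h)
    obtain ⟨ω, hω⟩ := extUniversal_surjective (fun i => Ideal.Quotient.mkₐ k (J i)) D.base
      (fun i => Ideal.Quotient.mkₐ_surjective k (J i)) i γ
    refine ⟨⟨familyIncl D (fun j => extUniversal (fun i => Ideal.Quotient.mkₐ k (J i)) D.base j ω) *
      localInj X.χ D.piece p, (horForms X D).mul_mem
        (familyIncl_mem X D (extUniversal_mem _ _ ω)) (localInj_mem_horForms X D p)⟩, ?_⟩
    apply horEmb_injective (D.base i) D.fibre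
    rw [horEmb_horProj]
    change pieceIncl (D.base i) D.fibre (extUniversal _ D.base i ω) *
      (D.piece i).inj (X.χ i p) = _
    rw [hp, hω]
    change (tm γ (1 : D.fibre.Form) : TensorForm (D.base i) D.fibre) *
      tensorInj (D.base i) D.fibre (1 ⊗ₜ h) = tm γ (D.fibre.inj h)
    rw [tensorInj_tmul, map_one, tm_mul_tm_zero _ SetLike.GradedOne.one_mem
      SetLike.GradedOne.one_mem, mul_one, one_mul]

variable [Fintype I] [DecidableEq I]

/-- The conditions common to left and right covariant derivatives `hor Γ_c(P) → hor Γ_c(P)`. -/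
structure PreCovariantDerivative where
  toLinearMap : horForms X D →ₗ[k] horForms X D
  degree : ∀ (n : ℕ) (α : horForms X D), (α : Families D) ∈ localDeg D.piece n →
    (toLinearMap α : Families D) ∈ localDeg D.piece (n + 1)
  map_one : toLinearMap 1 = 0
  covariant : ∀ α : horForms X D,
    toLinearMap.rTensor H (horCoact X D α) = horCoact X D (toLinearMap α)
  isLocal : ∀ (i : I) (α : horForms X D), (α : Families D) i = 0 →
    (toLinearMap α : Families D) i = 0

/-- Left covariant derivatives. -/
structure LeftCovariantDerivative extends PreCovariantDerivative X D where
  leibniz : ∀ (n : ℕ) (γ : baseForms D) (α : horForms X D),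
    (γ : ∀ i, (D.base i).Form) ∈ localDeg D.base n →
      (toLinearMap (baseIncl X D γ * α) : Families D) =
        localD D.piece (baseIncl X D γ : Families D) * (α : Families D) +
          (-1 : k) ^ n • (baseIncl X D γ * toLinearMap α : Families D)

/-- Right covariant derivatives. -/
structure RightCovariantDerivative extends PreCovariantDerivative X D where
  leibniz : ∀ (n : ℕ) (γ : baseForms D) (α : horForms X D),
    (α : Families D) ∈ localDeg D.piece n →
      (toLinearMap (α * baseIncl X D γ) : Families D) =
        (toLinearMap α * baseIncl X D γ : Families D) +
          (-1 : k) ^ n • ((α : Families D) * localD D.piece (baseIncl X D γ : Families D))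

namespace PreCovariantDerivative

variable {X D}
variable (T : PreCovariantDerivative X D)

/-- The local operator `Tᵢ` on `Γ(Bᵢ) ⊗ H`, determined by `Tᵢ ∘ χᵢ = χᵢ ∘ T`. -/
def localMap (i : I) : (D.base i).Form ⊗[k] H →ₗ[k] (D.base i).Form ⊗[k] H :=
  (LinearMap.ker (horProj X D i)).liftQ (horProj X D i ∘ₗ T.toLinearMap)
      (fun α hα => LinearMap.mem_ker.2 <| (horProj_eq_zero X D).2 <|
        T.isLocal i α <| (horProj_eq_zero X D).1 <| LinearMap.mem_ker.1 hα) ∘ₗ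
    ((horProj X D i).quotKerEquivOfSurjective (horProj_surjective X D i)).symm.toLinearMap

theorem localMap_horProj (i : I) (α : horForms X D) :
    T.localMap i (horProj X D i α) = horProj X D i (T.toLinearMap α) := by
  have h : ((horProj X D i).quotKerEquivOfSurjective (horProj_surjective X D i)).symm
      (horProj X D i α) = Submodule.Quotient.mk α := by
    rw [LinearEquiv.symm_apply_eq]; rfl
  rw [localMap, LinearMap.comp_apply, LinearEquiv.coe_coe, h]
  exact Submodule.liftQ_apply _ _ _

/-- The local maps `Aᵢ(h) = -(id ⊗ ε)(Tᵢ(1 ⊗ h))` of a covariant derivative. -/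
def A (i : I) : H →ₗ[k] (D.base i).Form :=
  -(contract (Coalgebra.counit (R := k) (A := H)) ∘ₗ T.localMap i ∘ₗ
    TensorProduct.mk k (D.base i).Form H 1)

end PreCovariantDerivative

/-! ### Connections -/

/-- The conditions common to left and right connections `hor : Γ¹_c(P) → hor Γ¹_c(P)`. -/
structure PreConnection where
  toLinearMap : oneForms X D →ₗ[k] horOneForms X D
  surjective : Function.Surjective toLinearMap
  idem : ∀ γ : oneForms X D,
    toLinearMap (Submodule.inclusion (horOneForms_le X D) (toLinearMap γ)) = toLinearMap γ
  covariant : ∀ γ : oneForms X D,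
    toLinearMap.rTensor H (oneCoact X D γ) = horOneCoact X D (toLinearMap γ)
  isLocal : ∀ (i : I) (γ : oneForms X D), (γ : Families D) i = 0 →
    (toLinearMap γ : Families D) i = 0

/-- Left connections: the map is a homomorphism of left `P`-modules. -/
structure LeftConnection extends PreConnection X D where
  map_mul : ∀ (p : P) (γ : oneForms X D),
    (toLinearMap (leftMul X D p γ) : Families D) =
      (totalIncl X D p : Families D) * (toLinearMap γ : Families D)

/-- Right connections: the map is a homomorphism of right `P`-modules. -/
structure RightConnection extends PreConnection X D where
  map_mul : ∀ (p : P) (γ : oneForms X D),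
    (toLinearMap (rightMul X D γ p) : Families D) =
      (toLinearMap γ : Families D) * (totalIncl X D p : Families D)

end Derivative

/-! ### The right ideal of a right covariant calculus -/

section FibreIdeal

variable {k : Type u} {H : Type v} [Field k] [Ring H] [HopfAlgebra k H]

/-- The inverse of the antipode. -/
def antipodeInv (hS : Function.Bijective (HopfAlgebra.antipode k (A := H))) : H →ₗ[k] H :=
  (LinearEquiv.ofBijective (HopfAlgebra.antipode k (A := H)) hS).symm.toLinearMap

/-- The map `η(h) = ∑ S⁻¹(h₂) dh₁` from `H` to `Γ¹(H)`. -/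
def eta (Λ : DifferentialCalculus.{u, v, w} k H)
    (hS : Function.Bijective (HopfAlgebra.antipode k (A := H))) : H →ₗ[k] Λ.Form :=
  LinearMap.mul' k Λ.Form ∘ₗ
    TensorProduct.map (Λ.inj.toLinearMap ∘ₗ antipodeInv hS) (Λ.d ∘ₗ Λ.inj.toLinearMap) ∘ₗ
      (TensorProduct.comm k H H).toLinearMap ∘ₗ Coalgebra.comul

/-- The right ideal `R = ker η ∩ ker ε` of `H` which corresponds to the right covariant calculus
`Γ(H)`. -/
def rightIdeal (Λ : DifferentialCalculus.{u, v, w} k H)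
    (hS : Function.Bijective (HopfAlgebra.antipode k (A := H))) : Submodule k H :=
  LinearMap.ker (eta Λ hS) ⊓ LinearMap.ker (Coalgebra.counit (R := k) (A := H))

end FibreIdeal

end QuantumBundle

end

/-! Over a trivial piece everything is governed by one linear map a : H → Γ(Bᵢ) ⊗ H, called
`potential`. For a connection it is a(h) = hor(1 ⊗ dh), for a covariant derivative a(h) = Dᵢ(1 ⊗ h),
and D|_P = hor ∘ d makes the two agree. In both cases a is H-colinear and a(1) = 0. The Leibniz rule
forces Dᵢ(γ ⊗ h) = dγ ⊗ h + (-1)ⁿ(γ ⊗ 1)a(h) in the left case (`leftOp`). Left linearity and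
idempotence force hor to fix Γ¹(Bᵢ) ⊗ H and to send b ⊗ h dh' to (b ⊗ h)a(h') (`leftHor`). The
second formula makes sense only if it respects the relations Σ h dh' = 0 of Γ(H), and this is what R
⊂ ker Aᵢ expresses.

Colinearity gives (id ⊗ φ)a(h) = (id ⊗ ε)a(Σ φ(h₂)h₁), so a is determined by Aᵢ = -(id ⊗ ε)a. If Σ h
dh' = 0, applying the coaction and S⁻¹ shows that g = Σ φ(hh'₂)h'₁ satisfies η(g) = 0 for every
functional φ (`eta_translateMul`). Hence g - ε(g)1 lies in R, and (id ⊗ φ) kills Σ (1 ⊗ h)a(h')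
(`mulAct_eq_zero`). Conversely, r in R yields the relation Σ S⁻¹(r₂)dr₁ = 0; applying hor and then
id ⊗ ε gives (id ⊗ ε)a(r) = 0 (`rightIdeal_le_of_mulAct`). In the right case the relations are Σ dh'
h = 0, and Σ dg₁ S(g₂) = -η(S(g)) replaces R by S⁻¹(R) (`diffMul_antipode`).

Local operators must also glue. Two components of a form in Γ_c(P) fit together modulo ideals
(`overlap`) which are stable under the coaction, so by an antipode argument they meet Γ(Bᵢ) ⊗ H in J
⊗ H for a subspace J of Γ(Bᵢ). Together with the global lifts ω·p of γ ⊗ h, on which the operators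
give dω·p ± ω·hor(dp), this shows that D preserves Γ_c(P) (`applyLocal_mem`). For a connection built
from D, any two components of a one-form have a common lift Σ a db, whose image Σ a D(b) is visibly
global (`PreConnection.ofLocal_mem`). -/

noncomputable section

namespace QuantumBundle

/-! ### Contractions with functionals on the factor H -/

section Contract

variable {k : Type*} {H : Type*} {M : Type*} [Field k] [AddCommGroup H] [Module k H]
  [AddCommGroup M] [Module k M]

/-- Over a field, functionals on H separate the elements of M ⊗ H. Identities between coactions are
therefore tested after contraction with an arbitrary φ. -/
theorem eq_of_contract {x y : M ⊗[k] H} (h : ∀ φ : H →ₗ[k] k, contract φ x = contract φ y) :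
    x = y :=
  sub_eq_zero.1 <| eq_zero_of_contract fun φ => by rw [map_sub, h φ, sub_self]

theorem contract_lTensor {H' : Type*} [AddCommGroup H'] [Module k H'] (φ : H' →ₗ[k] k)
    (f : H →ₗ[k] H') (z : M ⊗[k] H) : contract φ (f.lTensor M z) = contract (φ ∘ₗ f) z := by
  induction z using TensorProduct.induction_on with
  | zero => simp
  | add a b ha hb => simp only [map_add, ha, hb]
  | tmul m h => simp

/-- Contractions see through `restrictCoaction`, so every restricted coaction reduces to the
componentwise coaction on families. -/
theorem coe_contract_restrictCoaction (δ : M →ₗ[k] M ⊗[k] H) (N : Submodule k M)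
    (hN : ∀ φ : H →ₗ[k] k, ∀ m ∈ N, contract φ (δ m) ∈ N) (φ : H →ₗ[k] k) (m : N) :
    ((contract φ (restrictCoaction δ N hN m) : N) : M) = contract φ (δ m) := by
  rw [← rTensor_restrictCoaction δ N hN, contract_rTensor]; rfl

theorem map_comp_right_apply {V W U Y Z : Type*} [AddCommGroup V] [Module k V] [AddCommGroup W]
    [Module k W] [AddCommGroup U] [Module k U] [AddCommGroup Y] [Module k Y] [AddCommGroup Z]
    [Module k Z] (f : V →ₗ[k] W) (g : Y →ₗ[k] Z) (g' : U →ₗ[k] Y) (z : V ⊗[k] U) :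
    TensorProduct.map f (g ∘ₗ g') z = TensorProduct.map f g (g'.lTensor V z) := by
  rw [← LinearMap.map_comp_lTensor]; rfl

theorem map_comp_left_apply {V W U Y Z : Type*} [AddCommGroup V] [Module k V] [AddCommGroup W]
    [Module k W] [AddCommGroup U] [Module k U] [AddCommGroup Y] [Module k Y] [AddCommGroup Z]
    [Module k Z] (f : Y →ₗ[k] Z) (f' : U →ₗ[k] Y) (g : V →ₗ[k] W) (z : U ⊗[k] V) :
    TensorProduct.map (f ∘ₗ f') g z = TensorProduct.map f g (f'.rTensor V z) := by
  rw [← LinearMap.map_comp_rTensor]; rfl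

/-- A linear map which vanishes on the kernel of `f` factors through `f`. -/
theorem exists_comp_eq_of_ker_le {V W U : Type*} [AddCommGroup V] [Module k V] [AddCommGroup W]
    [Module k W] [AddCommGroup U] [Module k U] (f : V →ₗ[k] W) (g : V →ₗ[k] U)
    (h : LinearMap.ker f ≤ LinearMap.ker g) : ∃ e : W →ₗ[k] U, ∀ v, e (f v) = g v := by
  obtain ⟨e, he⟩ := LinearMap.exists_extend
    ((LinearMap.ker f).liftQ g h ∘ₗ f.quotKerEquivRange.symm.toLinearMap)
  refine ⟨e, fun v => ?_⟩
  have := LinearMap.congr_fun he ⟨f v, v, rfl⟩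
  refine this.trans ?_
  have h2 : f.quotKerEquivRange.symm ⟨f v, v, rfl⟩ = Submodule.Quotient.mk v := by
    rw [LinearEquiv.symm_apply_eq]; rfl
  rw [LinearMap.comp_apply, LinearEquiv.coe_coe, h2]
  exact Submodule.liftQ_apply _ _ _

end Contract

/-! ### Right translations and antipode identities in H -/

section Hopf

variable {k : Type*} {H : Type*} [Field k] [Ring H] [HopfAlgebra k H]

open HopfAlgebra Coalgebra

/-- The right translation `h ↦ ∑ φ(h₂) h₁` by a functional `φ`. -/
def translate (φ : H →ₗ[k] k) : H →ₗ[k] H := contract φ ∘ₗ comul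

theorem translate_apply (φ : H →ₗ[k] k) (h : H) :
    translate φ h = contract φ (comul (R := k) h) := rfl

theorem counit_translate (φ : H →ₗ[k] k) (h : H) : counit (R := k) (translate φ h) = φ h := by
  have e : ∀ z : H ⊗[k] H, counit (R := k) (contract φ z) =
      φ (TensorProduct.lid k H (counit.rTensor H z)) := by
    intro z
    induction z using TensorProduct.induction_on with
    | zero => simp
    | add a b ha hb => simp only [map_add, ha, hb]
    | tmul a b => simp [mul_comm]
  rw [translate_apply, e, rTensor_counit_comul]; simp

theorem translate_counit (h : H) : translate (counit (R := k)) h = h := by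
  rw [translate_apply, contract, LinearMap.comp_apply, lTensor_counit_comul]; simp

theorem translate_one (φ : H →ₗ[k] k) : translate φ (1 : H) = φ 1 • 1 := by
  rw [translate_apply, Bialgebra.comul_one, Algebra.TensorProduct.one_def, contract_tmul]

/-- Coassociativity: translation contracts the last factor of the iterated coproduct, so it can be
carried out on the second leg. -/
theorem comul_translate (φ : H →ₗ[k] k) (h : H) :
    comul (R := k) (translate φ h) = (translate φ).lTensor H (comul (R := k) h) := by
  have e : ∀ z : H ⊗[k] H, comul (R := k) (contract φ z) =
      contract φ (comul.rTensor H z) := by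
    intro z
    rw [contract_rTensor]
  have e2 : ∀ z : H ⊗[k] (H ⊗[k] H), contract φ ((TensorProduct.assoc k H H H).symm z) =
      (contract φ).lTensor H z := by
    intro z
    induction z using TensorProduct.induction_on with
    | zero => simp
    | add a b ha hb => simp only [map_add, ha, hb]
    | tmul a b =>
      induction b using TensorProduct.induction_on with
      | zero => simp
      | add x y hx hy => simp only [map_add, TensorProduct.tmul_add, hx, hy]
      | tmul b c => simp
  rw [translate_apply, e, ← LinearEquiv.symm_apply_apply (TensorProduct.assoc k H H H)
    (comul.rTensor H (comul h)), coassoc_apply, e2, translate, LinearMap.lTensor_comp]; rfl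

theorem contract_tmul_one_mul {G : Type*} [Ring G] [Algebra k G] (φ : H →ₗ[k] k) (g : G)
    (z : G ⊗[k] H) : contract φ ((g ⊗ₜ 1) * z) = g * contract φ z := by
  induction z using TensorProduct.induction_on with
  | zero => simp
  | add a b ha hb => simp only [map_add, mul_add, ha, hb]
  | tmul m h => simp

theorem contract_mul_tmul_one {G : Type*} [Ring G] [Algebra k G] (φ : H →ₗ[k] k) (g : G)
    (z : G ⊗[k] H) : contract φ (z * (g ⊗ₜ 1)) = contract φ z * g := by
  induction z using TensorProduct.induction_on with
  | zero => simp
  | add a b ha hb => simp only [map_add, add_mul, ha, hb]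
  | tmul m h => simp

theorem contract_one_tmul_mul {G : Type*} [Ring G] [Algebra k G] (φ : H →ₗ[k] k) (h : H)
    (z : G ⊗[k] H) :
    contract φ ((1 ⊗ₜ h) * z) = contract (φ ∘ₗ LinearMap.mulLeft k h) z := by
  induction z using TensorProduct.induction_on with
  | zero => simp
  | add a b ha hb => simp only [map_add, mul_add, ha, hb]
  | tmul m h => simp

theorem contract_mul_one_tmul {G : Type*} [Ring G] [Algebra k G] (φ : H →ₗ[k] k) (h : H)
    (z : G ⊗[k] H) :
    contract φ (z * (1 ⊗ₜ h)) = contract (φ ∘ₗ LinearMap.mulRight k h) z := by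
  induction z using TensorProduct.induction_on with
  | zero => simp
  | add a b ha hb => simp only [map_add, add_mul, ha, hb]
  | tmul m h => simp

theorem mul_antipode_comul_comul (h : H) :
    (LinearMap.mul' k H ∘ₗ (antipode k).lTensor H).rTensor H
      (comul.rTensor H (comul (R := k) h)) = 1 ⊗ₜ h := by
  have e := mul_antipode_lTensor_comul (R := k) (A := H)
  rw [← LinearMap.comp_apply, ← LinearMap.rTensor_comp, LinearMap.comp_assoc, e,
    LinearMap.rTensor_comp, LinearMap.comp_apply, rTensor_counit_comul]
  simp

theorem antipode_mul_comul_comul (h : H) :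
    (LinearMap.mul' k H ∘ₗ (antipode k).rTensor H).rTensor H
      (comul.rTensor H (comul (R := k) h)) = 1 ⊗ₜ h := by
  have e := mul_antipode_rTensor_comul (R := k) (A := H)
  rw [← LinearMap.comp_apply, ← LinearMap.rTensor_comp, LinearMap.comp_assoc, e,
    LinearMap.rTensor_comp, LinearMap.comp_apply, rTensor_counit_comul]
  simp

/-- `∑ (S(h₁) ⊗ 1) Δ(h₂) = 1 ⊗ h`. -/
theorem antipode_tmul_one_mul_comul (h : H) :
    (LinearMap.mul' k (H ⊗[k] H) ∘ₗ TensorProduct.map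
      ((TensorProduct.mk k H H).flip 1 ∘ₗ antipode k) comul) (comul (R := k) h) = 1 ⊗ₜ h := by
  rw [← antipode_mul_comul_comul (k := k) h]
  have e : ∀ z : (H ⊗[k] H) ⊗[k] H,
      (LinearMap.mul' k H ∘ₗ (antipode k).rTensor H).rTensor H z =
      (LinearMap.mul' k (H ⊗[k] H) ∘ₗ TensorProduct.map
        ((TensorProduct.mk k H H).flip 1 ∘ₗ antipode k) LinearMap.id)
        (TensorProduct.assoc k H H H z) := by
    intro z
    induction z using TensorProduct.induction_on with
    | zero => simp
    | add a b ha hb => rw [map_add, ha, hb, map_add, map_add]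
    | tmul u z =>
      induction u using TensorProduct.induction_on with
      | zero => simp
      | add a b ha hb => rw [TensorProduct.add_tmul, map_add, ha, hb, map_add, map_add]
      | tmul x y => simp
  rw [e, coassoc_apply, LinearMap.comp_apply, LinearMap.comp_apply, ← map_comp_right_apply,
    LinearMap.id_comp]

/-- `∑ S(h₁) (h₂ g)₁ φ((h₂ g)₂) = ∑ g₁ φ(h g₂)`. -/
theorem antipode_mul_translate (φ : H →ₗ[k] k) (g h : H) :
    (LinearMap.mul' k H ∘ₗ TensorProduct.map (antipode k)
      (translate φ ∘ₗ LinearMap.mulRight k g)) (comul (R := k) h) =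
      translate (φ ∘ₗ LinearMap.mulLeft k h) g := by
  -- The identity Σ (S(h₁) ⊗ 1)Δ(h₂) = 1 ⊗ h is multiplied on the right by Δ(g) and contracted with
  -- φ; multiplicativity of Δ then combines Δ(h₂)Δ(g).
  have e := congrArg (contract φ ∘ₗ LinearMap.mulRight k (comul (R := k) g))
    (antipode_tmul_one_mul_comul (k := k) h)
  rw [LinearMap.comp_apply _ _ ((1 : H) ⊗ₜ[k] h), LinearMap.mulRight_apply,
    contract_one_tmul_mul] at e
  rw [translate_apply, ← e]
  generalize comul (R := k) h = z
  induction z using TensorProduct.induction_on with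
  | zero => simp
  | add a b ha hb => rw [map_add, map_add, map_add, ha, hb]
  | tmul x y =>
    simp only [LinearMap.comp_apply, TensorProduct.map_tmul, LinearMap.mul'_apply,
      LinearMap.mulRight_apply, LinearMap.flip_apply, TensorProduct.mk_apply, mul_assoc,
      contract_tmul_one_mul, translate_apply, Bialgebra.comul_mul]

/-- `∑ h₁ S((g h₂)₁) φ((g h₂)₂) = ∑ S(g₁) φ(g₂ h)`. -/
theorem mul_antipode_translate (φ : H →ₗ[k] k) (g h : H) :
    (LinearMap.mul' k H ∘ₗ TensorProduct.map LinearMap.id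
      (antipode k ∘ₗ translate φ ∘ₗ LinearMap.mulLeft k g)) (comul (R := k) h) =
      antipode k (translate (φ ∘ₗ LinearMap.mulRight k h) g) := by
  -- Δ(g) is replaced by an arbitrary tensor t, so that induction on t is possible. As S is
  -- antimultiplicative, S(h₂) comes out next to h₁ and Σ h₁S(h₂) ⊗ h₃ = 1 ⊗ h applies.
  have key : ∀ t : H ⊗[k] H, (LinearMap.mul' k H ∘ₗ TensorProduct.map LinearMap.id
      (antipode k ∘ₗ contract φ ∘ₗ LinearMap.mulLeft k t ∘ₗ comul)) (comul (R := k) h) =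
      antipode k (contract φ (t * (1 ⊗ₜ h))) := by
    intro t
    have e : ∀ z : H ⊗[k] (H ⊗[k] H), (LinearMap.mul' k H ∘ₗ TensorProduct.map LinearMap.id
      (antipode k ∘ₗ contract φ ∘ₗ LinearMap.mulLeft k t)) z =
      (LinearMap.mul' k H ∘ₗ TensorProduct.map LinearMap.id
        (antipode k ∘ₗ contract φ ∘ₗ LinearMap.mulLeft k t ∘ₗ TensorProduct.mk k H H 1))
        ((LinearMap.mul' k H ∘ₗ (antipode k).lTensor H).rTensor H
          ((TensorProduct.assoc k H H H).symm z)) := by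
      intro z
      induction z using TensorProduct.induction_on with
      | zero => simp
      | add a b ha hb => rw [map_add, ha, hb, map_add, map_add, map_add]
      | tmul x z =>
        induction z using TensorProduct.induction_on with
        | zero => simp
        | add a b ha hb => rw [TensorProduct.tmul_add, map_add, ha, hb, map_add, map_add, map_add]
        | tmul y z =>
          simp only [LinearMap.comp_apply, TensorProduct.map_tmul,
            LinearMap.mul'_apply, LinearMap.mulLeft_apply,
            TensorProduct.assoc_symm_tmul, LinearMap.rTensor_tmul, LinearMap.lTensor_tmul,
            TensorProduct.mk_apply, LinearMap.id_apply]
          induction t using TensorProduct.induction_on with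
          | zero => simp
          | add a b ha hb => simp only [add_mul, map_add, mul_add, ha, hb]
          | tmul u v => simp [antipode_mul_antidistrib, mul_assoc]
    have h2 : (LinearMap.mul' k H ∘ₗ TensorProduct.map LinearMap.id
      (antipode k ∘ₗ contract φ ∘ₗ LinearMap.mulLeft k t ∘ₗ comul)) =
      (LinearMap.mul' k H ∘ₗ TensorProduct.map LinearMap.id
      (antipode k ∘ₗ contract φ ∘ₗ LinearMap.mulLeft k t)) ∘ₗ comul.lTensor H := by
      rw [LinearMap.comp_assoc, LinearMap.map_comp_lTensor]; rfl
    rw [h2, LinearMap.comp_apply, e, coassoc_symm_apply, mul_antipode_comul_comul]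
    simp
  have h3 := key (comul (R := k) g)
  rw [contract_mul_one_tmul] at h3
  rw [translate_apply, ← h3]
  congr 3
  ext x
  simp [translate_apply, Bialgebra.comul_mul]

/-- `Δ(S(h)) = ∑ S(h₂) ⊗ S(h₁)`. -/
theorem comul_antipode (h : H) : comul (R := k) (antipode k h) =
    TensorProduct.map (antipode k) (antipode k) (TensorProduct.comm k H H (comul (R := k) h)) := by
  -- Uniqueness of inverses in the convolution algebra Hom(H, H ⊗ H): Δ ∘ S is a right inverse of Δ,
  -- and the flipped S ⊗ S after Δ is shown to be a left inverse.
  have hl : WithConv.toConv (TensorProduct.map (antipode k) (antipode k) ∘ₗ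
      (TensorProduct.comm k H H).toLinearMap ∘ₗ comul) * WithConv.toConv (comul (R := k) (A := H))
        = 1 := by
    apply WithConv.ext
    rw [LinearMap.convMul_def, LinearMap.convOne_def]
    simp only
    ext h
    -- Splitting S(h₂) ⊗ S(h₁) as (1 ⊗ S(h₁))(S(h₂) ⊗ 1) lets the second factor combine with Δ(h₃)
    -- to 1 ⊗ h₂. What remains is 1 ⊗ Σ S(h₁)h₂ = ε(h).
    have e : ∀ z : H ⊗[k] (H ⊗[k] H), (LinearMap.mul' k (H ⊗[k] H) ∘ₗ
        TensorProduct.map (TensorProduct.map (antipode k) (antipode k) ∘ₗ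
          (TensorProduct.comm k H H).toLinearMap) comul)
          ((TensorProduct.assoc k H H H).symm z) =
        (LinearMap.mul' k (H ⊗[k] H) ∘ₗ TensorProduct.map
          (TensorProduct.mk k H H 1 ∘ₗ antipode k)
          (LinearMap.mul' k (H ⊗[k] H) ∘ₗ TensorProduct.map
            ((TensorProduct.mk k H H).flip 1 ∘ₗ antipode k) comul)) z := by
      intro z
      induction z using TensorProduct.induction_on with
      | zero => simp
      | add a b ha hb => rw [map_add, map_add, ha, hb, map_add]
      | tmul x z =>
        induction z using TensorProduct.induction_on with
        | zero => simp
        | add a b ha hb => rw [TensorProduct.tmul_add, map_add, map_add, ha, hb, map_add]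
        | tmul y z => simp [← mul_assoc]
    have h1 : (LinearMap.mul' k (H ⊗[k] H) ∘ₗ TensorProduct.map
        (TensorProduct.map (antipode k) (antipode k) ∘ₗ
          (TensorProduct.comm k H H).toLinearMap ∘ₗ comul) comul ∘ₗ comul) h =
        (LinearMap.mul' k (H ⊗[k] H) ∘ₗ
        TensorProduct.map (TensorProduct.map (antipode k) (antipode k) ∘ₗ
          (TensorProduct.comm k H H).toLinearMap) comul)
          (comul.rTensor H (comul (R := k) h)) := by
      rw [LinearMap.comp_apply, LinearMap.comp_apply, LinearMap.comp_apply,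
        ← map_comp_left_apply]; rfl
    rw [h1, ← coassoc_symm_apply, e, LinearMap.comp_apply, ← map_comp_right_apply]
    have h2 : ((LinearMap.mul' k (H ⊗[k] H) ∘ₗ TensorProduct.map
            ((TensorProduct.mk k H H).flip 1 ∘ₗ antipode k) comul) ∘ₗ comul (R := k) (A := H)) =
            TensorProduct.mk k H H 1 := by
      ext x
      exact antipode_tmul_one_mul_comul x
    rw [h2]
    have h3 : ∀ z : H ⊗[k] H, LinearMap.mul' k (H ⊗[k] H) (TensorProduct.map
        (TensorProduct.mk k H H 1 ∘ₗ antipode k) (TensorProduct.mk k H H 1) z) =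
        (1 : H) ⊗ₜ[k] LinearMap.mul' k H ((antipode k).rTensor H z) := by
      intro z
      induction z using TensorProduct.induction_on with
      | zero => simp
      | add a b ha hb => simp only [map_add, TensorProduct.tmul_add, ha, hb]
      | tmul x y => simp
    rw [h3, mul_antipode_rTensor_comul_apply]
    simp [Algebra.algebraMap_eq_smul_one, Algebra.TensorProduct.one_def]
  have := left_inv_eq_right_inv hl LinearMap.comul_right_inv
  exact (LinearMap.congr_fun (congrArg WithConv.ofConv this) h).symm

section AntipodeInv

variable (hS : Function.Bijective (antipode k (A := H)))

theorem antipode_antipodeInv (h : H) : antipode k (antipodeInv hS h) = h :=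
  (LinearEquiv.ofBijective (antipode k (A := H)) hS).apply_symm_apply h

theorem antipodeInv_antipode (h : H) : antipodeInv hS (antipode k h) = h :=
  (LinearEquiv.ofBijective (antipode k (A := H)) hS).symm_apply_apply h

theorem antipodeInv_mul (g h : H) :
    antipodeInv hS (g * h) = antipodeInv hS h * antipodeInv hS g := by
  apply hS.1
  simp only [antipode_mul_antidistrib, antipode_antipodeInv]

theorem antipodeInv_one : antipodeInv hS 1 = 1 := by
  apply hS.1
  rw [antipode_antipodeInv, antipode_one]

theorem counit_antipodeInv (h : H) : counit (R := k) (antipodeInv hS h) = counit (R := k) h := by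
  rw [← counit_antipode (R := k), antipode_antipodeInv]

end AntipodeInv

end Hopf

/-! ### Relations between one-forms on H and the ideal R -/

section FibreIdeal

open HopfAlgebra Coalgebra

variable {k : Type*} {H : Type*} [Field k] [Ring H] [HopfAlgebra k H]
variable (Λ : DifferentialCalculus k H)

/-- The map `h ⊗ h' ↦ h dh'`. -/
def mulDiff : H ⊗[k] H →ₗ[k] Λ.Form :=
  LinearMap.mul' k Λ.Form ∘ₗ
    TensorProduct.map Λ.inj.toLinearMap (Λ.d ∘ₗ Λ.inj.toLinearMap)

/-- The map `h' ⊗ h ↦ dh' h`. -/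
def diffMul : H ⊗[k] H →ₗ[k] Λ.Form :=
  LinearMap.mul' k Λ.Form ∘ₗ
    TensorProduct.map (Λ.d ∘ₗ Λ.inj.toLinearMap) Λ.inj.toLinearMap

@[simp] theorem mulDiff_tmul (h h' : H) :
    mulDiff Λ (h ⊗ₜ h') = Λ.inj h * Λ.d (Λ.inj h') := rfl

@[simp] theorem diffMul_tmul (h h' : H) :
    diffMul Λ (h ⊗ₜ h') = Λ.d (Λ.inj h) * Λ.inj h' := rfl

/-- The map `h ⊗ h' ↦ ∑ φ(h h'₂) h'₁`. -/
def translateMul (φ : H →ₗ[k] k) : H ⊗[k] H →ₗ[k] H :=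
  contract φ ∘ₗ LinearMap.mul' k (H ⊗[k] H) ∘ₗ TensorProduct.map (TensorProduct.mk k H H 1) comul

/-- The map `h' ⊗ h ↦ ∑ φ(h'₂ h) h'₁`. -/
def mulTranslate (φ : H →ₗ[k] k) : H ⊗[k] H →ₗ[k] H :=
  contract φ ∘ₗ LinearMap.mul' k (H ⊗[k] H) ∘ₗ TensorProduct.map comul (TensorProduct.mk k H H 1)

@[simp] theorem translateMul_tmul (φ : H →ₗ[k] k) (h h' : H) :
    translateMul φ (h ⊗ₜ h') = translate (φ ∘ₗ LinearMap.mulLeft k h) h' :=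
  contract_one_tmul_mul φ h (comul (R := k) h')

@[simp] theorem mulTranslate_tmul (φ : H →ₗ[k] k) (h h' : H) :
    mulTranslate φ (h ⊗ₜ h') = translate (φ ∘ₗ LinearMap.mulRight k h') h :=
  contract_mul_one_tmul φ h' (comul (R := k) h)

variable (hS : Function.Bijective (antipode k (A := H)))
variable {Λ}
variable (cov : RightCovariant Λ)

include cov

/-- Right covariance turns the relation Σ h dh' = 0 into Σ h₁dh'₁ ⊗ h₂h'₂ = 0. Translating the
second leg by φ, applying S⁻¹ and multiplying from the left cancels h₁ against S⁻¹(h₂) by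
`antipode_mul_translate`, leaving η of the translated element. -/
theorem eta_translateMul {w : H ⊗[k] H} (hw : mulDiff Λ w = 0) (φ : H →ₗ[k] k) :
    eta Λ hS (translateMul φ w) = 0 := by
  have key : (LinearMap.mul' k Λ.Form ∘ₗ
      TensorProduct.map (Λ.inj.toLinearMap ∘ₗ antipodeInv hS ∘ₗ translate φ) LinearMap.id ∘ₗ
        (TensorProduct.comm k Λ.Form H).toLinearMap) (cov.coact (mulDiff Λ w)) =
      eta Λ hS (translateMul φ w) := by
    clear hw
    induction w using TensorProduct.induction_on with
    | zero => simp
    | add a b ha hb => rw [map_add, map_add, map_add, ha, hb, map_add, map_add]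
    | tmul h h' =>
      rw [mulDiff_tmul, map_mul, cov.coact_inj, cov.coact_d, translateMul_tmul, eta,
        LinearMap.comp_apply _ _ (translate _ _), LinearMap.comp_apply _ _ (translate _ _),
        LinearMap.comp_apply _ _ (translate _ _), comul_translate]
      generalize comul (R := k) h' = t
      induction t using TensorProduct.induction_on with
      | zero => simp
      | add a b ha hb =>
        simp only [map_add, mul_add] at ha hb ⊢
        rw [ha, hb]
      | tmul x y =>
        have e := congrArg (antipodeInv hS) (antipode_mul_translate φ y h)
        simp only [LinearMap.rTensor_tmul, LinearMap.lTensor_tmul, LinearEquiv.coe_coe,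
          TensorProduct.comm_tmul, TensorProduct.map_tmul, LinearMap.comp_apply _ (antipodeInv hS),
          LinearMap.mul'_apply]
        rw [← e]
        generalize comul (R := k) h = z
        induction z using TensorProduct.induction_on with
        | zero => simp
        | add a b ha hb => simp only [map_add, add_mul] at ha hb ⊢; rw [ha, hb]
        | tmul u v =>
          simp only [LinearMap.comp_apply, LinearMap.rTensor_tmul, LinearEquiv.coe_coe,
            Algebra.TensorProduct.tmul_mul_tmul,
            TensorProduct.comm_tmul, TensorProduct.map_tmul, LinearMap.mul'_apply,
            LinearMap.mulRight_apply, antipodeInv_mul, antipodeInv_antipode,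
            AlgHom.toLinearMap_apply, map_mul, LinearMap.id_apply, mul_assoc]
  rw [← key, hw, map_zero, map_zero]

omit cov in
-- Apply d to Σ g₁S(g₂) = ε(g)1: the Leibniz rule gives Σ dg₁ S(g₂) = -Σ g₁ dS(g₂). Since ΔS(g) = Σ
-- S(g₂) ⊗ S(g₁), the last sum is η(S(g)). This is the source of S⁻¹(R) in the right case.
theorem diffMul_antipode (g : H) :
    diffMul Λ ((antipode k).lTensor H (comul (R := k) g)) = -eta Λ hS (antipode k g) := by
  have e : ∀ z : H ⊗[k] H, diffMul Λ ((antipode k).lTensor H z) +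
      (LinearMap.mul' k Λ.Form ∘ₗ
        TensorProduct.map (Λ.inj.toLinearMap ∘ₗ antipodeInv hS) (Λ.d ∘ₗ Λ.inj.toLinearMap) ∘ₗ
      (TensorProduct.comm k H H).toLinearMap) (TensorProduct.map (antipode k) (antipode k)
        (TensorProduct.comm k H H z)) =
      Λ.d (Λ.inj (LinearMap.mul' k H ((antipode k).lTensor H z))) := by
    intro z
    induction z using TensorProduct.induction_on with
    | zero => simp
    | add a b ha hb => simp only [map_add] at ha hb ⊢; rw [← ha, ← hb]; abel
    | tmul x y => simp [Λ.d_inj_mul, antipodeInv_antipode, -map_mul]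
  rw [eq_neg_iff_add_eq_zero, eta]
  have h := e (comul (R := k) g)
  rw [← comul_antipode, mul_antipode_lTensor_comul_apply, Algebra.algebraMap_eq_smul_one,
    map_smul, map_smul, map_one, Λ.d_one, smul_zero] at h
  exact h

/-- Mirror image of `eta_translateMul`: the coaction of Σ dh' h = 0 is multiplied out with S of the
translated second leg. This produces Σ dg₁ S(g₂) for the translated element g, which
`diffMul_antipode` identifies with -η(S(g)). -/
theorem eta_antipode_mulTranslate {w : H ⊗[k] H} (hw : diffMul Λ w = 0) (φ : H →ₗ[k] k) :
    eta Λ hS (antipode k (mulTranslate φ w)) = 0 := by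
  have key : (LinearMap.mul' k Λ.Form ∘ₗ
      TensorProduct.map LinearMap.id (Λ.inj.toLinearMap ∘ₗ antipode k ∘ₗ translate φ))
        (cov.coact (diffMul Λ w)) =
      diffMul Λ ((antipode k).lTensor H (comul (R := k) (mulTranslate φ w))) := by
    clear hw
    induction w using TensorProduct.induction_on with
    | zero => simp
    | add a b ha hb => simp only [map_add] at ha hb ⊢; rw [ha, hb]
    | tmul h' h =>
      rw [diffMul_tmul, map_mul, cov.coact_inj, cov.coact_d, mulTranslate_tmul, comul_translate]
      generalize comul (R := k) h' = t
      induction t using TensorProduct.induction_on with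
      | zero => simp
      | add a b ha hb => simp only [map_add, add_mul] at ha hb ⊢; rw [ha, hb]
      | tmul x y =>
        have e := mul_antipode_translate φ y h
        rw [LinearMap.lTensor_tmul, LinearMap.lTensor_tmul, diffMul_tmul, ← e]
        generalize comul (R := k) h = z
        induction z using TensorProduct.induction_on with
        | zero => simp
        | add a b ha hb => simp only [map_add, mul_add] at ha hb ⊢; rw [ha, hb]
        | tmul u v => simp [mul_assoc]
  rw [← neg_eq_zero, ← diffMul_antipode hS, ← key, hw, map_zero, map_zero]

omit cov

/-! ### Extending colinear maps to module maps on one-forms of H -/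

section ComoduleMap

variable {G : Type*} [Ring G] [Algebra k G] (a : H →ₗ[k] G ⊗[k] H)

/-- The map `h ⊗ h' ↦ (1 ⊗ h) a(h')`. -/
def mulAct : H ⊗[k] H →ₗ[k] G ⊗[k] H :=
  LinearMap.mul' k (G ⊗[k] H) ∘ₗ TensorProduct.map (TensorProduct.mk k G H 1) a

/-- The map `h' ⊗ h ↦ a(h') (1 ⊗ h)`. -/
def actMul : H ⊗[k] H →ₗ[k] G ⊗[k] H :=
  LinearMap.mul' k (G ⊗[k] H) ∘ₗ TensorProduct.map a (TensorProduct.mk k G H 1)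

@[simp] theorem mulAct_tmul (h h' : H) : mulAct a (h ⊗ₜ h') = (1 ⊗ₜ h) * a h' := rfl

@[simp] theorem actMul_tmul (h h' : H) : actMul a (h ⊗ₜ h') = a h * (1 ⊗ₜ h') := rfl

variable {a}
variable (ha : ∀ (φ : H →ₗ[k] k) (h : H), a (translate φ h) = (translate φ).lTensor G (a h))

include ha

/-- By colinearity, contracting a(h) with φ amounts to translating h by φ and contracting with ε.
Hence a is recovered from (id ⊗ ε) ∘ a, the map on which the condition of the theorem is imposed. -/
theorem contract_comoduleMap (φ : H →ₗ[k] k) (h : H) :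
    contract φ (a h) = contract (counit (R := k)) (a (translate φ h)) := by
  rw [ha, contract_lTensor]
  congr 1
  congr 1
  ext x
  exact (counit_translate φ x).symm

theorem contract_mulAct (φ : H →ₗ[k] k) (w : H ⊗[k] H) :
    contract φ (mulAct a w) = contract (counit (R := k)) (a (translateMul φ w)) := by
  induction w using TensorProduct.induction_on with
  | zero => simp
  | add x y hx hy => simp only [map_add, hx, hy]
  | tmul h h' =>
    rw [mulAct_tmul, contract_one_tmul_mul, translateMul_tmul, contract_comoduleMap ha]

theorem contract_actMul (φ : H →ₗ[k] k) (w : H ⊗[k] H) :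
    contract φ (actMul a w) = contract (counit (R := k)) (a (mulTranslate φ w)) := by
  induction w using TensorProduct.induction_on with
  | zero => simp
  | add x y hx hy => simp only [map_add, hx, hy]
  | tmul h h' =>
    rw [actMul_tmul, contract_mul_one_tmul, mulTranslate_tmul, contract_comoduleMap ha]

/-- The relation to use is w = Σ S⁻¹(r₂) ⊗ r₁: its image h dh' is η(r) = 0. As ε ∘ S⁻¹ = ε,
translating w with ε returns Σ ε(r₂)r₁ = r. -/
theorem rightIdeal_le_of_mulAct (h : ∀ w, mulDiff Λ w = 0 → mulAct a w = 0) {r : H}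
    (hr : r ∈ rightIdeal Λ hS) : contract (counit (R := k)) (a r) = 0 := by
  set w := (antipodeInv hS).rTensor H (TensorProduct.comm k H H (comul (R := k) r)) with hw
  have h1 : mulDiff Λ w = 0 := by
    rw [← LinearMap.mem_ker.1 hr.1, hw, eta, mulDiff, LinearMap.comp_apply, ← map_comp_left_apply]
    rfl
  have h2 : translateMul (counit (R := k)) w = r := by
    have e : ∀ z : H ⊗[k] H, translateMul (counit (R := k))
        ((antipodeInv hS).rTensor H (TensorProduct.comm k H H z)) =
        contract (counit (R := k)) z := by
      intro z
      induction z using TensorProduct.induction_on with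
      | zero => simp
      | add x y hx hy => simp only [map_add, hx, hy]
      | tmul x y =>
        have e2 : (counit (R := k) ∘ₗ LinearMap.mulLeft k (antipodeInv hS y)) =
            counit (R := k) y • counit (R := k) (A := H) := by
          ext z; simp [Bialgebra.counit_mul, counit_antipodeInv]
        have e3 := translate_counit (k := k) x
        rw [TensorProduct.comm_tmul, LinearMap.rTensor_tmul, translateMul_tmul, e2, contract_tmul]
        rw [translate_apply] at e3 ⊢
        have e4 : ∀ (c : k) (φ : H →ₗ[k] k) (z : H ⊗[k] H), contract (c • φ) z = c • contract φ z := by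
          intro c φ z
          simp [contract, LinearMap.lTensor_smul]
        rw [e4, e3]
    rw [hw, e]; exact translate_counit r
  rw [← h2, ← contract_mulAct ha, h w h1, map_zero]

/-- With g = S⁻¹(r), the relation w = Σ g₁ ⊗ S(g₂) holds because Σ dg₁ S(g₂) = -η(r). Translating w
with ε returns g. -/
theorem rightIdeal_le_of_actMul (h : ∀ w, diffMul Λ w = 0 → actMul a w = 0) {r : H}
    (hr : r ∈ rightIdeal Λ hS) : contract (counit (R := k)) (a (antipodeInv hS r)) = 0 := by
  set g := antipodeInv hS r with hg
  set w := (antipode k).lTensor H (comul (R := k) g) with hw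
  have h1 : diffMul Λ w = 0 := by
    rw [hw, diffMul_antipode hS, hg, antipode_antipodeInv, LinearMap.mem_ker.1 hr.1, neg_zero]
  have h2 : mulTranslate (counit (R := k)) w = g := by
    have e : ∀ z : H ⊗[k] H, mulTranslate (counit (R := k))
        ((antipode k).lTensor H z) = contract (counit (R := k)) z := by
      intro z
      induction z using TensorProduct.induction_on with
      | zero => simp
      | add x y hx hy => simp only [map_add, hx, hy]
      | tmul x y =>
        have e2 : (counit (R := k) ∘ₗ LinearMap.mulRight k (antipode k y)) =
            counit (R := k) y • counit (R := k) (A := H) := by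
          ext z; simp [Bialgebra.counit_mul, mul_comm]
        have e3 := translate_counit (k := k) x
        rw [LinearMap.lTensor_tmul, mulTranslate_tmul, e2, contract_tmul]
        rw [translate_apply] at e3 ⊢
        have e4 : ∀ (c : k) (φ : H →ₗ[k] k) (z : H ⊗[k] H), contract (c • φ) z = c • contract φ z := by
          intro c φ z
          simp [contract, LinearMap.lTensor_smul]
        rw [e4, e3]
    rw [hw, e]; exact translate_counit g
  rw [← h2, ← contract_actMul ha, h w h1, map_zero]

include cov

variable (h1 : a 1 = 0)

include h1

/-- This is where R ⊂ ker Aᵢ is used. Each contraction of Σ (1 ⊗ h)a(h') is (id ⊗ ε)a(g) with η(g) =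
0, and g differs from an element of R by a multiple of 1, which a kills. Thus h dh' ↦ (1 ⊗ h)a(h')
is well defined. -/
theorem mulAct_eq_zero (hR : ∀ r ∈ rightIdeal Λ hS, contract (counit (R := k)) (a r) = 0)
    {w : H ⊗[k] H} (hw : mulDiff Λ w = 0) : mulAct a w = 0 := by
  refine eq_zero_of_contract fun φ => ?_
  rw [contract_mulAct ha]
  set g := translateMul φ w with hg
  have he : eta Λ hS 1 = 0 := by
    rw [eta]
    simp [Bialgebra.comul_one, Algebra.TensorProduct.one_def, Λ.d_one]
  -- Subtracting ε(g)1 moves g into ker ε and changes neither η(g), since η(1) = 0, nor a(g), since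
  -- a(1) = 0.
  have : g - counit (R := k) g • 1 ∈ rightIdeal Λ hS := by
    refine ⟨?_, ?_⟩
    · rw [SetLike.mem_coe, LinearMap.mem_ker, map_sub, map_smul, he,
        eta_translateMul hS cov hw φ, smul_zero, sub_zero]
    · simp [LinearMap.mem_ker]
  have h2 := hR _ this
  rwa [map_sub, map_smul, h1, smul_zero, sub_zero] at h2

/-- As in `mulAct_eq_zero`, but now η(S(g)) = 0, so S(g) - ε(g)1 is the element of R and S⁻¹ brings
it back to g - ε(g)1. -/
theorem actMul_eq_zero
    (hR : ∀ r ∈ rightIdeal Λ hS, contract (counit (R := k)) (a (antipodeInv hS r)) = 0)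
    {w : H ⊗[k] H} (hw : diffMul Λ w = 0) : actMul a w = 0 := by
  refine eq_zero_of_contract fun φ => ?_
  rw [contract_actMul ha]
  set g := mulTranslate φ w with hg
  have he : eta Λ hS 1 = 0 := by
    rw [eta]
    simp [Bialgebra.comul_one, Algebra.TensorProduct.one_def, Λ.d_one]
  have : antipode k g - counit (R := k) g • 1 ∈ rightIdeal Λ hS := by
    refine ⟨?_, ?_⟩
    · rw [SetLike.mem_coe, LinearMap.mem_ker, map_sub, map_smul, he,
        eta_antipode_mulTranslate hS cov hw φ, smul_zero, sub_zero]
    · simp [LinearMap.mem_ker]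
  have h2 := hR _ this
  rwa [map_sub, map_smul, antipodeInv_antipode, antipodeInv_one, map_sub, map_smul, h1, smul_zero,
    sub_zero] at h2

end ComoduleMap

end FibreIdeal

/-! ### The sign automorphism and the Leibniz rule without homogeneity -/

namespace DifferentialCalculus

variable {k : Type*} {A : Type*} [Field k] [Ring A] [Algebra k A] (Γ : DifferentialCalculus k A)

theorem sign_inj (a : A) : Γ.sign (Γ.inj a) = Γ.inj a := by
  rw [Γ.sign_of_mem (Γ.inj_mem a), pow_zero, one_smul]

theorem sign_d_inj (a : A) : Γ.sign (Γ.d (Γ.inj a)) = -Γ.d (Γ.inj a) := by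
  rw [Γ.sign_of_mem (Γ.d_inj_mem a), pow_one, neg_one_smul]

theorem sign_mul (ω η : Γ.Form) : Γ.sign (ω * η) = Γ.sign ω * Γ.sign η := by
  induction ω using DirectSum.Decomposition.inductionOn Γ.deg with
  | zero => simp
  | add a b ha hb => rw [add_mul, map_add, ha, hb, map_add, add_mul]
  | homogeneous a =>
    induction η using DirectSum.Decomposition.inductionOn Γ.deg with
    | zero => simp
    | add a b ha hb => rw [mul_add, map_add, ha, hb, map_add, mul_add]
    | homogeneous b =>
      rw [Γ.sign_of_mem (SetLike.mul_mem_graded a.2 b.2), Γ.sign_of_mem a.2, Γ.sign_of_mem b.2,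
        smul_mul_smul_comm, pow_add]

/-- Writing (-1)ⁿ as the operator `sign` frees the Leibniz rule from homogeneity assumptions, which
allows induction on arbitrary products and tensors. -/
theorem d_mul (ω η : Γ.Form) : Γ.d (ω * η) = Γ.d ω * η + Γ.sign ω * Γ.d η := by
  induction ω using DirectSum.Decomposition.inductionOn Γ.deg with
  | zero => simp
  | add a b ha hb => rw [add_mul, map_add, ha, hb, map_add, map_add, add_mul, add_mul]; abel
  | homogeneous a => rw [Γ.leibniz _ _ _ a.2, Γ.sign_of_mem a.2, smul_mul_assoc]

end DifferentialCalculus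

/-! ### Lifting operations and degrees to universal forms -/

section Adapted

variable {k : Type*} {A : Type*} {I : Type*} [Field k] [Ring A] [Algebra k A]
variable {C : I → Type*} [∀ i, Ring (C i)] [∀ i, Algebra k (C i)]
variable (f : ∀ i, A →ₐ[k] C i) (Γ : ∀ i, DifferentialCalculus k (C i))

theorem UniversalForms.adjoin_eq_top :
    Algebra.adjoin k (Set.range (UniversalForms.inj (A := A) k) ∪
      Set.range (UniversalForms.d (A := A) k)) = ⊤ := by
  rw [← top_le_iff]
  intro ω _
  obtain ⟨x, rfl⟩ := RingQuot.mkAlgHom_surjective k (UniversalRel k A) ω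
  induction x using FreeAlgebra.induction with
  | grade0 r => rw [AlgHom.commutes]; exact Subalgebra.algebraMap_mem _ _
  | grade1 x =>
    rcases x with a | a
    · exact Algebra.subset_adjoin (Or.inl ⟨a, rfl⟩)
    · exact Algebra.subset_adjoin (Or.inr ⟨a, rfl⟩)
  | mul a b ha hb => rw [map_mul]; exact mul_mem (ha trivial) (hb trivial)
  | add a b ha hb => rw [map_add]; exact add_mem (ha trivial) (hb trivial)

/-- Induction on universal forms. -/
theorem UniversalForms.induction {p : UniversalForms k A → Prop}
    (inj : ∀ a, p (UniversalForms.inj k a)) (d : ∀ a, p (UniversalForms.d k a))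
    (add : ∀ a b, p a → p b → p (a + b)) (mul : ∀ a b, p a → p b → p (a * b))
    (ω : UniversalForms k A) : p ω := by
  have h : ω ∈ Algebra.adjoin k (Set.range (UniversalForms.inj (A := A) k) ∪
      Set.range (UniversalForms.d (A := A) k)) := by
    rw [UniversalForms.adjoin_eq_top]; trivial
  induction h using Algebra.adjoin_induction with
  | mem x hx =>
    rcases hx with ⟨a, rfl⟩ | ⟨a, rfl⟩
    · exact inj a
    · exact d a
  | algebraMap r =>
    rw [← (UniversalForms.inj (A := A) k).commutes r]
    exact inj _
  | add x y _ _ hx hy => exact add x y hx hy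
  | mul x y _ _ hx hy => exact mul x y hx hy

/-- Induction on generators: a is fixed, da changes sign, products and sums follow. The point is a
single lift serving all i at once, as gluing requires. -/
theorem exists_extUniversal_sign (ω : UniversalForms k A) :
    ∃ ω' : UniversalForms k A, ∀ i, extUniversal f Γ i ω' = (Γ i).sign (extUniversal f Γ i ω) := by
  induction ω using UniversalForms.induction with
  | inj a =>
    exact ⟨UniversalForms.inj k a, fun i => by
      rw [extUniversal_inj, DifferentialCalculus.sign_inj]⟩
  | d a =>
    exact ⟨-UniversalForms.d k a, fun i => by
      rw [map_neg, extUniversal_d, DifferentialCalculus.sign_d_inj]⟩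
  | add a b ha hb =>
    obtain ⟨a', ha⟩ := ha
    obtain ⟨b', hb⟩ := hb
    exact ⟨a' + b', fun i => by rw [map_add, map_add, map_add, ha, hb]⟩
  | mul a b ha hb =>
    obtain ⟨a', ha⟩ := ha
    obtain ⟨b', hb⟩ := hb
    exact ⟨a' * b', fun i => by rw [map_mul, map_mul, DifferentialCalculus.sign_mul, ha, hb]⟩

/-- The kernels of `Ω(A) → Γ(Cᵢ)` are differential ideals, uniformly in `i`. -/
theorem exists_extUniversal_d (ω : UniversalForms k A) :
    ∃ ω' : UniversalForms k A, ∀ i, extUniversal f Γ i ω' = (Γ i).d (extUniversal f Γ i ω) := by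
  induction ω using UniversalForms.induction with
  | inj a => exact ⟨UniversalForms.d k a, fun i => by rw [extUniversal_inj, extUniversal_d]⟩
  | d a => exact ⟨0, fun i => by rw [extUniversal_d, (Γ i).d_d, map_zero]⟩
  | add a b ha hb =>
    obtain ⟨a', ha⟩ := ha
    obtain ⟨b', hb⟩ := hb
    exact ⟨a' + b', fun i => by rw [map_add, map_add, map_add, ha, hb]⟩
  | mul a b ha hb =>
    obtain ⟨a', ha⟩ := ha
    obtain ⟨b', hb⟩ := hb
    obtain ⟨s, hs⟩ := exists_extUniversal_sign f Γ a
    exact ⟨a' * b + s * b', fun i => by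
      rw [map_mul, map_add, map_mul, map_mul, DifferentialCalculus.d_mul, ha, hb, hs]⟩

variable (k A) in
/-- The universal one-forms, spanned by the `a db`. -/
def universalOne : Submodule k (UniversalForms k A) :=
  Submodule.span k {ω | ∃ a b : A, ω = UniversalForms.inj k a * UniversalForms.d k b}

theorem inj_mul_mem_universalOne (a : A) {ω : UniversalForms k A} (h : ω ∈ universalOne k A) :
    UniversalForms.inj k a * ω ∈ universalOne k A := by
  induction h using Submodule.span_induction with
  | zero => simp
  | add x y _ _ hx hy => rw [mul_add]; exact add_mem hx hy
  | smul c x _ hx => rw [mul_smul_comm]; exact Submodule.smul_mem _ _ hx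
  | mem x hx =>
    obtain ⟨b, c, rfl⟩ := hx
    rw [← mul_assoc, ← map_mul]
    exact Submodule.subset_span ⟨_, _, rfl⟩

/-- The Leibniz rule moves a to the left: (b dc)a = b d(ca) - bc da. -/
theorem mul_inj_mem_universalOne (a : A) {ω : UniversalForms k A} (h : ω ∈ universalOne k A) :
    ω * UniversalForms.inj k a ∈ universalOne k A := by
  induction h using Submodule.span_induction with
  | zero => simp
  | add x y _ _ hx hy => rw [add_mul]; exact add_mem hx hy
  | smul c x _ hx => rw [smul_mul_assoc]; exact Submodule.smul_mem _ _ hx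
  | mem x hx =>
    obtain ⟨b, c, rfl⟩ := hx
    have : UniversalForms.inj k b * UniversalForms.d k c * UniversalForms.inj k a =
        UniversalForms.inj k b * UniversalForms.d k (c * a) -
          UniversalForms.inj k (b * c) * UniversalForms.d k a := by
      rw [UniversalForms.d_mul, map_mul]; noncomm_ring
    rw [this]
    exact sub_mem (Submodule.subset_span ⟨_, _, rfl⟩) (Submodule.subset_span ⟨_, _, rfl⟩)

/-- The homogeneous universal forms. -/
def universalDeg (n : ℕ) : Submodule k (UniversalForms k A) :=
  (⨅ i, ((Γ i).deg n).comap (extUniversal f Γ i).toLinearMap) ⊓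
    if n = 0 then LinearMap.range (UniversalForms.inj (A := A) k).toLinearMap else
    if n = 1 then universalOne k A else ⊤

theorem extUniversal_mem_deg {n : ℕ} {ω : UniversalForms k A} (h : ω ∈ universalDeg f Γ n) (i : I) :
    extUniversal f Γ i ω ∈ (Γ i).deg n :=
  (Submodule.mem_iInf _).1 h.1 i

/-- A substitute for the grading of Ω(A). Degrees 0 and 1 are pinned down to A and the span of the a
db, higher degrees are restricted only through their images. Multiplicative closure suffices, since
A and dA already generate; no directness is needed. -/
instance universalGraded : SetLike.GradedMonoid (universalDeg f Γ) where
  one_mem := by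
    refine ⟨(Submodule.mem_iInf _).2 fun i => ?_, ?_⟩
    · rw [Submodule.mem_comap, AlgHom.toLinearMap_apply, map_one]; exact SetLike.GradedOne.one_mem
    · rw [if_pos rfl]; exact ⟨1, map_one (UniversalForms.inj k)⟩
  mul_mem := by
    intro m n a b ha hb
    refine ⟨(Submodule.mem_iInf _).2 fun i => ?_, ?_⟩
    · rw [Submodule.mem_comap, AlgHom.toLinearMap_apply, map_mul]
      exact SetLike.mul_mem_graded (extUniversal_mem_deg f Γ ha i) (extUniversal_mem_deg f Γ hb i)
    · have ha := ha.2
      have hb := hb.2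
      by_cases hm : m = 0
      · subst hm
        rw [if_pos rfl] at ha
        obtain ⟨x, rfl⟩ := ha
        rw [zero_add]
        by_cases hn : n = 0
        · rw [if_pos hn] at hb ⊢
          obtain ⟨y, rfl⟩ := hb
          exact ⟨x * y, map_mul (UniversalForms.inj k) x y⟩
        · rw [if_neg hn] at hb ⊢
          split_ifs with h1
          · rw [if_pos h1] at hb
            exact inj_mul_mem_universalOne x hb
          · trivial
      · rw [if_neg (by omega)]
        split_ifs with h1
        · obtain ⟨rfl, rfl⟩ : m = 1 ∧ n = 0 := by omega
          simp only [one_ne_zero, if_true, if_false] at ha hb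
          obtain ⟨y, rfl⟩ := hb
          exact mul_inj_mem_universalOne y ha
        · trivial

theorem inj_mem_universalDeg (a : A) : UniversalForms.inj k a ∈ universalDeg f Γ 0 := by
  refine ⟨(Submodule.mem_iInf _).2 fun i => ?_, ?_⟩
  · rw [Submodule.mem_comap, AlgHom.toLinearMap_apply, extUniversal_inj]; exact (Γ i).inj_mem _
  · rw [if_pos rfl]; exact ⟨a, rfl⟩

theorem d_mem_universalDeg (a : A) : UniversalForms.d k a ∈ universalDeg f Γ 1 := by
  refine ⟨(Submodule.mem_iInf _).2 fun i => ?_, ?_⟩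
  · rw [Submodule.mem_comap, AlgHom.toLinearMap_apply, extUniversal_d]; exact (Γ i).d_inj_mem _
  · rw [if_neg one_ne_zero, if_pos rfl]
    exact Submodule.subset_span ⟨1, a, by rw [map_one, one_mul]⟩

/-- The subspaces `universalDeg` span Ω(A) and each maps into the forms of its degree. So the n-th
part of any decomposition of ω has as image the degree-n component, for all i simultaneously, and
nothing changes over the pieces where that image was already of degree n. -/
theorem exists_component (ω : UniversalForms k A) (n : ℕ) :
    ∃ ω' ∈ universalDeg f Γ n, ∀ i, extUniversal f Γ i ω ∈ (Γ i).deg n →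
      extUniversal f Γ i ω' = extUniversal f Γ i ω := by
  have hsurj : ∃ z, DirectSum.coeAlgHom (universalDeg f Γ) z = ω := by
    induction ω using UniversalForms.induction with
    | inj a =>
      exact ⟨DirectSum.of (fun i => universalDeg f Γ i) 0 ⟨_, inj_mem_universalDeg f Γ a⟩, by simp⟩
    | d a =>
      exact ⟨DirectSum.of (fun i => universalDeg f Γ i) 1 ⟨_, d_mem_universalDeg f Γ a⟩, by simp⟩
    | add a b ha hb =>
      obtain ⟨x, rfl⟩ := ha
      obtain ⟨y, rfl⟩ := hb
      exact ⟨x + y, map_add _ _ _⟩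
    | mul a b ha hb =>
      obtain ⟨x, rfl⟩ := ha
      obtain ⟨y, rfl⟩ := hb
      exact ⟨x * y, map_mul _ _ _⟩
  obtain ⟨z, rfl⟩ := hsurj
  refine ⟨z n, (z n).2, fun i hi => ?_⟩
  have key : ∀ z : DirectSum ℕ (fun n => universalDeg f Γ n),
      ((DirectSum.decompose (Γ i).deg (extUniversal f Γ i (DirectSum.coeAlgHom _ z)) n :
        (Γ i).deg n) : (Γ i).Form) = extUniversal f Γ i (z n) := by
    intro z
    induction z using DirectSum.induction_on with
    | zero => simp
    | of m y =>
      have hy : DirectSum.coeAlgHom (universalDeg f Γ) (DirectSum.of _ m y) =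
        (y : UniversalForms k A) := by simp
      rw [hy]
      by_cases h : m = n
      · subst h
        rw [DirectSum.decompose_of_mem_same _ (extUniversal_mem_deg f Γ y.2 i), DirectSum.of_eq_same]
      · rw [DirectSum.decompose_of_mem_ne _ (extUniversal_mem_deg f Γ y.2 i) h,
          DirectSum.of_eq_of_ne _ _ _ (Ne.symm h), ZeroMemClass.coe_zero, map_zero]
    | add x y hx hy =>
      rw [map_add, map_add, DirectSum.decompose_add, DirectSum.add_apply, Submodule.coe_add, hx, hy,
        DirectSum.add_apply, Submodule.coe_add, map_add]
  rw [← key z, DirectSum.decompose_of_mem_same _ hi]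

theorem exists_universalDeg (hf : ∀ i, Function.Surjective (f i)) (i : I) {n : ℕ}
    {γ : (Γ i).Form} (hγ : γ ∈ (Γ i).deg n) :
    ∃ ω ∈ universalDeg f Γ n, extUniversal f Γ i ω = γ := by
  obtain ⟨ω, rfl⟩ := extUniversal_surjective f Γ hf i γ
  obtain ⟨ω', h1, h2⟩ := exists_component f Γ ω n
  exact ⟨ω', h1, h2 i hγ⟩

theorem universalDeg_one_le : universalDeg f Γ 1 ≤ universalOne k A := by
  intro ω h
  have := h.2
  rwa [if_neg one_ne_zero, if_pos rfl] at this

/-- A pair of one-forms which glue has a common lift of the form `∑ a db`. -/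
theorem exists_universalOne {γ : ∀ i, (Γ i).Form} (hγ : γ ∈ localForms f Γ)
    (h1 : γ ∈ localDeg Γ 1) (i j : I) :
    ∃ ω ∈ universalOne k A, extUniversal f Γ i ω = γ i ∧ extUniversal f Γ j ω = γ j := by
  obtain ⟨ω, hi, hj⟩ := (mem_localForms f Γ).1 hγ i j
  rw [mem_localDeg] at h1
  obtain ⟨ω', h, h'⟩ := exists_component f Γ ω 1
  refine ⟨ω', universalDeg_one_le f Γ h, ?_, ?_⟩
  · rw [h' i (hi ▸ h1 i), hi]
  · rw [h' j (hj ▸ h1 j), hj]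

end Adapted

namespace DifferentialCalculus

variable {k : Type*} {A : Type*} [Field k] [Ring A] [Algebra k A] (Γ : DifferentialCalculus k A)

/-- One-forms are sums of the `a db`. -/
theorem deg_one_le : Γ.deg 1 ≤ Submodule.span k {ω | ∃ a b : A, ω = Γ.inj a * Γ.d (Γ.inj b)} := by
  intro ω hω
  -- A single calculus is treated as the calculi adapted to the one-member family consisting of the
  -- identity of A.
  obtain ⟨η, h, rfl⟩ := exists_universalDeg (fun _ : Unit => AlgHom.id k A) (fun _ => Γ)
    (fun _ => Function.surjective_id) () hω
  have h' := universalDeg_one_le _ _ h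
  clear hω h
  induction h' using Submodule.span_induction with
  | zero => simp
  | add x y _ _ hx hy => rw [map_add]; exact add_mem hx hy
  | smul c x _ hx => rw [map_smul]; exact Submodule.smul_mem _ _ hx
  | mem x hx =>
    obtain ⟨b, c, rfl⟩ := hx
    exact Submodule.subset_span ⟨b, c, by simp⟩

end DifferentialCalculus

section Contract

variable {k : Type*} {H : Type*} {M : Type*} [Field k] [AddCommGroup H] [Module k H]
  [AddCommGroup M] [Module k M]

/-- Induction on the elements of `N ⊗ H ⊆ M ⊗ H`. -/
theorem contract_induction (N : Submodule k M) {p : M ⊗[k] H → Prop} (zero : p 0)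
    (add : ∀ x y, p x → p y → p (x + y)) (tmul : ∀ m ∈ N, ∀ h : H, p (m ⊗ₜ h)) {z : M ⊗[k] H}
    (hz : ∀ φ : H →ₗ[k] k, contract φ z ∈ N) : p z := by
  obtain ⟨w, rfl⟩ := mem_range_of_contract N hz
  clear hz
  induction w using TensorProduct.induction_on with
  | zero => rw [map_zero]; exact zero
  | add x y hx hy => rw [map_add]; exact add _ _ hx hy
  | tmul m h => exact tmul m m.2 h

end Contract

/-! ### Projections onto homogeneous components -/

namespace DifferentialCalculus

section Proj

variable {k : Type*} {A : Type*} [Field k] [Ring A] [Algebra k A] (Γ : DifferentialCalculus k A)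

theorem mul_mem_deg {m n l : ℕ} (h : m + n = l) {a b : Γ.Form} (ha : a ∈ Γ.deg m)
    (hb : b ∈ Γ.deg n) : a * b ∈ Γ.deg l :=
  h ▸ SetLike.mul_mem_graded ha hb

/-- The projection of forms to their component of degree `n`. -/
def proj (n : ℕ) : Γ.Form →ₗ[k] Γ.Form :=
  (Γ.deg n).subtype ∘ₗ DirectSum.component k ℕ (fun n => Γ.deg n) n ∘ₗ
    (DirectSum.decomposeLinearEquiv Γ.deg).toLinearMap

theorem proj_apply (n : ℕ) (ω : Γ.Form) :
    Γ.proj n ω = (DirectSum.decompose Γ.deg ω n : Γ.deg n) := rfl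

theorem proj_mem (n : ℕ) (ω : Γ.Form) : Γ.proj n ω ∈ Γ.deg n :=
  (DirectSum.decompose Γ.deg ω n).2

theorem proj_of_mem {n : ℕ} {ω : Γ.Form} (h : ω ∈ Γ.deg n) : Γ.proj n ω = ω := by
  rw [proj_apply, DirectSum.decompose_of_mem_same _ h]

theorem proj_of_mem_ne {m n : ℕ} {ω : Γ.Form} (h : ω ∈ Γ.deg m) (hmn : m ≠ n) :
    Γ.proj n ω = 0 := by
  rw [proj_apply, DirectSum.decompose_of_mem_ne _ h hmn]

/-- Provides the part of `leftHor` and `rightHor` that reads off the H-factor of a horizontal form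
and ignores Γ¹(H). -/
theorem exists_leftInverse_inj : ∃ r : Γ.Form →ₗ[k] A,
    (∀ a, r (Γ.inj a) = a) ∧ ∀ ω ∈ Γ.deg 1, r ω = 0 := by
  obtain ⟨g, hg⟩ := Γ.inj.toLinearMap.exists_leftInverse_of_injective
    (LinearMap.ker_eq_bot.2 Γ.inj_injective)
  refine ⟨g ∘ₗ Γ.proj 0, fun a => ?_, fun ω h => ?_⟩
  · rw [LinearMap.comp_apply, Γ.proj_of_mem (Γ.inj_mem a)]
    exact LinearMap.congr_fun hg a
  · rw [LinearMap.comp_apply, Γ.proj_of_mem_ne h one_ne_zero, map_zero]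

end Proj

end DifferentialCalculus

open DifferentialCalculus

/-! ### Horizontal forms of a trivial piece -/

section Piece

open HopfAlgebra Coalgebra

variable {k : Type*} {A : Type*} {H : Type*} [Field k] [Ring A] [Algebra k A] [Ring H]
  [HopfAlgebra k H]
variable (Γ : DifferentialCalculus k A) (Λ : DifferentialCalculus k H)

variable {Γ} in
/-- `γ ⊗ ρ` as an element of `Γ(A) ⊗̂ Γ(H)`, linearly in `ρ`. -/
def pieceTmul (γ : Γ.Form) : Λ.Form →ₗ[k] (Γ.tensor Λ).Form := tmRight Λ γ

theorem pieceTmul_inj (γ : Γ.Form) (h : H) : pieceTmul Λ γ (Λ.inj h) = horEmb Γ Λ (γ ⊗ₜ h) := rfl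

theorem horEmb_tmul_one (γ : Γ.Form) : horEmb Γ Λ (γ ⊗ₜ 1) = pieceIncl Γ Λ γ := by
  rw [horEmb_tmul, map_one]; rfl

theorem piece_inj (y : A ⊗[k] H) :
    (Γ.tensor Λ).inj y = horEmb Γ Λ (Γ.inj.toLinearMap.rTensor H y) := by
  induction y using TensorProduct.induction_on with
  | zero => simp
  | add a b ha hb => rw [map_add, ha, hb, map_add, map_add]
  | tmul a h => exact tensorInj_tmul a h

theorem piece_inj_one_tmul (h : H) : (Γ.tensor Λ).inj (1 ⊗ₜ h) = horEmb Γ Λ (1 ⊗ₜ h) := by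
  rw [piece_inj, LinearMap.rTensor_tmul, AlgHom.toLinearMap_apply, map_one]

theorem piece_inj_tmul_one (a : A) : (Γ.tensor Λ).inj (a ⊗ₜ 1) = pieceIncl Γ Λ (Γ.inj a) := by
  rw [pieceIncl_inj]

theorem piece_d_inj_tmul (a : A) (h : H) : (Γ.tensor Λ).d ((Γ.tensor Λ).inj (a ⊗ₜ h)) =
    horEmb Γ Λ (Γ.d (Γ.inj a) ⊗ₜ h) + pieceTmul Λ (Γ.inj a) (Λ.d (Λ.inj h)) := by
  change tensorD Γ Λ (tensorInj Γ Λ (a ⊗ₜ h)) = _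
  rw [tensorInj_tmul, tensorD_tm (Γ.inj_mem a), pow_zero, one_smul]; rfl

theorem horEmb_tmul_eq_mul (γ : Γ.Form) (h : H) :
    horEmb Γ Λ (γ ⊗ₜ h) = pieceIncl Γ Λ γ * (Γ.tensor Λ).inj (1 ⊗ₜ h) := by
  rw [piece_inj_one_tmul, ← horEmb_tmul_one]
  refine Eq.trans ?_ (horEmb_mul Γ Λ _ _)
  simp

theorem piece_d_pieceIncl (γ : Γ.Form) :
    (Γ.tensor Λ).d (pieceIncl Γ Λ γ) = pieceIncl Γ Λ (Γ.d γ) := by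
  change tensorD Γ Λ (tm γ 1) = tm (Γ.d γ) 1
  induction γ using DirectSum.Decomposition.inductionOn Γ.deg with
  | zero => rw [map_zero, tm_zero_left, map_zero]
  | add a b ha hb => rw [tm_add_left, map_add, ha, hb, map_add, tm_add_left]
  | homogeneous a => rw [tensorD_tm a.2, Λ.d_one, tm_zero_right, smul_zero, add_zero]

theorem pieceIncl_mem {n : ℕ} {γ : Γ.Form} (h : γ ∈ Γ.deg n) :
    pieceIncl Γ Λ γ ∈ (Γ.tensor Λ).deg n :=
  tm_mem_tensorDeg (add_zero n) h SetLike.GradedOne.one_mem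

theorem piece_sign_pieceIncl (γ : Γ.Form) :
    (Γ.tensor Λ).sign (pieceIncl Γ Λ γ) = pieceIncl Γ Λ (Γ.sign γ) := by
  induction γ using DirectSum.Decomposition.inductionOn Γ.deg with
  | zero => simp
  | add a b ha hb => rw [map_add, map_add, ha, hb, map_add, map_add]
  | homogeneous a =>
    rw [(Γ.tensor Λ).sign_of_mem (pieceIncl_mem Γ Λ a.2), Γ.sign_of_mem a.2, map_smul]

theorem horEmb_mem_deg {n : ℕ} {z : Γ.Form ⊗[k] H}
    (hz : ∀ φ : H →ₗ[k] k, contract φ z ∈ Γ.deg n) : horEmb Γ Λ z ∈ (Γ.tensor Λ).deg n := by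
  refine contract_induction (Γ.deg n) (p := fun z => horEmb Γ Λ z ∈ (Γ.tensor Λ).deg n) ?_ ?_ ?_ hz
  · rw [map_zero]; exact zero_mem _
  · intro x y hx hy; rw [map_add]; exact add_mem hx hy
  · intro γ hγ h
    exact tm_mem_tensorDeg (add_zero n) hγ (Λ.inj_mem h)

/-- H sits in degree 0, so the projection to degree n acts on Γ(A) ⊗ H through the first factor
alone; injectivity of `horEmb` then carries the degree back. -/
theorem contract_mem_of_horEmb_mem_deg {n : ℕ} {z : Γ.Form ⊗[k] H}
    (hz : horEmb Γ Λ z ∈ (Γ.tensor Λ).deg n) (φ : H →ₗ[k] k) : contract φ z ∈ Γ.deg n := by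
  have key : ∀ z : Γ.Form ⊗[k] H,
      (Γ.tensor Λ).proj n (horEmb Γ Λ z) = horEmb Γ Λ ((Γ.proj n).rTensor H z) := by
    intro z
    induction z using TensorProduct.induction_on with
    | zero => simp
    | add x y hx hy => rw [map_add, map_add, hx, hy, map_add, map_add]
    | tmul γ h =>
      induction γ using DirectSum.Decomposition.inductionOn Γ.deg with
      | zero => simp
      | add a b ha hb => rw [TensorProduct.add_tmul, map_add, map_add, ha, hb, map_add, map_add]
      | @homogeneous m a =>
        have hm : horEmb Γ Λ ((a : Γ.Form) ⊗ₜ h) ∈ (Γ.tensor Λ).deg m :=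
          tm_mem_tensorDeg (add_zero m) a.2 (Λ.inj_mem h)
        rw [LinearMap.rTensor_tmul]
        by_cases hmn : m = n
        · subst hmn
          rw [proj_of_mem _ hm, proj_of_mem _ a.2]
        · rw [proj_of_mem_ne _ hm hmn, proj_of_mem_ne _ a.2 hmn, TensorProduct.zero_tmul, map_zero]
  have h := key z
  rw [proj_of_mem _ hz] at h
  rw [horEmb_injective Γ Λ h, contract_rTensor]
  exact proj_mem _ _ _

variable {Λ} (cov : RightCovariant Λ)

theorem pieceCoact_pieceTmul (γ : Γ.Form) (θ : Λ.Form) :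
    pieceCoact Γ cov (pieceTmul Λ γ θ) = (pieceTmul Λ γ).rTensor H (cov.coact θ) :=
  tensorCoact_tm cov γ θ

/-- On horizontal forms the coaction touches only the factor H, where contracting it is translation
by φ. -/
theorem contract_pieceCoact_horEmb (φ : H →ₗ[k] k) (z : Γ.Form ⊗[k] H) :
    contract φ (pieceCoact Γ cov (horEmb Γ Λ z)) =
      horEmb Γ Λ ((translate φ).lTensor Γ.Form z) := by
  induction z using TensorProduct.induction_on with
  | zero => simp
  | add x y hx hy => rw [map_add, map_add, map_add, hx, hy, map_add, map_add]
  | tmul γ h =>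
    rw [← pieceTmul_inj, pieceCoact_pieceTmul, contract_rTensor, cov.coact_inj, contract_rTensor]
    rfl

/-- A subspace of `Γ(A) ⊗̂ Γ(H)` which is stable under the coaction and the right multiplication
with elements of `H` meets `Γ(A) ⊗ H` in a subspace of the form `J ⊗ H`. -/
theorem pieceIncl_contract_mem (K : Submodule k (Γ.tensor Λ).Form)
    (hmul : ∀ x ∈ K, ∀ h : H, x * (Γ.tensor Λ).inj (1 ⊗ₜ h) ∈ K)
    (hco : ∀ x ∈ K, ∀ φ : H →ₗ[k] k, contract φ (pieceCoact Γ cov x) ∈ K)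
    {z : Γ.Form ⊗[k] H} (hz : horEmb Γ Λ z ∈ K) (φ : H →ₗ[k] k) :
    pieceIncl Γ Λ (contract φ z) ∈ K := by
  -- In Sweedler notation Q ∘ coaction sends x to Σ x₀(1 ⊗ S(x₁))φ(x₂). It preserves K by the two
  -- stability assumptions, and on γ ⊗ h it gives Σ γ ⊗ h₁S(h₂)φ(h₃) = φ(h)γ ⊗ 1.
  let Q : (Γ.tensor Λ).Form ⊗[k] H →ₗ[k] (Γ.tensor Λ).Form :=
    LinearMap.mul' k (Γ.tensor Λ).Form ∘ₗ TensorProduct.map LinearMap.id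
      ((Γ.tensor Λ).inj.toLinearMap ∘ₗ TensorProduct.mk k A H 1 ∘ₗ antipode k ∘ₗ translate φ)
  have hQ : ∀ x ∈ K, Q (pieceCoact Γ cov x) ∈ K := by
    intro x hx
    refine contract_induction K (p := fun z => Q z ∈ K) ?_ ?_ ?_ (hco x hx)
    · rw [map_zero]; exact zero_mem _
    · intro x y hx hy; rw [map_add]; exact add_mem hx hy
    · intro m hm h
      exact hmul m hm _
  have key : ∀ z, Q (pieceCoact Γ cov (horEmb Γ Λ z)) = pieceIncl Γ Λ (contract φ z) := by
    intro z
    induction z using TensorProduct.induction_on with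
    | zero => simp
    | add x y hx hy => rw [map_add, map_add, map_add, hx, hy, map_add, map_add]
    | tmul γ h =>
      have h0 : pieceCoact Γ cov (horEmb Γ Λ (γ ⊗ₜ h)) =
          (pieceTmul Λ γ ∘ₗ Λ.inj.toLinearMap).rTensor H (comul (R := k) h) := by
        rw [← pieceTmul_inj, LinearMap.rTensor_comp, LinearMap.comp_apply, ← cov.coact_inj,
          pieceCoact_pieceTmul]
      have h1 : ∀ w : H ⊗[k] H, Q ((pieceTmul Λ γ ∘ₗ Λ.inj.toLinearMap).rTensor H w) =
          horEmb Γ Λ (γ ⊗ₜ (LinearMap.mul' k H ∘ₗ TensorProduct.map LinearMap.id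
            (antipode k ∘ₗ translate φ ∘ₗ LinearMap.mulLeft k 1)) w) := by
        intro w
        induction w using TensorProduct.induction_on with
        | zero => simp
        | add x y hx hy =>
          rw [map_add, map_add, hx, hy, map_add, TensorProduct.tmul_add, map_add]
        | tmul x y =>
          change horEmb Γ Λ (γ ⊗ₜ x) * (Γ.tensor Λ).inj (1 ⊗ₜ antipode k (translate φ y)) =
            horEmb Γ Λ (γ ⊗ₜ (x * antipode k (translate φ (1 * y))))
          rw [piece_inj_one_tmul]
          refine (horEmb_mul Γ Λ _ _).symm.trans ?_
          simp
      rw [h0, h1, mul_antipode_translate, translate_one, contract_tmul, map_smul, antipode_one,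
        TensorProduct.tmul_smul, map_smul, horEmb_tmul_one, map_smul]
      simp
  rw [← key]
  exact hQ _ hz

end Piece

/-! ### Gluing local operators over the overlaps -/

section

open DifferentialCalculus HopfAlgebra Coalgebra

section Bundle

variable {k : Type*} {H : Type*} {P : Type*} {B : Type*} {I : Type*} [Field k]
    [Ring H] [HopfAlgebra k H] [Ring P] [Algebra k P] [Ring B] [Algebra k B]
    {J : I → Ideal B} [∀ i, (J i).IsTwoSided]

variable (X : PrincipalBundle k H P J) (D : DifferentialStructure k H J)

/-- The image of `ker χⱼ` under the extension `Ω(P) → Γ(Bᵢ) ⊗̂ Γ(H)` of `χᵢ`: two forms over the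
pieces `i` and `j` are glued modulo such subspaces. -/
def overlap (i j : I) : Submodule k (D.piece i).Form :=
  (LinearMap.ker (extUniversal X.χ D.piece j).toLinearMap).map
    (extUniversal X.χ D.piece i).toLinearMap

variable {X D}

theorem mem_overlap {i j : I} {x : (D.piece i).Form} : x ∈ overlap X D i j ↔
    ∃ ω, extUniversal X.χ D.piece j ω = 0 ∧ extUniversal X.χ D.piece i ω = x := Iff.rfl

/-- Surjectivity of χᵢ on forms lets any factor y be lifted to Ω(P), where the kernel over j is an
ideal; with the left version, `overlap` is a two-sided ideal. -/
theorem overlap_mul_right {i j : I} {x : (D.piece i).Form} (hx : x ∈ overlap X D i j)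
    (y : (D.piece i).Form) : x * y ∈ overlap X D i j := by
  obtain ⟨ω, h1, rfl⟩ := mem_overlap.1 hx
  obtain ⟨η, rfl⟩ := extUniversal_surjective X.χ D.piece X.χ_surjective i y
  exact mem_overlap.2 ⟨ω * η, by rw [map_mul, h1, zero_mul], map_mul _ _ _⟩

theorem overlap_mul_left {i j : I} {x : (D.piece i).Form} (hx : x ∈ overlap X D i j)
    (y : (D.piece i).Form) : y * x ∈ overlap X D i j := by
  obtain ⟨ω, h1, rfl⟩ := mem_overlap.1 hx
  obtain ⟨η, rfl⟩ := extUniversal_surjective X.χ D.piece X.χ_surjective i y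
  exact mem_overlap.2 ⟨η * ω, by rw [map_mul, h1, mul_zero], map_mul _ _ _⟩

theorem overlap_d {i j : I} {x : (D.piece i).Form} (hx : x ∈ overlap X D i j) :
    (D.piece i).d x ∈ overlap X D i j := by
  obtain ⟨ω, h1, rfl⟩ := mem_overlap.1 hx
  obtain ⟨ω', h⟩ := exists_extUniversal_d X.χ D.piece ω
  exact mem_overlap.2 ⟨ω', by rw [h, h1, map_zero], h i⟩

theorem overlap_sign {i j : I} {x : (D.piece i).Form} (hx : x ∈ overlap X D i j) :
    (D.piece i).sign x ∈ overlap X D i j := by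
  obtain ⟨ω, h1, rfl⟩ := mem_overlap.1 hx
  obtain ⟨ω', h⟩ := exists_extUniversal_sign X.χ D.piece ω
  exact mem_overlap.2 ⟨ω', by rw [h, h1, map_zero], h i⟩

/-- The coaction lifts to Ω(P) compatibly with every χᵢ, so it preserves the kernel over j and hence
its image over i. -/
theorem overlap_contract {i j : I} {x : (D.piece i).Form} (hx : x ∈ overlap X D i j)
    (φ : H →ₗ[k] k) : contract φ (pieceCoact (D.base i) D.cov x) ∈ overlap X D i j := by
  obtain ⟨ω, h1, rfl⟩ := mem_overlap.1 hx
  refine mem_overlap.2 ⟨contract φ (universalCoact X ω), ?_, ?_⟩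
  · have := extUniversal_coact X D j ω
    rw [h1, map_zero] at this
    refine (contract_rTensor φ (extUniversal X.χ D.piece j).toLinearMap _).symm.trans ?_
    rw [this, map_zero]
  · rw [← extUniversal_coact, contract_rTensor]; rfl

theorem mem_overlap_of_mem_totalForms {γ : Families D} (hγ : γ ∈ totalForms X D) {i j : I}
    (h : γ j = 0) : γ i ∈ overlap X D i j := by
  obtain ⟨ω, h1, h2⟩ := (mem_localForms _ _).1 hγ i j
  exact mem_overlap.2 ⟨ω, h2.trans h, h1⟩

theorem pieceIncl_contract_mem_overlap {i j : I} {z : (D.base i).Form ⊗[k] H}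
    (hz : horEmb (D.base i) D.fibre z ∈ overlap X D i j) (φ : H →ₗ[k] k) :
    pieceIncl (D.base i) D.fibre (contract φ z) ∈ overlap X D i j :=
  pieceIncl_contract_mem (D.base i) D.cov (overlap X D i j)
    (fun _ hx _ => overlap_mul_right hx _) (fun _ hx φ => overlap_contract hx φ) hz φ

theorem horProj_eq_iff {i : I} {α : horForms X D} {z : (D.base i).Form ⊗[k] H} :
    horProj X D i α = z ↔ (α : Families D) i = horEmb (D.base i) D.fibre z := by
  rw [← horEmb_horProj, (horEmb_injective (D.base i) D.fibre).eq_iff]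

variable (X D) in
/-- A family of operators on the `Γ(Bᵢ) ⊗ H` applied to the components of horizontal forms. -/
def applyLocal (T : ∀ i, (D.base i).Form ⊗[k] H →ₗ[k] (D.base i).Form ⊗[k] H) :
    horForms X D →ₗ[k] Families D :=
  LinearMap.pi fun i => horEmb (D.base i) D.fibre ∘ₗ T i ∘ₗ horProj X D i

theorem applyLocal_apply (T : ∀ i, (D.base i).Form ⊗[k] H →ₗ[k] (D.base i).Form ⊗[k] H)
    (α : horForms X D) (i : I) :
    applyLocal X D T α i = horEmb (D.base i) D.fibre (T i (horProj X D i α)) := rfl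

/-- Over i, replace α by a horizontal form β with the same i-component whose image is known to glue
(`hlift`). The difference α - β vanishes over i, so its j-component lies in `overlap`; by
`pieceIncl_contract_mem_overlap` it is a sum of γ ⊗ h with γ in that ideal, which is why `hK` need
only be known for such tensors. -/
theorem applyLocal_mem (T : ∀ i, (D.base i).Form ⊗[k] H →ₗ[k] (D.base i).Form ⊗[k] H)
    (hK : ∀ i j (γ : (D.base i).Form) (h : H), pieceIncl (D.base i) D.fibre γ ∈ overlap X D i j →
      horEmb (D.base i) D.fibre (T i (γ ⊗ₜ h)) ∈ overlap X D i j)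
    (hlift : ∀ i (γ : (D.base i).Form) (h : H), ∃ α : horForms X D,
      horProj X D i α = γ ⊗ₜ h ∧ applyLocal X D T α ∈ totalForms X D)
    (α : horForms X D) : applyLocal X D T α ∈ totalForms X D := by
  have hK' : ∀ i j (z : (D.base i).Form ⊗[k] H), horEmb (D.base i) D.fibre z ∈ overlap X D i j →
      horEmb (D.base i) D.fibre (T i z) ∈ overlap X D i j := by
    intro i j z hz
    refine contract_induction ((overlap X D i j).comap (pieceIncl (D.base i) D.fibre).toLinearMap)
      (p := fun z => horEmb (D.base i) D.fibre (T i z) ∈ overlap X D i j) ?_ ?_ ?_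
      (pieceIncl_contract_mem_overlap hz)
    · rw [map_zero, map_zero]; exact zero_mem _
    · intro x y hx hy; rw [map_add, map_add]; exact add_mem hx hy
    · intro γ hγ h; exact hK i j γ h hγ
  have hlift' : ∀ i (z : (D.base i).Form ⊗[k] H), ∃ α : horForms X D,
      horProj X D i α = z ∧ applyLocal X D T α ∈ totalForms X D := by
    intro i z
    induction z using TensorProduct.induction_on with
    | zero => exact ⟨0, map_zero _, by rw [map_zero]; exact zero_mem _⟩
    | add x y hx hy =>
      obtain ⟨α, h1, h2⟩ := hx
      obtain ⟨β, h3, h4⟩ := hy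
      exact ⟨α + β, by rw [map_add, h1, h3], by rw [map_add]; exact add_mem h2 h4⟩
    | tmul γ h => exact hlift i γ h
  refine (mem_localForms _ _).2 fun i j => ?_
  obtain ⟨β, h1, h2⟩ := hlift' i (horProj X D i α)
  obtain ⟨ω, h3, h4⟩ := (mem_localForms _ _).1 h2 i j
  have h5 : ((α - β : horForms X D) : Families D) i = 0 := by
    rw [← horProj_eq_zero, map_sub, h1, sub_self]
  have h6 := mem_overlap_of_mem_totalForms ((mem_horForms X D).1 (α - β).2).1 (i := j) h5
  rw [← horEmb_horProj] at h6
  -- η vanishes over i and represents Tⱼ of the j-component of α - β over j, so ω + η is a common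
  -- lift of both components.
  obtain ⟨η, h7, h8⟩ := mem_overlap.1 (hK' j i _ h6)
  refine ⟨ω + η, ?_, ?_⟩
  · rw [map_add, h7, h3, add_zero, applyLocal_apply, applyLocal_apply, h1]
  · rw [map_add, h8, h4, applyLocal_apply, applyLocal_apply, ← map_add, ← map_add, ← map_add,
      add_sub_cancel]

variable [Fintype I] [DecidableEq I]

variable (X D) in
/-- The right translation of horizontal forms by a functional on `H`. -/
def horTranslate (φ : H →ₗ[k] k) : horForms X D →ₗ[k] horForms X D :=
  contract φ ∘ₗ horCoact X D

theorem coe_horTranslate (φ : H →ₗ[k] k) (α : horForms X D) :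
    (horTranslate X D φ α : Families D) = contract φ (familyCoact D α) :=
  coe_contract_restrictCoaction (familyCoact D) (Subalgebra.toSubmodule (horForms X D)) _ φ α

theorem horProj_horTranslate (φ : H →ₗ[k] k) (α : horForms X D) (i : I) :
    horProj X D i (horTranslate X D φ α) =
      (translate φ).lTensor (D.base i).Form (horProj X D i α) := by
  rw [horProj_eq_iff, coe_horTranslate, contract_familyCoact, ← contract_pieceCoact_horEmb,
    horEmb_horProj]

/-- Covariance is commutation with all translations; this form passes directly to the local
operators. -/
theorem covariant_iff (T : horForms X D →ₗ[k] horForms X D) :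
    (∀ α, T.rTensor H (horCoact X D α) = horCoact X D (T α)) ↔
      ∀ φ α, T (horTranslate X D φ α) = horTranslate X D φ (T α) := by
  constructor
  · intro h φ α
    rw [horTranslate, LinearMap.comp_apply, LinearMap.comp_apply, ← h, contract_rTensor]
  · intro h α
    refine eq_of_contract fun φ => ?_
    rw [contract_rTensor]
    exact h φ α

omit [Fintype I] [DecidableEq I] in
theorem horProj_one (i : I) : horProj X D i 1 = 1 := by
  rw [horProj_eq_iff, Algebra.TensorProduct.one_def, horEmb_tmul_one]
  exact (map_one (pieceIncl (D.base i) D.fibre)).symm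

/-- The operator on horizontal forms given by a family of local operators. -/
def horLocal (T : ∀ i, (D.base i).Form ⊗[k] H →ₗ[k] (D.base i).Form ⊗[k] H)
    (hT : ∀ α : horForms X D, applyLocal X D T α ∈ totalForms X D) :
    horForms X D →ₗ[k] horForms X D :=
  (applyLocal X D T).codRestrict (Subalgebra.toSubmodule (horForms X D))
    fun α => (mem_horForms X D).2 ⟨hT α, fun _ => ⟨_, rfl⟩⟩

omit [Fintype I] [DecidableEq I] in
theorem horProj_horLocal (T : ∀ i, (D.base i).Form ⊗[k] H →ₗ[k] (D.base i).Form ⊗[k] H)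
    (hT : ∀ α : horForms X D, applyLocal X D T α ∈ totalForms X D) (α : horForms X D) (i : I) :
    horProj X D i (horLocal T hT α) = T i (horProj X D i α) :=
  horProj_eq_iff.2 rfl

/-- A covariant derivative from its local operators, without the Leibniz rule. -/
def PreCovariantDerivative.ofLocal
    (T : ∀ i, (D.base i).Form ⊗[k] H →ₗ[k] (D.base i).Form ⊗[k] H)
    (hT : ∀ α : horForms X D, applyLocal X D T α ∈ totalForms X D)
    (hdeg : ∀ i (n : ℕ) (γ : (D.base i).Form) (h : H) (φ : H →ₗ[k] k), γ ∈ (D.base i).deg n →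
      contract φ (T i (γ ⊗ₜ h)) ∈ (D.base i).deg (n + 1))
    (hone : ∀ i, T i 1 = 0)
    (hcov : ∀ i (φ : H →ₗ[k] k) (γ : (D.base i).Form) (h : H),
      T i (γ ⊗ₜ translate φ h) = (translate φ).lTensor _ (T i (γ ⊗ₜ h))) :
    PreCovariantDerivative X D where
  toLinearMap := horLocal T hT
  degree n α hα := by
    rw [mem_localDeg] at hα ⊢
    intro i
    refine horEmb_mem_deg (D.base i) D.fibre ?_
    have h := hα i
    rw [← horEmb_horProj] at h
    intro φ
    refine contract_induction ((D.base i).deg n)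
      (p := fun z => contract φ (T i z) ∈ (D.base i).deg (n + 1)) ?_ ?_ ?_
      (contract_mem_of_horEmb_mem_deg (D.base i) D.fibre h)
    · simp
    · intro x y hx hy; rw [map_add, map_add]; exact add_mem hx hy
    · intro γ hγ h; exact hdeg i n γ h φ hγ
  map_one := by
    refine Subtype.ext (funext fun i => ?_)
    rw [← horEmb_horProj, horProj_horLocal, horProj_one, hone, map_zero]; rfl
  covariant := (covariant_iff _).2 fun φ α => by
    refine Subtype.ext (funext fun i => ?_)
    rw [← horEmb_horProj, ← horEmb_horProj, horProj_horLocal, horProj_horTranslate,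
      horProj_horTranslate, horProj_horLocal]
    congr 1
    generalize horProj X D i α = z
    induction z using TensorProduct.induction_on with
    | zero => simp
    | add x y hx hy => simp only [map_add, hx, hy]
    | tmul γ h => rw [LinearMap.lTensor_tmul, hcov]
  isLocal i α hα := by
    rw [← horEmb_horProj, horProj_horLocal, (horProj_eq_zero X D).2 hα, map_zero, map_zero]

theorem PreCovariantDerivative.ext_of_localMap {T T' : PreCovariantDerivative X D}
    (h : ∀ i (γ : (D.base i).Form) (h : H), T.localMap i (γ ⊗ₜ h) = T'.localMap i (γ ⊗ₜ h)) :
    T.toLinearMap = T'.toLinearMap := by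
  refine LinearMap.ext fun α => Subtype.ext (funext fun i => ?_)
  rw [← horEmb_horProj, ← horEmb_horProj, ← T.localMap_horProj, ← T'.localMap_horProj,
    TensorProduct.ext' (g := T.localMap i) (h := T'.localMap i) (h i)]

theorem PreCovariantDerivative.localMap_eq (T : PreCovariantDerivative X D) {i : I}
    {S : (D.base i).Form ⊗[k] H →ₗ[k] (D.base i).Form ⊗[k] H}
    (h : ∀ α, horProj X D i (T.toLinearMap α) = S (horProj X D i α)) : T.localMap i = S := by
  refine LinearMap.ext fun z => ?_
  obtain ⟨α, rfl⟩ := horProj_surjective X D i z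
  rw [PreCovariantDerivative.localMap_horProj, h]

end Bundle

end

/-! ### Local operators of covariant derivatives -/

section

open DifferentialCalculus HopfAlgebra Coalgebra

section LocalOperators

variable {k : Type*} {A : Type*} {H : Type*} [Field k] [Ring A] [Algebra k A] [Ring H]
  [HopfAlgebra k H]
variable (Γ : DifferentialCalculus k A) (Λ : DifferentialCalculus k H)
variable (a : H →ₗ[k] Γ.Form ⊗[k] H)

/-- The local operator `γ ⊗ h ↦ dγ ⊗ h + (-1)ⁿ (γ ⊗ 1) a(h)` of a left covariant derivative. -/
def leftOp : Γ.Form ⊗[k] H →ₗ[k] Γ.Form ⊗[k] H :=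
  Γ.d.rTensor H + LinearMap.mul' k (Γ.Form ⊗[k] H) ∘ₗ
    TensorProduct.map ((TensorProduct.mk k Γ.Form H).flip 1 ∘ₗ Γ.sign) a

/-- The local operator `γ ⊗ h ↦ dγ ⊗ h + a(h) (γ ⊗ 1)` of a right covariant derivative. -/
def rightOp : Γ.Form ⊗[k] H →ₗ[k] Γ.Form ⊗[k] H :=
  Γ.d.rTensor H + LinearMap.mul' k (Γ.Form ⊗[k] H) ∘ₗ
    TensorProduct.map a ((TensorProduct.mk k Γ.Form H).flip 1) ∘ₗ
      (TensorProduct.comm k Γ.Form H).toLinearMap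

@[simp] theorem leftOp_tmul (γ : Γ.Form) (h : H) :
    leftOp Γ a (γ ⊗ₜ h) = Γ.d γ ⊗ₜ h + (Γ.sign γ ⊗ₜ 1) * a h := rfl

@[simp] theorem rightOp_tmul (γ : Γ.Form) (h : H) :
    rightOp Γ a (γ ⊗ₜ h) = Γ.d γ ⊗ₜ h + a h * (γ ⊗ₜ 1) := rfl

theorem leftOp_mul (γ : Γ.Form) (z : Γ.Form ⊗[k] H) :
    leftOp Γ a ((γ ⊗ₜ 1) * z) = (Γ.d γ ⊗ₜ 1) * z + (Γ.sign γ ⊗ₜ 1) * leftOp Γ a z := by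
  induction z using TensorProduct.induction_on with
  | zero => simp
  | add x y hx hy => simp only [mul_add, map_add, hx, hy]; abel
  | tmul γ' h =>
    rw [Algebra.TensorProduct.tmul_mul_tmul, leftOp_tmul, leftOp_tmul, Γ.d_mul, Γ.sign_mul,
      one_mul, mul_add, ← mul_assoc, Algebra.TensorProduct.tmul_mul_tmul,
      Algebra.TensorProduct.tmul_mul_tmul, Algebra.TensorProduct.tmul_mul_tmul,
      TensorProduct.add_tmul, one_mul, one_mul, add_assoc]

/-- The factor γ stands on the right, so the sign of the Leibniz rule falls on z; on generators 1 ⊗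
h it is invisible, which is why `rightOp` itself contains no sign. -/
theorem rightOp_mul (γ : Γ.Form) (z : Γ.Form ⊗[k] H) :
    rightOp Γ a (z * (γ ⊗ₜ 1)) =
      rightOp Γ a z * (γ ⊗ₜ 1) + Γ.sign.rTensor H z * (Γ.d γ ⊗ₜ 1) := by
  induction z using TensorProduct.induction_on with
  | zero => simp
  | add x y hx hy => simp only [add_mul, map_add, hx, hy]; abel
  | tmul γ' h =>
    rw [Algebra.TensorProduct.tmul_mul_tmul, rightOp_tmul, rightOp_tmul, Γ.d_mul,
      mul_one, add_mul, mul_assoc (a h), LinearMap.rTensor_tmul,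
      Algebra.TensorProduct.tmul_mul_tmul, Algebra.TensorProduct.tmul_mul_tmul,
      Algebra.TensorProduct.tmul_mul_tmul, TensorProduct.add_tmul, mul_one, mul_one]
    abel

theorem leftOp_one_tmul (h : H) : leftOp Γ a (1 ⊗ₜ h) = a h := by
  rw [leftOp_tmul, Γ.d_one, ← map_one Γ.inj, Γ.sign_inj, map_one, TensorProduct.zero_tmul, zero_add,
    ← Algebra.TensorProduct.one_def, one_mul]

theorem rightOp_one_tmul (h : H) : rightOp Γ a (1 ⊗ₜ h) = a h := by
  rw [rightOp_tmul, Γ.d_one, TensorProduct.zero_tmul, zero_add, ← Algebra.TensorProduct.one_def,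
    mul_one]

theorem sign_rTensor_of_contract_mem {n : ℕ} {z : Γ.Form ⊗[k] H}
    (hz : ∀ φ : H →ₗ[k] k, contract φ z ∈ Γ.deg n) :
    Γ.sign.rTensor H z = (-1 : k) ^ n • z := by
  refine contract_induction (Γ.deg n) (p := fun z => Γ.sign.rTensor H z = (-1 : k) ^ n • z)
    ?_ ?_ ?_ hz
  · simp
  · intro x y hx hy; rw [map_add, hx, hy, smul_add]
  · intro γ hγ h
    rw [LinearMap.rTensor_tmul, Γ.sign_of_mem hγ, TensorProduct.smul_tmul']

variable {a}

theorem contract_leftOp_mem (ha : ∀ h φ, contract φ (a h) ∈ Γ.deg 1) {n : ℕ} {γ : Γ.Form}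
    (hγ : γ ∈ Γ.deg n) (h : H) (φ : H →ₗ[k] k) :
    contract φ (leftOp Γ a (γ ⊗ₜ h)) ∈ Γ.deg (n + 1) := by
  rw [leftOp_tmul, map_add, contract_tmul, contract_tmul_one_mul, Γ.sign_of_mem hγ, smul_mul_assoc]
  exact add_mem (Submodule.smul_mem _ _ (Γ.d_mem _ _ hγ))
    (Submodule.smul_mem _ _ (SetLike.mul_mem_graded hγ (ha h φ)))

theorem contract_rightOp_mem (ha : ∀ h φ, contract φ (a h) ∈ Γ.deg 1) {n : ℕ} {γ : Γ.Form}
    (hγ : γ ∈ Γ.deg n) (h : H) (φ : H →ₗ[k] k) :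
    contract φ (rightOp Γ a (γ ⊗ₜ h)) ∈ Γ.deg (n + 1) := by
  rw [rightOp_tmul, map_add, contract_tmul, contract_mul_tmul_one, add_comm n]
  refine add_mem (Submodule.smul_mem _ _ ?_) (SetLike.mul_mem_graded (ha h φ) hγ)
  rw [add_comm]
  exact Γ.d_mem _ _ hγ

theorem tmul_one_mul_lTensor (f : H →ₗ[k] H) (γ : Γ.Form) (z : Γ.Form ⊗[k] H) :
    f.lTensor Γ.Form ((γ ⊗ₜ 1) * z) = (γ ⊗ₜ 1) * f.lTensor Γ.Form z := by
  induction z using TensorProduct.induction_on with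
  | zero => simp
  | add x y hx hy => simp only [mul_add, map_add, hx, hy]
  | tmul γ' h => simp

theorem lTensor_mul_tmul_one (f : H →ₗ[k] H) (γ : Γ.Form) (z : Γ.Form ⊗[k] H) :
    f.lTensor Γ.Form (z * (γ ⊗ₜ 1)) = f.lTensor Γ.Form z * (γ ⊗ₜ 1) := by
  induction z using TensorProduct.induction_on with
  | zero => simp
  | add x y hx hy => simp only [add_mul, map_add, hx, hy]
  | tmul γ' h => simp

theorem leftOp_translate
    (ha : ∀ (φ : H →ₗ[k] k) (h : H), a (translate φ h) = (translate φ).lTensor Γ.Form (a h))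
    (φ : H →ₗ[k] k) (γ : Γ.Form) (h : H) :
    leftOp Γ a (γ ⊗ₜ translate φ h) = (translate φ).lTensor Γ.Form (leftOp Γ a (γ ⊗ₜ h)) := by
  rw [leftOp_tmul, leftOp_tmul, map_add, ha, tmul_one_mul_lTensor, LinearMap.lTensor_tmul]

theorem rightOp_translate
    (ha : ∀ (φ : H →ₗ[k] k) (h : H), a (translate φ h) = (translate φ).lTensor Γ.Form (a h))
    (φ : H →ₗ[k] k) (γ : Γ.Form) (h : H) :
    rightOp Γ a (γ ⊗ₜ translate φ h) = (translate φ).lTensor Γ.Form (rightOp Γ a (γ ⊗ₜ h)) := by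
  rw [rightOp_tmul, rightOp_tmul, map_add, ha, lTensor_mul_tmul_one, LinearMap.lTensor_tmul]

theorem pieceTmul_inj_mul (h : H) (θ : Λ.Form) :
    (Γ.tensor Λ).inj (1 ⊗ₜ h) * pieceTmul Λ (1 : Γ.Form) θ =
      pieceTmul Λ (1 : Γ.Form) (Λ.inj h * θ) := by
  rw [piece_inj_one_tmul, ← pieceTmul_inj]
  refine (tm_mul_tm_zero (1 : Γ.Form) (Λ.inj_mem h) SetLike.GradedOne.one_mem θ).trans ?_
  rw [one_mul]; rfl

theorem pieceTmul_mul_inj {n : ℕ} (h : H) {θ : Λ.Form} (hθ : θ ∈ Λ.deg n) :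
    pieceTmul Λ (1 : Γ.Form) θ * (Γ.tensor Λ).inj (1 ⊗ₜ h) =
      pieceTmul Λ (1 : Γ.Form) (θ * Λ.inj h) := by
  rw [piece_inj_one_tmul, ← pieceTmul_inj]
  refine (tm_mul_tm_zero (1 : Γ.Form) hθ SetLike.GradedOne.one_mem (Λ.inj h)).trans ?_
  rw [one_mul]; rfl

theorem piece_d_inj_one_tmul (h : H) : (Γ.tensor Λ).d ((Γ.tensor Λ).inj (1 ⊗ₜ h)) =
    pieceTmul Λ (1 : Γ.Form) (Λ.d (Λ.inj h)) := by
  rw [piece_d_inj_tmul, map_one, Γ.d_one, TensorProduct.zero_tmul, map_zero, zero_add]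

end LocalOperators

/-! ### From left connections to left covariant derivatives -/

section Bundle

variable {k : Type*} {H : Type*} {P : Type*} {B : Type*} {I : Type*} [Field k]
    [Ring H] [HopfAlgebra k H] [Ring P] [Algebra k P] [Ring B] [Algebra k B]
    {J : I → Ideal B} [∀ i, (J i).IsTwoSided]

variable {X : PrincipalBundle k H P J} {D : DifferentialStructure k H J}

theorem horProj_mul (α β : horForms X D) (i : I) :
    horProj X D i (α * β) = horProj X D i α * horProj X D i β := by
  rw [horProj_eq_iff, horEmb_mul, horEmb_horProj, horEmb_horProj]; rfl

theorem horProj_totalIncl (p : P) (i : I) : horProj X D i (totalIncl X D p) =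
    (D.base i).inj.toLinearMap.rTensor H (X.χ i p) := by
  rw [horProj_eq_iff, ← piece_inj]; rfl

theorem horProj_baseIncl (γ : baseForms D) (i : I) :
    horProj X D i (baseIncl X D γ) = (γ : ∀ i, (D.base i).Form) i ⊗ₜ 1 := by
  rw [horProj_eq_iff, horEmb_tmul_one]; rfl

variable (D) in
/-- The element of `Γ_c(B)` defined by a universal form. -/
def baseOf (ω : UniversalForms k B) : baseForms D := ⟨_, extUniversal_mem _ _ ω⟩

theorem baseOf_apply (ω : UniversalForms k B) (i : I) :
    (baseOf D ω : ∀ i, (D.base i).Form) i =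
      extUniversal (fun i => Ideal.Quotient.mkₐ k (J i)) D.base i ω := rfl

variable (D) in
theorem exists_baseOf (i : I) (γ : (D.base i).Form) :
    ∃ ω, (baseOf D ω : ∀ i, (D.base i).Form) i = γ :=
  extUniversal_surjective _ _ (fun i => Ideal.Quotient.mkₐ_surjective k (J i)) i γ

variable (X D) in
/-- The inclusion `hor Γ¹_c(P) → hor Γ_c(P)`. -/
def horOneIncl : horOneForms X D →ₗ[k] horForms X D :=
  Submodule.inclusion (horOneForms_le_hor X D)

theorem mem_totalForms (α : horForms X D) : (α : Families D) ∈ totalForms X D :=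
  ((mem_horForms X D).1 α.2).1

theorem contract_horProj_mem {n : ℕ} {α : horForms X D}
    (hα : (α : Families D) ∈ localDeg D.piece n) (i : I) (φ : H →ₗ[k] k) :
    contract φ (horProj X D i α) ∈ (D.base i).deg n := by
  refine contract_mem_of_horEmb_mem_deg (D.base i) D.fibre ?_ φ
  rw [horEmb_horProj]
  exact (mem_localDeg _).1 hα i

variable [Fintype I] [DecidableEq I]

variable (X D) in
/-- The right translation of one-forms by a functional on `H`. -/
def oneTranslate (φ : H →ₗ[k] k) : oneForms X D →ₗ[k] oneForms X D :=
  contract φ ∘ₗ oneCoact X D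

theorem coe_oneTranslate (φ : H →ₗ[k] k) (α : oneForms X D) :
    (oneTranslate X D φ α : Families D) = contract φ (familyCoact D α) :=
  coe_contract_restrictCoaction (familyCoact D) (oneForms X D) _ φ α

variable (X D) in
/-- The right translation of horizontal one-forms by a functional on `H`. -/
def horOneTranslate (φ : H →ₗ[k] k) :
    horOneForms X D →ₗ[k] horOneForms X D :=
  contract φ ∘ₗ horOneCoact X D

theorem coe_horOneTranslate (φ : H →ₗ[k] k) (α : horOneForms X D) :
    (horOneTranslate X D φ α : Families D) = contract φ (familyCoact D α) :=
  coe_contract_restrictCoaction (familyCoact D) (horOneForms X D) _ φ α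

theorem covariant_one_iff (T : oneForms X D →ₗ[k] horOneForms X D) :
    (∀ α, T.rTensor H (oneCoact X D α) = horOneCoact X D (T α)) ↔
      ∀ φ α, T (oneTranslate X D φ α) = horOneTranslate X D φ (T α) := by
  constructor
  · intro h φ α
    rw [horOneTranslate, oneTranslate, LinearMap.comp_apply, LinearMap.comp_apply, ← h,
      contract_rTensor]
  · intro h α
    refine eq_of_contract fun φ => ?_
    rw [contract_rTensor]
    exact h φ α

omit [Fintype I] [DecidableEq I] in
theorem χ_contract_coact (φ : H →ₗ[k] k) (p : P) (i : I) :
    X.χ i (contract φ (X.coact p)) = (translate φ).lTensor (B ⧸ J i) (X.χ i p) := by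
  have h := X.χ_coact i p
  have e : ∀ z : ((B ⧸ J i) ⊗[k] H) ⊗[k] H, contract φ z =
      (contract φ).lTensor (B ⧸ J i) (TensorProduct.assoc k (B ⧸ J i) H H z) := by
    intro z
    induction z using TensorProduct.induction_on with
    | zero => simp
    | add x y hx hy => simp only [map_add, hx, hy]
    | tmul u h =>
      induction u using TensorProduct.induction_on with
      | zero => simp
      | add x y hx hy => simp only [map_add, TensorProduct.add_tmul, hx, hy]
      | tmul b g => simp
  refine (contract_rTensor φ (X.χ i).toLinearMap (X.coact p)).symm.trans ?_
  rw [e, h, translate, LinearMap.lTensor_comp]; rfl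

namespace PreConnection

variable (c : PreConnection X D)

/-- Surjectivity and idempotence together make hor the identity on horizontal one-forms. -/
theorem apply_horizontal (γ : horOneForms X D) :
    c.toLinearMap (Submodule.inclusion (horOneForms_le X D) γ) = γ := by
  obtain ⟨η, rfl⟩ := c.surjective γ
  exact c.idem η

/-- The map `hor ∘ d : P → hor Γ_c(P)`. -/
def horD : P →ₗ[k] horForms X D := horOneIncl X D ∘ₗ c.toLinearMap ∘ₗ totalD X D

/-- If χᵢ(p) = 0 then dp vanishes over i, and locality of hor makes hor(dp) vanish there too; so hor
∘ d factors through χᵢ. -/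
theorem exists_localHorD (i : I) : ∃ δ : (B ⧸ J i) ⊗[k] H →ₗ[k] (D.base i).Form ⊗[k] H,
    ∀ p, δ (X.χ i p) = horProj X D i (c.horD p) := by
  refine exists_comp_eq_of_ker_le (X.χ i).toLinearMap (horProj X D i ∘ₗ c.horD) fun p hp => ?_
  rw [LinearMap.mem_ker, LinearMap.comp_apply, horProj_eq_zero]
  refine c.isLocal i _ ?_
  change (D.piece i).d ((D.piece i).inj (X.χ i p)) = 0
  rw [LinearMap.mem_ker, AlgHom.toLinearMap_apply] at hp
  rw [hp, map_zero, map_zero]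

/-- The map `Bᵢ ⊗ H → Γ(Bᵢ) ⊗ H` induced by `hor ∘ d`. -/
def localHorD (i : I) : (B ⧸ J i) ⊗[k] H →ₗ[k] (D.base i).Form ⊗[k] H :=
  Classical.choose (c.exists_localHorD i)

theorem localHorD_χ (i : I) (p : P) : c.localHorD i (X.χ i p) = horProj X D i (c.horD p) :=
  Classical.choose_spec (c.exists_localHorD i) p

/-- The map `h ↦ hor(1 ⊗ dh)` over the piece `i`. -/
def potential (i : I) : H →ₗ[k] (D.base i).Form ⊗[k] H :=
  c.localHorD i ∘ₗ TensorProduct.mk k (B ⧸ J i) H 1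

theorem potential_apply (i : I) (h : H) : c.potential i h = c.localHorD i (1 ⊗ₜ h) := rfl

theorem potential_one (i : I) : c.potential i 1 = 0 := by
  rw [potential_apply, ← Algebra.TensorProduct.one_def, ← map_one (X.χ i), localHorD_χ]
  have : totalD X D 1 = 0 := by
    refine Subtype.ext (funext fun i => ?_)
    change (D.piece i).d ((D.piece i).inj (X.χ i 1)) = 0
    rw [map_one, map_one, (D.piece i).d_one]
  rw [horD, LinearMap.comp_apply, LinearMap.comp_apply, this, map_zero, map_zero, map_zero]

theorem contract_potential_mem (i : I) (h : H) (φ : H →ₗ[k] k) :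
    contract φ (c.potential i h) ∈ (D.base i).deg 1 := by
  obtain ⟨p, hp⟩ := X.χ_surjective i (1 ⊗ₜ h)
  rw [potential_apply, ← hp, localHorD_χ]
  exact contract_horProj_mem (c.toLinearMap (totalD X D p)).2.2 i φ

theorem totalD_contract (φ : H →ₗ[k] k) (p : P) :
    totalD X D (contract φ (X.coact p)) = oneTranslate X D φ (totalD X D p) := by
  refine Subtype.ext (funext fun i => ?_)
  rw [coe_oneTranslate, contract_familyCoact]
  change (D.piece i).d ((D.piece i).inj (X.χ i (contract φ (X.coact p)))) =
    contract φ (pieceCoact (D.base i) D.cov ((D.piece i).d ((D.piece i).inj (X.χ i p))))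
  rw [pieceCoact_d, contract_rTensor, ← X.χ_coact, LinearEquiv.symm_apply_apply, contract_rTensor]
  rfl

/-- A preimage p of 1 ⊗ h becomes, after translation by φ, a preimage of 1 ⊗ `translate φ h`; both d
and hor commute with translations. -/
theorem potential_translate (i : I) (φ : H →ₗ[k] k) (h : H) : c.potential i (translate φ h) =
    (translate φ).lTensor (D.base i).Form (c.potential i h) := by
  obtain ⟨p, hp⟩ := X.χ_surjective i (1 ⊗ₜ h)
  have hp' : X.χ i (contract φ (X.coact p)) = 1 ⊗ₜ translate φ h := by
    rw [χ_contract_coact, hp, LinearMap.lTensor_tmul]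
  rw [potential_apply, potential_apply, ← hp, ← hp', localHorD_χ, localHorD_χ,
    ← horProj_horTranslate]
  congr 1
  refine Subtype.ext ?_
  rw [coe_horTranslate]
  have h := (covariant_one_iff c.toLinearMap).1 c.covariant φ (totalD X D p)
  rw [← totalD_contract] at h
  refine (congrArg Subtype.val h).trans ?_
  rw [coe_horOneTranslate]; rfl

end PreConnection

namespace LeftConnection

variable (c : LeftConnection X D)

/-- With b lifted to the base, d(ι(b)p) = dι(b)·p + ι(b)dp. The first summand is horizontal and
fixed by hor, the second is handled by left P-linearity. -/
theorem localHorD_tmul (i : I) (b : B ⧸ J i) (h : H) : c.localHorD i (b ⊗ₜ h) =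
    (D.base i).d ((D.base i).inj b) ⊗ₜ h + ((D.base i).inj b ⊗ₜ 1) * c.potential i h := by
  obtain ⟨p, hp⟩ := X.χ_surjective i (1 ⊗ₜ h)
  obtain ⟨b, rfl⟩ := Ideal.Quotient.mk_surjective b
  have h1 : X.χ i (X.ι b * p) = Ideal.Quotient.mk (J i) b ⊗ₜ h := by
    rw [_root_.map_mul, X.χ_ι, hp, Algebra.TensorProduct.tmul_mul_tmul, mul_one, one_mul]
  -- The form dι(b)·p, written as a base form times an element of P so that its horizontality is
  -- evident over every piece.
  let α := baseIncl X D (baseOf D (UniversalForms.d k b)) * totalIncl X D p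
  have hα : ∀ j, (α : Families D) j =
      pieceIncl (D.base j) D.fibre ((D.base j).d ((D.base j).inj (Ideal.Quotient.mk (J j) b))) *
        (D.piece j).inj (X.χ j p) := by
    intro j
    change pieceIncl (D.base j) D.fibre (extUniversal _ _ j _) * _ = _
    rw [extUniversal_d]; rfl
  have hα1 : (α : Families D) ∈ localDeg D.piece 1 := (mem_localDeg _).2 fun j => by
    rw [hα]
    exact (D.piece j).mul_mem_deg (add_zero 1)
      (pieceIncl_mem (D.base j) D.fibre ((D.base j).d_inj_mem _)) ((D.piece j).inj_mem _)
  have h2 : totalD X D (X.ι b * p) = Submodule.inclusion (horOneForms_le X D) ⟨α, α.2, hα1⟩ +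
      leftMul X D (X.ι b) (totalD X D p) := by
    refine Subtype.ext (funext fun j => ?_)
    change (D.piece j).d ((D.piece j).inj (X.χ j (X.ι b * p))) = (α : Families D) j +
      (D.piece j).inj (X.χ j (X.ι b)) * (D.piece j).d ((D.piece j).inj (X.χ j p))
    rw [hα, _root_.map_mul, (D.piece j).d_inj_mul, X.χ_ι, pieceIncl_d]
  rw [c.potential_apply, ← h1, ← hp, c.localHorD_χ, c.localHorD_χ, horProj_eq_iff, map_add,
    horEmb_mul, horEmb_horProj, horEmb_tmul_one, horEmb_tmul_eq_mul, ← hp]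
  change (c.toLinearMap (totalD X D (X.ι b * p)) : Families D) i = _
  rw [h2, map_add, c.apply_horizontal]
  change (α : Families D) i +
    (c.toLinearMap (leftMul X D (X.ι b) (totalD X D p)) : Families D) i = _
  rw [c.map_mul, hα]
  change _ + (D.piece i).inj (X.χ i (X.ι b)) * _ = _
  rw [X.χ_ι, piece_inj_tmul_one]; rfl

theorem leftOp_localHorD (i : I) (y : (B ⧸ J i) ⊗[k] H) :
    leftOp (D.base i) (c.potential i) ((D.base i).inj.toLinearMap.rTensor H y) =
      c.localHorD i y := by
  induction y using TensorProduct.induction_on with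
  | zero => simp
  | add x y hx hy => simp only [map_add, hx, hy]
  | tmul b h =>
    rw [LinearMap.rTensor_tmul, AlgHom.toLinearMap_apply, leftOp_tmul, localHorD_tmul,
      DifferentialCalculus.sign_inj]

/-- The overlap ideals are stable under d, signs and products, which settles `hK`. For `hlift`, γ ⊗
h is lifted to ω·p with ω a form on the whole base; the local operators turn it into dω·p +
sign(ω)·hor(dp), a global form. -/
theorem applyLocal_mem (α : horForms X D) :
    applyLocal X D (fun i => leftOp (D.base i) (c.potential i)) α ∈ totalForms X D := by
  refine QuantumBundle.applyLocal_mem _ (fun i j γ h hγ => ?_) (fun i γ h => ?_) α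
  · rw [leftOp_tmul, map_add, horEmb_mul, horEmb_tmul_one, horEmb_tmul_eq_mul, ← piece_d_pieceIncl,
      ← piece_sign_pieceIncl]
    exact add_mem (overlap_mul_right (overlap_d hγ) _) (overlap_mul_right (overlap_sign hγ) _)
  · obtain ⟨ω, rfl⟩ := exists_baseOf D i γ
    obtain ⟨p, hp⟩ := X.χ_surjective i (1 ⊗ₜ h)
    obtain ⟨ω₁, h₁⟩ := exists_extUniversal_d (fun i => Ideal.Quotient.mkₐ k (J i)) D.base ω
    obtain ⟨ω₂, h₂⟩ := exists_extUniversal_sign (fun i => Ideal.Quotient.mkₐ k (J i)) D.base ω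
    refine ⟨baseIncl X D (baseOf D ω) * totalIncl X D p, ?_, ?_⟩
    · rw [horProj_mul, horProj_baseIncl, horProj_totalIncl, hp, LinearMap.rTensor_tmul,
        Algebra.TensorProduct.tmul_mul_tmul, AlgHom.toLinearMap_apply, map_one, mul_one, one_mul]
    · have : applyLocal X D (fun i => leftOp (D.base i) (c.potential i))
          (baseIncl X D (baseOf D ω) * totalIncl X D p) =
          ((baseIncl X D (baseOf D ω₁) * totalIncl X D p +
            baseIncl X D (baseOf D ω₂) * c.horD p : horForms X D) : Families D) := by
        funext j
        rw [← horEmb_horProj X D j (_ + _), applyLocal_apply, map_add, horProj_mul, horProj_mul,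
          horProj_mul, horProj_baseIncl, horProj_baseIncl, horProj_baseIncl, leftOp_mul,
          horProj_totalIncl, leftOp_localHorD, c.localHorD_χ, baseOf_apply, baseOf_apply,
          baseOf_apply, h₁, h₂]
      rw [this]
      exact mem_totalForms _

/-- The left covariant derivative of a left connection. -/
def covariantDerivative : LeftCovariantDerivative X D where
  toPreCovariantDerivative := PreCovariantDerivative.ofLocal
    (fun i => leftOp (D.base i) (c.potential i)) c.applyLocal_mem
    (fun i _ _ h φ hγ => contract_leftOp_mem _ (c.contract_potential_mem i) hγ h φ)
    (fun i => by rw [Algebra.TensorProduct.one_def, leftOp_one_tmul, c.potential_one])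
    (fun i φ γ h => leftOp_translate _ (c.potential_translate i) φ γ h)
  leibniz n γ α hγ := by
    funext i
    change horEmb (D.base i) D.fibre (leftOp (D.base i) (c.potential i)
      (horProj X D i (baseIncl X D γ * α))) =
      (D.piece i).d (pieceIncl (D.base i) D.fibre ((γ : ∀ i, (D.base i).Form) i)) *
        (α : Families D) i + (-1 : k) ^ n • (pieceIncl (D.base i) D.fibre
          ((γ : ∀ i, (D.base i).Form) i) * horEmb (D.base i) D.fibre
            (leftOp (D.base i) (c.potential i) (horProj X D i α)))
    rw [horProj_mul, horProj_baseIncl, leftOp_mul, map_add, horEmb_mul, horEmb_mul,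
      horEmb_tmul_one, horEmb_tmul_one, horEmb_horProj, piece_d_pieceIncl,
      (D.base i).sign_of_mem ((mem_localDeg _).1 hγ i), map_smul, smul_mul_assoc]

theorem covariantDerivative_totalIncl (p : P) :
    c.covariantDerivative.toLinearMap (totalIncl X D p) = c.horD p := by
  refine Subtype.ext (funext fun i => ?_)
  rw [← horEmb_horProj, ← horEmb_horProj, ← c.localHorD_χ, ← leftOp_localHorD, ← horProj_totalIncl]
  exact congrArg _ (horProj_horLocal _ c.applyLocal_mem _ i)

theorem localMap_covariantDerivative (i : I) : c.covariantDerivative.localMap i =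
    leftOp (D.base i) (c.potential i) :=
  PreCovariantDerivative.localMap_eq _ fun α => horProj_horLocal _ c.applyLocal_mem α i

/-- Lifting h and h' to elements p, q of P realises Σ h dh' as the i-component of a global one-form
Σ p dq, and left linearity computes hor of it as Σ (1 ⊗ h)a(h'). If the component is zero, locality
of hor makes this zero. -/
theorem mulAct_potential (i : I) {w : H ⊗[k] H} (hw : mulDiff D.fibre w = 0) :
    mulAct (c.potential i) w = 0 := by
  have key : ∀ w : H ⊗[k] H, ∃ γ : oneForms X D, (γ : Families D) i =
      pieceTmul D.fibre (1 : (D.base i).Form) (mulDiff D.fibre w) ∧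
      horProj X D i (horOneIncl X D (c.toLinearMap γ)) = mulAct (c.potential i) w := by
    intro w
    induction w using TensorProduct.induction_on with
    | zero => exact ⟨0, by simp, by simp⟩
    | add x y hx hy =>
      obtain ⟨γ, h1, h2⟩ := hx
      obtain ⟨η, h3, h4⟩ := hy
      refine ⟨γ + η, ?_, by simp only [map_add, h2, h4]⟩
      rw [map_add, map_add, ← h1, ← h3]; rfl
    | tmul h h' =>
      obtain ⟨p, hp⟩ := X.χ_surjective i (1 ⊗ₜ h)
      obtain ⟨q, hq⟩ := X.χ_surjective i (1 ⊗ₜ h')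
      refine ⟨leftMul X D p (totalD X D q), ?_, ?_⟩
      · change (D.piece i).inj (X.χ i p) * (D.piece i).d ((D.piece i).inj (X.χ i q)) = _
        rw [hp, hq, piece_d_inj_one_tmul, pieceTmul_inj_mul, mulDiff_tmul]
      · have : horOneIncl X D (c.toLinearMap (leftMul X D p (totalD X D q))) =
            totalIncl X D p * c.horD q := Subtype.ext (c.map_mul p (totalD X D q))
        rw [this, horProj_mul, horProj_totalIncl, hp, mulAct_tmul, c.potential_apply, ← hq,
          c.localHorD_χ, LinearMap.rTensor_tmul, AlgHom.toLinearMap_apply, map_one]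
  obtain ⟨γ, h1, h2⟩ := key w
  rw [← h2, horProj_eq_zero]
  refine c.isLocal i γ ?_
  rw [h1, hw, map_zero]

theorem rightIdeal_le (hS : Function.Bijective (antipode k (A := H))) (i : I) :
    rightIdeal D.fibre hS ≤ LinearMap.ker (c.covariantDerivative.A i) := by
  intro r hr
  have h := rightIdeal_le_of_mulAct hS (c.potential_translate i)
    (fun w hw => c.mulAct_potential i hw) hr
  rw [LinearMap.mem_ker]
  change -contract counit (c.covariantDerivative.localMap i (1 ⊗ₜ r)) = 0
  rw [localMap_covariantDerivative, leftOp_one_tmul, h, neg_zero]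

end LeftConnection

end Bundle

end

/-! ### From right connections to right covariant derivatives -/

section

open DifferentialCalculus HopfAlgebra Coalgebra

section Bundle

variable {k : Type*} {H : Type*} {P : Type*} {B : Type*} {I : Type*} [Field k]
    [Ring H] [HopfAlgebra k H] [Ring P] [Algebra k P] [Ring B] [Algebra k B]
    {J : I → Ideal B} [∀ i, (J i).IsTwoSided]

variable {X : PrincipalBundle k H P J} {D : DifferentialStructure k H J}

theorem horEmb_tmul_eq_mul' {A : Type*} [Ring A] [Algebra k A] (Γ : DifferentialCalculus k A)
    (Λ : DifferentialCalculus k H) (γ : Γ.Form) (h : H) :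
    horEmb Γ Λ (γ ⊗ₜ h) = (Γ.tensor Λ).inj (1 ⊗ₜ h) * pieceIncl Γ Λ γ := by
  rw [piece_inj_one_tmul, ← horEmb_tmul_one]
  refine Eq.trans ?_ (horEmb_mul Γ Λ _ _)
  simp

theorem sign_rTensor_inj {A : Type*} [Ring A] [Algebra k A] (Γ : DifferentialCalculus k A)
    (y : A ⊗[k] H) :
    Γ.sign.rTensor H (Γ.inj.toLinearMap.rTensor H y) = Γ.inj.toLinearMap.rTensor H y := by
  induction y using TensorProduct.induction_on with
  | zero => simp
  | add x y hx hy => simp only [map_add, hx, hy]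
  | tmul a h =>
    rw [LinearMap.rTensor_tmul, LinearMap.rTensor_tmul, AlgHom.toLinearMap_apply, Γ.sign_inj]

variable [Fintype I] [DecidableEq I]

namespace RightConnection

variable (c : RightConnection X D)

/-- Here ι(b) is placed to the right of p: d(pι(b)) = dp·ι(b) + p·dι(b), with right P-linearity for
the first term and horizontality of the second. -/
theorem localHorD_tmul (i : I) (b : B ⧸ J i) (h : H) : c.localHorD i (b ⊗ₜ h) =
    (D.base i).d ((D.base i).inj b) ⊗ₜ h + c.potential i h * ((D.base i).inj b ⊗ₜ 1) := by
  obtain ⟨p, hp⟩ := X.χ_surjective i (1 ⊗ₜ h)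
  obtain ⟨b, rfl⟩ := Ideal.Quotient.mk_surjective b
  have h1 : X.χ i (p * X.ι b) = Ideal.Quotient.mk (J i) b ⊗ₜ h := by
    rw [_root_.map_mul, X.χ_ι, hp, Algebra.TensorProduct.tmul_mul_tmul, mul_one, one_mul]
  let α := totalIncl X D p * baseIncl X D (baseOf D (UniversalForms.d k b))
  have hα : ∀ j, (α : Families D) j = (D.piece j).inj (X.χ j p) *
      pieceIncl (D.base j) D.fibre ((D.base j).d ((D.base j).inj (Ideal.Quotient.mk (J j) b))) := by
    intro j
    change _ * pieceIncl (D.base j) D.fibre (extUniversal _ _ j _) = _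
    rw [extUniversal_d]; rfl
  have hα1 : (α : Families D) ∈ localDeg D.piece 1 := (mem_localDeg _).2 fun j => by
    rw [hα]
    exact (D.piece j).mul_mem_deg (zero_add 1) ((D.piece j).inj_mem _)
      (pieceIncl_mem (D.base j) D.fibre ((D.base j).d_inj_mem _))
  have h2 : totalD X D (p * X.ι b) = Submodule.inclusion (horOneForms_le X D) ⟨α, α.2, hα1⟩ +
      rightMul X D (totalD X D p) (X.ι b) := by
    refine Subtype.ext (funext fun j => ?_)
    change (D.piece j).d ((D.piece j).inj (X.χ j (p * X.ι b))) = (α : Families D) j +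
      (D.piece j).d ((D.piece j).inj (X.χ j p)) * (D.piece j).inj (X.χ j (X.ι b))
    rw [hα, _root_.map_mul, (D.piece j).d_inj_mul, X.χ_ι, pieceIncl_d, add_comm]
  rw [c.potential_apply, ← h1, ← hp, c.localHorD_χ, c.localHorD_χ, horProj_eq_iff, map_add,
    horEmb_mul, horEmb_horProj, horEmb_tmul_one, horEmb_tmul_eq_mul', ← hp]
  change (c.toLinearMap (totalD X D (p * X.ι b)) : Families D) i = _
  rw [h2, map_add, c.apply_horizontal]
  change (α : Families D) i +
    (c.toLinearMap (rightMul X D (totalD X D p) (X.ι b)) : Families D) i = _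
  rw [c.map_mul, hα]
  change _ + _ * (D.piece i).inj (X.χ i (X.ι b)) = _
  rw [X.χ_ι, piece_inj_tmul_one]; rfl

theorem rightOp_localHorD (i : I) (y : (B ⧸ J i) ⊗[k] H) :
    rightOp (D.base i) (c.potential i) ((D.base i).inj.toLinearMap.rTensor H y) =
      c.localHorD i y := by
  induction y using TensorProduct.induction_on with
  | zero => simp
  | add x y hx hy => simp only [map_add, hx, hy]
  | tmul b h =>
    rw [LinearMap.rTensor_tmul, AlgHom.toLinearMap_apply, rightOp_tmul, localHorD_tmul]

/-- The lift is p·ω, mapped to hor(dp)·ω + p·dω. No sign occurs since p has degree 0. -/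
theorem applyLocal_mem (α : horForms X D) :
    applyLocal X D (fun i => rightOp (D.base i) (c.potential i)) α ∈ totalForms X D := by
  refine QuantumBundle.applyLocal_mem _ (fun i j γ h hγ => ?_) (fun i γ h => ?_) α
  · rw [rightOp_tmul, map_add, horEmb_mul, horEmb_tmul_one, horEmb_tmul_eq_mul, ← piece_d_pieceIncl]
    exact add_mem (overlap_mul_right (overlap_d hγ) _) (overlap_mul_left hγ _)
  · obtain ⟨ω, rfl⟩ := exists_baseOf D i γ
    obtain ⟨p, hp⟩ := X.χ_surjective i (1 ⊗ₜ h)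
    obtain ⟨ω₁, h₁⟩ := exists_extUniversal_d (fun i => Ideal.Quotient.mkₐ k (J i)) D.base ω
    refine ⟨totalIncl X D p * baseIncl X D (baseOf D ω), ?_, ?_⟩
    · rw [horProj_mul, horProj_baseIncl, horProj_totalIncl, hp, LinearMap.rTensor_tmul,
        Algebra.TensorProduct.tmul_mul_tmul, AlgHom.toLinearMap_apply, map_one, mul_one, one_mul]
    · have : applyLocal X D (fun i => rightOp (D.base i) (c.potential i))
          (totalIncl X D p * baseIncl X D (baseOf D ω)) =
          ((c.horD p * baseIncl X D (baseOf D ω) +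
            totalIncl X D p * baseIncl X D (baseOf D ω₁) : horForms X D) : Families D) := by
        funext j
        rw [← horEmb_horProj X D j (_ + _), applyLocal_apply, map_add, horProj_mul, horProj_mul,
          horProj_mul, horProj_baseIncl, horProj_baseIncl, rightOp_mul,
          horProj_totalIncl, rightOp_localHorD, c.localHorD_χ, baseOf_apply, baseOf_apply, h₁,
          sign_rTensor_inj]
      rw [this]
      exact mem_totalForms _

/-- The right covariant derivative of a right connection. -/
def covariantDerivative : RightCovariantDerivative X D where
  toPreCovariantDerivative := PreCovariantDerivative.ofLocal
    (fun i => rightOp (D.base i) (c.potential i)) c.applyLocal_mem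
    (fun i _ _ h φ hγ => contract_rightOp_mem _ (c.contract_potential_mem i) hγ h φ)
    (fun i => by rw [Algebra.TensorProduct.one_def, rightOp_one_tmul, c.potential_one])
    (fun i φ γ h => rightOp_translate _ (c.potential_translate i) φ γ h)
  leibniz n γ α hα := by
    funext i
    change horEmb (D.base i) D.fibre (rightOp (D.base i) (c.potential i)
      (horProj X D i (α * baseIncl X D γ))) =
      horEmb (D.base i) D.fibre (rightOp (D.base i) (c.potential i) (horProj X D i α)) *
        pieceIncl (D.base i) D.fibre ((γ : ∀ i, (D.base i).Form) i) +
      (-1 : k) ^ n • ((α : Families D) i *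
        (D.piece i).d (pieceIncl (D.base i) D.fibre ((γ : ∀ i, (D.base i).Form) i)))
    rw [horProj_mul, horProj_baseIncl, rightOp_mul, map_add, horEmb_mul, horEmb_mul,
      horEmb_tmul_one, horEmb_tmul_one, piece_d_pieceIncl,
      sign_rTensor_of_contract_mem _ (contract_horProj_mem hα i), map_smul, horEmb_horProj,
      smul_mul_assoc]

theorem covariantDerivative_totalIncl (p : P) :
    c.covariantDerivative.toLinearMap (totalIncl X D p) = c.horD p := by
  refine Subtype.ext (funext fun i => ?_)
  rw [← horEmb_horProj, ← horEmb_horProj, ← c.localHorD_χ, ← rightOp_localHorD, ← horProj_totalIncl]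
  exact congrArg _ (horProj_horLocal _ c.applyLocal_mem _ i)

theorem localMap_covariantDerivative (i : I) : c.covariantDerivative.localMap i =
    rightOp (D.base i) (c.potential i) :=
  PreCovariantDerivative.localMap_eq _ fun α => horProj_horLocal _ c.applyLocal_mem α i

/-- The relation Σ dh' h is realised by a global one-form Σ dq·p, on which right linearity and
locality of hor apply as in the left case. -/
theorem actMul_potential (i : I) {w : H ⊗[k] H} (hw : diffMul D.fibre w = 0) :
    actMul (c.potential i) w = 0 := by
  have key : ∀ w : H ⊗[k] H, ∃ γ : oneForms X D, (γ : Families D) i =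
      pieceTmul D.fibre (1 : (D.base i).Form) (diffMul D.fibre w) ∧
      horProj X D i (horOneIncl X D (c.toLinearMap γ)) = actMul (c.potential i) w := by
    intro w
    induction w using TensorProduct.induction_on with
    | zero => exact ⟨0, by simp, by simp⟩
    | add x y hx hy =>
      obtain ⟨γ, h1, h2⟩ := hx
      obtain ⟨η, h3, h4⟩ := hy
      refine ⟨γ + η, ?_, by simp only [map_add, h2, h4]⟩
      rw [map_add, map_add, ← h1, ← h3]; rfl
    | tmul h' h =>
      obtain ⟨p, hp⟩ := X.χ_surjective i (1 ⊗ₜ h)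
      obtain ⟨q, hq⟩ := X.χ_surjective i (1 ⊗ₜ h')
      refine ⟨rightMul X D (totalD X D q) p, ?_, ?_⟩
      · change (D.piece i).d ((D.piece i).inj (X.χ i q)) * (D.piece i).inj (X.χ i p) = _
        rw [hp, hq, piece_d_inj_one_tmul, pieceTmul_mul_inj _ _ _ (D.fibre.d_inj_mem h'),
          diffMul_tmul]
      · have : horOneIncl X D (c.toLinearMap (rightMul X D (totalD X D q) p)) =
            c.horD q * totalIncl X D p := Subtype.ext (c.map_mul p (totalD X D q))
        rw [this, horProj_mul, horProj_totalIncl, hp, actMul_tmul, c.potential_apply, ← hq,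
          c.localHorD_χ, LinearMap.rTensor_tmul, AlgHom.toLinearMap_apply, map_one]
  obtain ⟨γ, h1, h2⟩ := key w
  rw [← h2, horProj_eq_zero]
  refine c.isLocal i γ ?_
  rw [h1, hw, map_zero]

theorem rightIdeal_map_le (hS : Function.Bijective (antipode k (A := H))) (i : I) :
    (rightIdeal D.fibre hS).map (antipodeInv hS) ≤
      LinearMap.ker (c.covariantDerivative.A i) := by
  rintro _ ⟨r, hr, rfl⟩
  have h := rightIdeal_le_of_actMul hS (c.potential_translate i)
    (fun w hw => c.actMul_potential i hw) hr
  rw [LinearMap.mem_ker]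
  change -contract counit (c.covariantDerivative.localMap i (1 ⊗ₜ antipodeInv hS r)) = 0
  rw [localMap_covariantDerivative, rightOp_one_tmul, h, neg_zero]

end RightConnection

end Bundle

end

/-! ### Module maps on the one-forms of a trivial piece -/

section

open DifferentialCalculus HopfAlgebra Coalgebra

section LocalConnections

variable {k : Type*} {A : Type*} {H : Type*} [Field k] [Ring A] [Algebra k A] [Ring H]
  [HopfAlgebra k H]

/-- The Leibniz rule in the form a db = d(ab)·1 - da·b gives generators suited to right module maps.
-/
theorem DifferentialCalculus.deg_one_le_span_d_mul (Γ : DifferentialCalculus k A) :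
    Γ.deg 1 ≤ Submodule.span k {ω | ∃ a b : A, ω = Γ.d (Γ.inj a) * Γ.inj b} := by
  refine Γ.deg_one_le.trans (Submodule.span_le.2 ?_)
  rintro _ ⟨a, b, rfl⟩
  have : Γ.inj a * Γ.d (Γ.inj b) =
      Γ.d (Γ.inj (a * b)) * Γ.inj 1 - Γ.d (Γ.inj a) * Γ.inj b := by
    rw [Γ.d_inj_mul, map_one, mul_one, add_sub_cancel_left]
  rw [this]
  exact sub_mem (Submodule.subset_span ⟨_, _, rfl⟩) (Submodule.subset_span ⟨_, _, rfl⟩)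

variable (Γ : DifferentialCalculus k A) (Λ : DifferentialCalculus k H)

theorem horEmb_rTensor_inj_mul (x : A ⊗[k] H) (z : Γ.Form ⊗[k] H) :
    horEmb Γ Λ (Γ.inj.toLinearMap.rTensor H x * z) = (Γ.tensor Λ).inj x * horEmb Γ Λ z := by
  rw [horEmb_mul, piece_inj]

theorem horEmb_mul_rTensor_inj (x : A ⊗[k] H) (z : Γ.Form ⊗[k] H) :
    horEmb Γ Λ (z * Γ.inj.toLinearMap.rTensor H x) = horEmb Γ Λ z * (Γ.tensor Λ).inj x := by
  rw [horEmb_mul, piece_inj]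

section Projections

variable (r : Λ.Form →ₗ[k] H) (κ : Λ.Form →ₗ[k] Γ.Form ⊗[k] H)

/-- The local operator `γ ⊗ θ ↦ γ ⊗ r(θ) + (γ ⊗ 1) κ(θ₁)` of a left connection. -/
def leftHor : (Γ.tensor Λ).Form →ₗ[k] Γ.Form ⊗[k] H :=
  (r.lTensor Γ.Form + LinearMap.mul' k (Γ.Form ⊗[k] H) ∘ₗ
    TensorProduct.map ((TensorProduct.mk k Γ.Form H).flip 1) (κ ∘ₗ Λ.proj 1)) ∘ₗ
    (GradedTensorProduct.of k Γ.deg Λ.deg).symm.toLinearMap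

/-- The local operator `γ ⊗ θ ↦ γ ⊗ r(θ) + κ(θ₁) (γ ⊗ 1)` of a right connection. -/
def rightHor : (Γ.tensor Λ).Form →ₗ[k] Γ.Form ⊗[k] H :=
  (r.lTensor Γ.Form + LinearMap.mul' k (Γ.Form ⊗[k] H) ∘ₗ
    TensorProduct.map (κ ∘ₗ Λ.proj 1) ((TensorProduct.mk k Γ.Form H).flip 1) ∘ₗ
      (TensorProduct.comm k Γ.Form Λ.Form).toLinearMap) ∘ₗ
    (GradedTensorProduct.of k Γ.deg Λ.deg).symm.toLinearMap

theorem leftHor_pieceTmul (γ : Γ.Form) (θ : Λ.Form) : leftHor Γ Λ r κ (pieceTmul Λ γ θ) =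
    γ ⊗ₜ r θ + (γ ⊗ₜ 1) * κ (Λ.proj 1 θ) := rfl

theorem rightHor_pieceTmul (γ : Γ.Form) (θ : Λ.Form) : rightHor Γ Λ r κ (pieceTmul Λ γ θ) =
    γ ⊗ₜ r θ + κ (Λ.proj 1 θ) * (γ ⊗ₜ 1) := rfl

variable {r κ} (hr : ∀ h, r (Λ.inj h) = h) (hr1 : ∀ θ ∈ Λ.deg 1, r θ = 0)

theorem pieceTmul_mul_pieceTmul {m : ℕ} (b b' : A) {θ : Λ.Form} (hθ : θ ∈ Λ.deg m) (τ : Λ.Form) :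
    pieceTmul Λ (Γ.inj b) θ * pieceTmul Λ (Γ.inj b') τ = pieceTmul Λ (Γ.inj (b * b')) (θ * τ) := by
  rw [map_mul Γ.inj]
  exact tm_mul_tm_zero _ hθ (Γ.inj_mem b') τ

include hr

theorem leftHor_horEmb (z : Γ.Form ⊗[k] H) : leftHor Γ Λ r κ (horEmb Γ Λ z) = z := by
  induction z using TensorProduct.induction_on with
  | zero => simp
  | add x y hx hy => rw [map_add, map_add, hx, hy]
  | tmul γ h =>
    rw [← pieceTmul_inj, leftHor_pieceTmul, hr, Λ.proj_of_mem_ne (Λ.inj_mem h) zero_ne_one,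
      map_zero, mul_zero, add_zero]

theorem rightHor_horEmb (z : Γ.Form ⊗[k] H) : rightHor Γ Λ r κ (horEmb Γ Λ z) = z := by
  induction z using TensorProduct.induction_on with
  | zero => simp
  | add x y hx hy => rw [map_add, map_add, hx, hy]
  | tmul γ h =>
    rw [← pieceTmul_inj, rightHor_pieceTmul, hr, Λ.proj_of_mem_ne (Λ.inj_mem h) zero_ne_one,
      map_zero, zero_mul, add_zero]

include hr1

/-- The form (b ⊗ h)d(b' ⊗ h') splits into a horizontal part b db' ⊗ hh', which `leftHor` fixes, and
bb' ⊗ h dh', where κ(h dh') = (1 ⊗ h)a(h'). The sum is (b ⊗ h) times `leftOp` of b' ⊗ h', so on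
one-forms the operator is left linear and extends dy ↦ Dᵢ(y). -/
theorem leftHor_inj_mul_d {a : H →ₗ[k] Γ.Form ⊗[k] H} (hκ : ∀ w, κ (mulDiff Λ w) = mulAct a w)
    (x y : A ⊗[k] H) :
    leftHor Γ Λ r κ ((Γ.tensor Λ).inj x * (Γ.tensor Λ).d ((Γ.tensor Λ).inj y)) =
      Γ.inj.toLinearMap.rTensor H x * leftOp Γ a (Γ.inj.toLinearMap.rTensor H y) := by
  induction x using TensorProduct.induction_on with
  | zero => simp
  | add x y hx hy => simp only [map_add, add_mul, hx, hy]
  | tmul b h =>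
    induction y using TensorProduct.induction_on with
    | zero => simp
    | add x y hx hy => simp only [map_add, mul_add, hx, hy]
    | tmul b' h' =>
      have hm : Λ.inj h * Λ.d (Λ.inj h') ∈ Λ.deg 1 :=
        Λ.mul_mem_deg (zero_add 1) (Λ.inj_mem h) (Λ.d_inj_mem h')
      have hi : (Γ.tensor Λ).inj (b ⊗ₜ h) = pieceTmul Λ (Γ.inj b) (Λ.inj h) := by
        rw [piece_inj]; rfl
      rw [piece_d_inj_tmul, mul_add, map_add, ← horEmb_rTensor_inj_mul, leftHor_horEmb Γ Λ hr, hi,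
        pieceTmul_mul_pieceTmul _ _ _ _ (Λ.inj_mem h), leftHor_pieceTmul, hr1 _ hm,
        Λ.proj_of_mem hm, TensorProduct.tmul_zero, zero_add, ← mulDiff_tmul, hκ, mulAct_tmul,
        LinearMap.rTensor_tmul, LinearMap.rTensor_tmul, leftOp_tmul, mul_add,
        AlgHom.toLinearMap_apply, AlgHom.toLinearMap_apply, Γ.sign_inj, ← mul_assoc, ← mul_assoc,
        Algebra.TensorProduct.tmul_mul_tmul _ _ (1 : H), Algebra.TensorProduct.tmul_mul_tmul _ _ h,
        Algebra.TensorProduct.tmul_mul_tmul _ _ h, map_mul]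
      simp

/-- The mirror computation on d(b' ⊗ h')(b ⊗ h), with κ(dh' h) = a(h')(1 ⊗ h) for the part in Γ¹(H).
-/
theorem rightHor_d_mul_inj {a : H →ₗ[k] Γ.Form ⊗[k] H} (hκ : ∀ w, κ (diffMul Λ w) = actMul a w)
    (x y : A ⊗[k] H) :
    rightHor Γ Λ r κ ((Γ.tensor Λ).d ((Γ.tensor Λ).inj y) * (Γ.tensor Λ).inj x) =
      rightOp Γ a (Γ.inj.toLinearMap.rTensor H y) * Γ.inj.toLinearMap.rTensor H x := by
  induction x using TensorProduct.induction_on with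
  | zero => simp
  | add x y hx hy => simp only [map_add, mul_add, hx, hy]
  | tmul b h =>
    induction y using TensorProduct.induction_on with
    | zero => simp
    | add x y hx hy => simp only [map_add, add_mul, hx, hy]
    | tmul b' h' =>
      have hm : Λ.d (Λ.inj h') * Λ.inj h ∈ Λ.deg 1 :=
        Λ.mul_mem_deg (add_zero 1) (Λ.d_inj_mem h') (Λ.inj_mem h)
      have hi : (Γ.tensor Λ).inj (b ⊗ₜ h) = pieceTmul Λ (Γ.inj b) (Λ.inj h) := by
        rw [piece_inj]; rfl
      rw [piece_d_inj_tmul, add_mul, map_add, ← horEmb_mul_rTensor_inj, rightHor_horEmb Γ Λ hr, hi,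
        pieceTmul_mul_pieceTmul _ _ _ _ (Λ.d_inj_mem h'), rightHor_pieceTmul, hr1 _ hm,
        Λ.proj_of_mem hm, TensorProduct.tmul_zero, zero_add, ← diffMul_tmul, hκ, actMul_tmul,
        LinearMap.rTensor_tmul, LinearMap.rTensor_tmul, rightOp_tmul, add_mul,
        AlgHom.toLinearMap_apply, AlgHom.toLinearMap_apply, mul_assoc, mul_assoc,
        Algebra.TensorProduct.tmul_mul_tmul _ _ h, Algebra.TensorProduct.tmul_mul_tmul _ _ h',
        Algebra.TensorProduct.tmul_mul_tmul _ _ (1 : H), map_mul]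
      simp

end Projections

variable {Λ} (cov : RightCovariant Λ)

/-- The coaction of `H` on `A ⊗ H`. -/
def trivialCoact : A ⊗[k] H →ₗ[k] (A ⊗[k] H) ⊗[k] H :=
  (TensorProduct.assoc k A H H).symm.toLinearMap ∘ₗ (Coalgebra.comul (R := k) (A := H)).lTensor A

theorem contract_trivialCoact (φ : H →ₗ[k] k) (y : A ⊗[k] H) :
    contract φ (trivialCoact y) = (translate φ).lTensor A y := by
  have e : ∀ z : A ⊗[k] (H ⊗[k] H), contract φ ((TensorProduct.assoc k A H H).symm z) =
      (contract φ).lTensor A z := by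
    intro z
    induction z using TensorProduct.induction_on with
    | zero => simp
    | add x y hx hy => simp only [map_add, hx, hy]
    | tmul a w =>
      induction w using TensorProduct.induction_on with
      | zero => simp
      | add x y hx hy => simp only [map_add, TensorProduct.tmul_add, hx, hy]
      | tmul g h => simp
  rw [trivialCoact, LinearMap.comp_apply, LinearEquiv.coe_coe, e, translate, LinearMap.lTensor_comp]
  rfl

theorem rTensor_inj_lTensor (f : H →ₗ[k] H) (y : A ⊗[k] H) :
    Γ.inj.toLinearMap.rTensor H (f.lTensor A y) =
      f.lTensor Γ.Form (Γ.inj.toLinearMap.rTensor H y) := by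
  induction y using TensorProduct.induction_on with
  | zero => simp
  | add x y hx hy => simp only [map_add, hx, hy]
  | tmul a h => simp

variable {Γ} {T : Γ.Form ⊗[k] H →ₗ[k] Γ.Form ⊗[k] H}
  (hT : ∀ (φ : H →ₗ[k] k) z, T ((translate φ).lTensor Γ.Form z) =
    (translate φ).lTensor Γ.Form (T z))
  {N : (Γ.tensor Λ).Form →ₗ[k] (Γ.tensor Λ).Form}

include hT

theorem rTensor_trivialCoact (y : A ⊗[k] H) :
    (horEmb Γ Λ ∘ₗ T ∘ₗ Γ.inj.toLinearMap.rTensor H).rTensor H (trivialCoact y) =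
      pieceCoact Γ cov (horEmb Γ Λ (T (Γ.inj.toLinearMap.rTensor H y))) := by
  refine eq_of_contract fun φ => ?_
  rw [contract_rTensor, contract_trivialCoact, contract_pieceCoact_horEmb, ← hT,
    ← rTensor_inj_lTensor]
  rfl

/-- One-forms are spanned by the x dy and the coaction is multiplicative, so covariance of N follows
from left linearity and the colinearity of T. -/
theorem leftModuleMap_translate
    (hN : ∀ x y, N ((Γ.tensor Λ).inj x * (Γ.tensor Λ).d ((Γ.tensor Λ).inj y)) =
      (Γ.tensor Λ).inj x * horEmb Γ Λ (T (Γ.inj.toLinearMap.rTensor H y)))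
    {u : (Γ.tensor Λ).Form} (hu : u ∈ (Γ.tensor Λ).deg 1) (φ : H →ₗ[k] k) :
    N (contract φ (pieceCoact Γ cov u)) = contract φ (pieceCoact Γ cov (N u)) := by
  rw [← contract_rTensor]
  congr 1
  have hu' := (Γ.tensor Λ).deg_one_le hu
  clear hu
  induction hu' using Submodule.span_induction with
  | zero => simp
  | add x y _ _ hx hy => simp only [map_add, hx, hy]
  | smul c x _ hx => simp only [map_smul, hx]
  | mem u hu =>
    obtain ⟨x, y, rfl⟩ := hu
    rw [hN, map_mul (pieceCoact Γ cov), map_mul (pieceCoact Γ cov), pieceCoact_inj, pieceCoact_d,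
      ← rTensor_trivialCoact cov hT]
    change N.rTensor H (_ * ((Γ.tensor Λ).d ∘ₗ (Γ.tensor Λ).inj.toLinearMap).rTensor H
      (trivialCoact y)) = _
    generalize trivialCoact y = t
    generalize (TensorProduct.assoc k A H H).symm _ = s
    induction s using TensorProduct.induction_on with
    | zero => simp
    | add x y hx hy => simp only [map_add, add_mul, hx, hy]
    | tmul x g =>
      induction t using TensorProduct.induction_on with
      | zero => simp
      | add x y hx hy => simp only [map_add, mul_add, hx, hy]
      | tmul y h =>
        simp only [LinearMap.rTensor_tmul, Algebra.TensorProduct.tmul_mul_tmul,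
          LinearMap.comp_apply, AlgHom.toLinearMap_apply, hN]

theorem rightModuleMap_translate
    (hN : ∀ x y, N ((Γ.tensor Λ).d ((Γ.tensor Λ).inj y) * (Γ.tensor Λ).inj x) =
      horEmb Γ Λ (T (Γ.inj.toLinearMap.rTensor H y)) * (Γ.tensor Λ).inj x)
    {u : (Γ.tensor Λ).Form} (hu : u ∈ (Γ.tensor Λ).deg 1) (φ : H →ₗ[k] k) :
    N (contract φ (pieceCoact Γ cov u)) = contract φ (pieceCoact Γ cov (N u)) := by
  rw [← contract_rTensor]
  congr 1
  have hu' := (Γ.tensor Λ).deg_one_le_span_d_mul hu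
  clear hu
  induction hu' using Submodule.span_induction with
  | zero => simp
  | add x y _ _ hx hy => simp only [map_add, hx, hy]
  | smul c x _ hx => simp only [map_smul, hx]
  | mem u hu =>
    obtain ⟨y, x, rfl⟩ := hu
    rw [hN, map_mul (pieceCoact Γ cov), map_mul (pieceCoact Γ cov), pieceCoact_inj, pieceCoact_d,
      ← rTensor_trivialCoact cov hT]
    change N.rTensor H (((Γ.tensor Λ).d ∘ₗ (Γ.tensor Λ).inj.toLinearMap).rTensor H
      (trivialCoact y) * _) = _
    generalize trivialCoact y = t
    generalize (TensorProduct.assoc k A H H).symm _ = s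
    induction s using TensorProduct.induction_on with
    | zero => simp
    | add x y hx hy => simp only [map_add, mul_add, hx, hy]
    | tmul x g =>
      induction t using TensorProduct.induction_on with
      | zero => simp
      | add x y hx hy => simp only [map_add, add_mul, hx, hy]
      | tmul y h =>
        simp only [LinearMap.rTensor_tmul, Algebra.TensorProduct.tmul_mul_tmul,
          LinearMap.comp_apply, AlgHom.toLinearMap_apply, hN]

omit hT

theorem leftModuleMap_mem_deg
    (hT1 : ∀ y φ, contract φ (T (Γ.inj.toLinearMap.rTensor H y)) ∈ Γ.deg 1)
    (hN : ∀ x y, N ((Γ.tensor Λ).inj x * (Γ.tensor Λ).d ((Γ.tensor Λ).inj y)) =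
      (Γ.tensor Λ).inj x * horEmb Γ Λ (T (Γ.inj.toLinearMap.rTensor H y)))
    {u : (Γ.tensor Λ).Form} (hu : u ∈ (Γ.tensor Λ).deg 1) : N u ∈ (Γ.tensor Λ).deg 1 := by
  suffices h : _ ≤ ((Γ.tensor Λ).deg 1).comap N from h ((Γ.tensor Λ).deg_one_le hu)
  refine Submodule.span_le.2 ?_
  rintro _ ⟨x, y, rfl⟩
  rw [SetLike.mem_coe, Submodule.mem_comap, hN]
  exact (Γ.tensor Λ).mul_mem_deg (zero_add 1) ((Γ.tensor Λ).inj_mem x) (horEmb_mem_deg Γ Λ (hT1 y))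

theorem rightModuleMap_mem_deg
    (hT1 : ∀ y φ, contract φ (T (Γ.inj.toLinearMap.rTensor H y)) ∈ Γ.deg 1)
    (hN : ∀ x y, N ((Γ.tensor Λ).d ((Γ.tensor Λ).inj y) * (Γ.tensor Λ).inj x) =
      horEmb Γ Λ (T (Γ.inj.toLinearMap.rTensor H y)) * (Γ.tensor Λ).inj x)
    {u : (Γ.tensor Λ).Form} (hu : u ∈ (Γ.tensor Λ).deg 1) : N u ∈ (Γ.tensor Λ).deg 1 := by
  suffices h : _ ≤ ((Γ.tensor Λ).deg 1).comap N from h ((Γ.tensor Λ).deg_one_le_span_d_mul hu)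
  refine Submodule.span_le.2 ?_
  rintro _ ⟨y, x, rfl⟩
  rw [SetLike.mem_coe, Submodule.mem_comap, hN]
  exact (Γ.tensor Λ).mul_mem_deg (add_zero 1) (horEmb_mem_deg Γ Λ (hT1 y)) ((Γ.tensor Λ).inj_mem x)

theorem leftModuleMap_inj_mul
    (hN : ∀ x y, N ((Γ.tensor Λ).inj x * (Γ.tensor Λ).d ((Γ.tensor Λ).inj y)) =
      (Γ.tensor Λ).inj x * horEmb Γ Λ (T (Γ.inj.toLinearMap.rTensor H y)))
    {u : (Γ.tensor Λ).Form} (hu : u ∈ (Γ.tensor Λ).deg 1) (x : A ⊗[k] H) :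
    N ((Γ.tensor Λ).inj x * u) = (Γ.tensor Λ).inj x * N u := by
  have hu' := (Γ.tensor Λ).deg_one_le hu
  clear hu
  induction hu' using Submodule.span_induction with
  | zero => simp
  | add x y _ _ hx hy => simp only [map_add, mul_add, hx, hy]
  | smul c x _ hx => simp only [map_smul, mul_smul_comm, hx]
  | mem u hu =>
    obtain ⟨y, z, rfl⟩ := hu
    rw [hN, ← mul_assoc, ← mul_assoc, ← map_mul, hN]

theorem rightModuleMap_mul_inj
    (hN : ∀ x y, N ((Γ.tensor Λ).d ((Γ.tensor Λ).inj y) * (Γ.tensor Λ).inj x) =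
      horEmb Γ Λ (T (Γ.inj.toLinearMap.rTensor H y)) * (Γ.tensor Λ).inj x)
    {u : (Γ.tensor Λ).Form} (hu : u ∈ (Γ.tensor Λ).deg 1) (x : A ⊗[k] H) :
    N (u * (Γ.tensor Λ).inj x) = N u * (Γ.tensor Λ).inj x := by
  have hu' := (Γ.tensor Λ).deg_one_le_span_d_mul hu
  clear hu
  induction hu' using Submodule.span_induction with
  | zero => simp
  | add x y _ _ hx hy => simp only [map_add, add_mul, hx, hy]
  | smul c x _ hx => simp only [map_smul, smul_mul_assoc, hx]
  | mem u hu =>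
    obtain ⟨z, y, rfl⟩ := hu
    rw [hN, mul_assoc, mul_assoc, ← map_mul, hN]

end LocalConnections

end

/-! ### From covariant derivatives to connections, and bijectivity -/

section

open DifferentialCalculus HopfAlgebra Coalgebra

section Bundle

variable {k : Type*} {H : Type*} {P : Type*} {B : Type*} {I : Type*} [Field k]
    [Ring H] [HopfAlgebra k H] [Ring P] [Algebra k P] [Ring B] [Algebra k B]
    {J : I → Ideal B} [∀ i, (J i).IsTwoSided]

variable {X : PrincipalBundle k H P J} {D : DifferentialStructure k H J}

theorem totalIncl_mem_deg (p : P) : (totalIncl X D p : Families D) ∈ localDeg D.piece 0 :=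
  (mem_localDeg _).2 fun i => (D.piece i).inj_mem _

theorem horProj_totalIncl_of_eq {i : I} {p : P} {h : H} (hp : X.χ i p = 1 ⊗ₜ h) :
    horProj X D i (totalIncl X D p) = 1 ⊗ₜ h := by
  rw [horProj_totalIncl, hp, LinearMap.rTensor_tmul, AlgHom.toLinearMap_apply, map_one]

variable [Fintype I] [DecidableEq I]

namespace PreCovariantDerivative

variable (T : PreCovariantDerivative X D)

/-- The map `h ↦ Tᵢ(1 ⊗ h)`. -/
def potential (i : I) : H →ₗ[k] (D.base i).Form ⊗[k] H :=
  T.localMap i ∘ₗ TensorProduct.mk k (D.base i).Form H 1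

theorem potential_apply (i : I) (h : H) : T.potential i h = T.localMap i (1 ⊗ₜ h) := rfl

theorem potential_one (i : I) : T.potential i 1 = 0 := by
  rw [potential_apply, ← Algebra.TensorProduct.one_def, ← horProj_one (X := X), localMap_horProj,
    T.map_one, map_zero]

theorem localMap_translate (i : I) (φ : H →ₗ[k] k) (z : (D.base i).Form ⊗[k] H) :
    T.localMap i ((translate φ).lTensor _ z) = (translate φ).lTensor _ (T.localMap i z) := by
  obtain ⟨α, rfl⟩ := horProj_surjective X D i z
  rw [← horProj_horTranslate, localMap_horProj, localMap_horProj,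
    (covariant_iff _).1 T.covariant, horProj_horTranslate]

theorem potential_translate (i : I) (φ : H →ₗ[k] k) (h : H) : T.potential i (translate φ h) =
    (translate φ).lTensor (D.base i).Form (T.potential i h) := by
  rw [potential_apply, potential_apply, ← localMap_translate, LinearMap.lTensor_tmul]

theorem localMap_inj_χ (i : I) (p : P) :
    horEmb (D.base i) D.fibre (T.localMap i ((D.base i).inj.toLinearMap.rTensor H (X.χ i p))) =
      (T.toLinearMap (totalIncl X D p) : Families D) i := by
  rw [← horProj_totalIncl, localMap_horProj, horEmb_horProj]

theorem contract_localMap_mem (i : I) (y : (B ⧸ J i) ⊗[k] H) (φ : H →ₗ[k] k) :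
    contract φ (T.localMap i ((D.base i).inj.toLinearMap.rTensor H y)) ∈ (D.base i).deg 1 := by
  obtain ⟨p, rfl⟩ := X.χ_surjective i y
  rw [← horProj_totalIncl, localMap_horProj]
  exact contract_horProj_mem (T.degree 0 _ (totalIncl_mem_deg p)) i φ

theorem contract_counit_potential {i : I} {h : H} (hh : h ∈ LinearMap.ker (T.A i)) :
    contract (counit (R := k)) (T.potential i h) = 0 :=
  neg_eq_zero.1 (LinearMap.mem_ker.1 hh)

end PreCovariantDerivative

/-- Every γ ⊗ h is the i-component of a product ω·p of a base form and an element of P, where the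
Leibniz rule reduces Dᵢ to its values on 1 ⊗ h. -/
theorem LeftCovariantDerivative.localMap_eq_leftOp (T : LeftCovariantDerivative X D) (i : I) :
    T.localMap i = leftOp (D.base i) (T.potential i) := by
  refine TensorProduct.ext' fun γ h => ?_
  induction γ using DirectSum.Decomposition.inductionOn (D.base i).deg with
  | zero => simp
  | add a b ha hb => rw [TensorProduct.add_tmul, map_add, map_add, ha, hb]
  | @homogeneous n γ =>
    -- The left Leibniz rule needs the base form to be of degree n over every piece, not only over
    -- i, so a homogeneous universal lift is taken.
    obtain ⟨ω, hω, h1⟩ := exists_universalDeg (fun i => Ideal.Quotient.mkₐ k (J i)) D.base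
      (fun i => Ideal.Quotient.mkₐ_surjective k (J i)) i γ.2
    obtain ⟨p, hp⟩ := X.χ_surjective i (1 ⊗ₜ h)
    have e : horProj X D i (baseIncl X D (baseOf D ω) * totalIncl X D p) =
        (γ : (D.base i).Form) ⊗ₜ h := by
      rw [horProj_mul, horProj_baseIncl, baseOf_apply, h1, horProj_totalIncl_of_eq hp,
        Algebra.TensorProduct.tmul_mul_tmul, mul_one, one_mul]
    have hl := congrFun (T.leibniz n (baseOf D ω) (totalIncl X D p)
      ((mem_localDeg _).2 fun j => extUniversal_mem_deg _ _ hω j)) i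
    rw [leftOp_tmul, ← e, T.localMap_horProj, horProj_eq_iff, hl]
    change (D.piece i).d (pieceIncl (D.base i) D.fibre (extUniversal _ D.base i ω)) *
      (D.piece i).inj (X.χ i p) + (-1 : k) ^ n • (pieceIncl (D.base i) D.fibre
        (extUniversal _ D.base i ω) * (T.toLinearMap (totalIncl X D p) : Families D) i) = _
    rw [h1, hp, piece_d_pieceIncl, ← horEmb_tmul_eq_mul, map_add, horEmb_mul, horEmb_tmul_one,
      (D.base i).sign_of_mem γ.2, map_smul, smul_mul_assoc, T.potential_apply,
      ← horProj_totalIncl_of_eq hp, T.localMap_horProj, horEmb_horProj]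

theorem RightCovariantDerivative.localMap_eq_rightOp (T : RightCovariantDerivative X D) (i : I) :
    T.localMap i = rightOp (D.base i) (T.potential i) := by
  refine TensorProduct.ext' fun γ h => ?_
  obtain ⟨ω, h1⟩ := exists_baseOf D i γ
  obtain ⟨p, hp⟩ := X.χ_surjective i (1 ⊗ₜ h)
  have e : horProj X D i (totalIncl X D p * baseIncl X D (baseOf D ω)) = γ ⊗ₜ h := by
    rw [horProj_mul, horProj_baseIncl, h1, horProj_totalIncl_of_eq hp,
      Algebra.TensorProduct.tmul_mul_tmul, mul_one, one_mul]
  -- In the right Leibniz rule the degree is that of the left factor p, which is 0; the base form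
  -- may be inhomogeneous.
  have hl := congrFun (T.leibniz 0 (baseOf D ω) (totalIncl X D p) (totalIncl_mem_deg p)) i
  rw [rightOp_tmul, ← e, T.localMap_horProj, horProj_eq_iff, hl, pow_zero, one_smul]
  change (T.toLinearMap (totalIncl X D p) : Families D) i *
    pieceIncl (D.base i) D.fibre ((baseOf D ω : ∀ i, (D.base i).Form) i) +
      (D.piece i).inj (X.χ i p) * (D.piece i).d
        (pieceIncl (D.base i) D.fibre ((baseOf D ω : ∀ i, (D.base i).Form) i)) = _
  rw [h1, hp, piece_d_pieceIncl, ← horEmb_tmul_eq_mul', map_add, horEmb_mul, horEmb_tmul_one,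
    T.potential_apply, ← horProj_totalIncl_of_eq hp, T.localMap_horProj, horEmb_horProj, add_comm]

namespace PreConnection

section OfLocal

variable {N : ∀ i, (D.piece i).Form →ₗ[k] (D.piece i).Form}

omit [Fintype I] [DecidableEq I] in
-- Two components of a one-form have a common lift Σ a db. On such a lift the Nᵢ are, by `hlift`,
-- the components of one global horizontal form, which supplies the lift of the images.
theorem ofLocal_mem (hrange : ∀ i u, N i u ∈ horizontal (D.base i) D.fibre)
    (hdeg : ∀ i, ∀ u ∈ (D.piece i).deg 1, N i u ∈ (D.piece i).deg 1)
    (hlift : ∀ a b : P, ∃ α : horForms X D, ∀ i, N i ((D.piece i).inj (X.χ i a) *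
      (D.piece i).d ((D.piece i).inj (X.χ i b))) = (α : Families D) i) (γ : oneForms X D) :
    (fun i => N i ((γ : Families D) i)) ∈ horOneForms X D := by
  have key : ∀ ω ∈ universalOne k P, ∃ α : horForms X D, ∀ i,
      N i (extUniversal X.χ D.piece i ω) = (α : Families D) i := by
    intro ω hω
    induction hω using Submodule.span_induction with
    | zero => exact ⟨0, fun i => by rw [map_zero, map_zero]; rfl⟩
    | add x y _ _ hx hy =>
      obtain ⟨α, hα⟩ := hx
      obtain ⟨β, hβ⟩ := hy
      exact ⟨α + β, fun i => by rw [map_add, map_add, hα, hβ]; rfl⟩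
    | smul c x _ hx =>
      obtain ⟨α, hα⟩ := hx
      exact ⟨c • α, fun i => by rw [map_smul, map_smul, hα]; rfl⟩
    | mem x hx =>
      obtain ⟨a, b, rfl⟩ := hx
      obtain ⟨α, hα⟩ := hlift a b
      exact ⟨α, fun i => by rw [map_mul, extUniversal_inj, extUniversal_d, hα]⟩
  refine ⟨(mem_horForms X D).2 ⟨(mem_localForms _ _).2 fun i j => ?_, fun i => hrange i _⟩,
    (mem_localDeg _).2 fun i => hdeg i _ ((mem_localDeg _).1 γ.2.2 i)⟩
  obtain ⟨ω, hω, hi, hj⟩ := exists_universalOne X.χ D.piece γ.2.1 γ.2.2 i j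
  obtain ⟨α, hα⟩ := key ω hω
  obtain ⟨η, h1, h2⟩ := (mem_localForms _ _).1 (mem_totalForms α) i j
  exact ⟨η, by rw [h1, ← hα, hi], by rw [h2, ← hα, hj]⟩

/-- A connection from its local operators, without the module property. -/
def ofLocal (hrange : ∀ i u, N i u ∈ horizontal (D.base i) D.fibre)
    (hdeg : ∀ i, ∀ u ∈ (D.piece i).deg 1, N i u ∈ (D.piece i).deg 1)
    (hlift : ∀ a b : P, ∃ α : horForms X D, ∀ i, N i ((D.piece i).inj (X.χ i a) *
      (D.piece i).d ((D.piece i).inj (X.χ i b))) = (α : Families D) i)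
    (hid : ∀ i z, N i (horEmb (D.base i) D.fibre z) = horEmb (D.base i) D.fibre z)
    (hcov : ∀ i (φ : H →ₗ[k] k), ∀ u ∈ (D.piece i).deg 1,
      N i (contract φ (pieceCoact (D.base i) D.cov u)) =
        contract φ (pieceCoact (D.base i) D.cov (N i u))) : PreConnection X D :=
  have hid' : ∀ (γ : horOneForms X D) (i : I), N i ((γ : Families D) i) = (γ : Families D) i := by
    intro γ i
    obtain ⟨z, hz⟩ := ((mem_horForms X D).1 γ.2.1).2 i
    rw [← hz]
    exact hid i z
  { toLinearMap := (LinearMap.pi (fun i => N i ∘ₗ LinearMap.proj i) ∘ₗ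
        (oneForms X D).subtype).codRestrict (horOneForms X D) (ofLocal_mem hrange hdeg hlift)
    surjective := fun γ => ⟨Submodule.inclusion (horOneForms_le X D) γ,
      Subtype.ext (funext fun i => hid' γ i)⟩
    idem := fun γ => Subtype.ext (funext fun i =>
      hid' ⟨_, ofLocal_mem hrange hdeg hlift γ⟩ i)
    covariant := (covariant_one_iff _).2 fun φ γ => by
      refine Subtype.ext (funext fun i => ?_)
      rw [coe_horOneTranslate, contract_familyCoact]
      change N i ((oneTranslate X D φ γ : Families D) i) = contract φ
        (pieceCoact (D.base i) D.cov (N i ((γ : Families D) i)))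
      rw [coe_oneTranslate, contract_familyCoact]
      exact hcov i φ _ ((mem_localDeg _).1 γ.2.2 i)
    isLocal := fun i γ hγ => by
      change N i ((γ : Families D) i) = 0
      rw [hγ, map_zero] }

end OfLocal

/-- Over a given piece every one-form coincides with a global Σ a db, and by locality hor depends
over that piece only on the component there. So agreement on the a db suffices. -/
theorem toLinearMap_ext {c c' : PreConnection X D}
    (h : ∀ a b : P, ∃ η : oneForms X D, (∀ i, (η : Families D) i =
      (D.piece i).inj (X.χ i a) * (D.piece i).d ((D.piece i).inj (X.χ i b))) ∧
        c.toLinearMap η = c'.toLinearMap η) : c.toLinearMap = c'.toLinearMap := by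
  have key : ∀ ω ∈ universalOne k P, ∃ η : oneForms X D,
      (∀ i, (η : Families D) i = extUniversal X.χ D.piece i ω) ∧
        c.toLinearMap η = c'.toLinearMap η := by
    intro ω hω
    induction hω using Submodule.span_induction with
    | zero => exact ⟨0, fun i => by rw [map_zero]; rfl, by rw [map_zero, map_zero]⟩
    | add x y _ _ hx hy =>
      obtain ⟨α, hα, h1⟩ := hx
      obtain ⟨β, hβ, h2⟩ := hy
      exact ⟨α + β, fun i => by rw [map_add, ← hα, ← hβ]; rfl, by rw [map_add, map_add, h1, h2]⟩
    | smul a x _ hx =>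
      obtain ⟨α, hα, h1⟩ := hx
      exact ⟨a • α, fun i => by rw [map_smul, ← hα]; rfl, by rw [map_smul, map_smul, h1]⟩
    | mem x hx =>
      obtain ⟨a, b, rfl⟩ := hx
      obtain ⟨η, hη, h1⟩ := h a b
      exact ⟨η, fun i => by rw [map_mul, extUniversal_inj, extUniversal_d, hη], h1⟩
  have eq_of_eq : ∀ (c : PreConnection X D) (γ η : oneForms X D) (i : I),
      (γ : Families D) i = (η : Families D) i →
        (c.toLinearMap γ : Families D) i = (c.toLinearMap η : Families D) i := by
    intro c γ η i hi
    have h0 := c.isLocal i (γ - η) (sub_eq_zero.2 hi)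
    rw [map_sub] at h0
    exact sub_eq_zero.1 h0
  refine LinearMap.ext fun γ => Subtype.ext (funext fun i => ?_)
  obtain ⟨ω, hω, hi, -⟩ := exists_universalOne X.χ D.piece γ.2.1 γ.2.2 i i
  obtain ⟨η, hη, h1⟩ := key ω hω
  have hγ : (γ : Families D) i = (η : Families D) i := by rw [hη, hi]
  rw [eq_of_eq c γ η i hγ, eq_of_eq c' γ η i hγ, h1]

theorem potential_eq {c : PreConnection X D} {T : PreCovariantDerivative X D}
    (h : ∀ p, (T.toLinearMap (totalIncl X D p) : Families D) = c.toLinearMap (totalD X D p))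
    (i : I) : c.potential i = T.potential i := by
  refine LinearMap.ext fun g => ?_
  obtain ⟨p, hp⟩ := X.χ_surjective i (1 ⊗ₜ g)
  rw [c.potential_apply, T.potential_apply, ← horProj_totalIncl_of_eq hp, T.localMap_horProj, ← hp,
    c.localHorD_χ]
  exact congrArg _ (Subtype.ext (h p).symm)

end PreConnection

theorem LeftConnection.eq_of_totalD {c c' : LeftConnection X D}
    (h : ∀ p, c.toLinearMap (totalD X D p) = c'.toLinearMap (totalD X D p)) : c = c' := by
  have e : c.toLinearMap = c'.toLinearMap := PreConnection.toLinearMap_ext fun a b =>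
    ⟨leftMul X D a (totalD X D b), fun _ => rfl,
      Subtype.ext (by rw [c.map_mul, c'.map_mul, h b])⟩
  obtain ⟨⟨_, _, _, _, _⟩, _⟩ := c
  obtain ⟨⟨_, _, _, _, _⟩, _⟩ := c'
  cases e
  rfl

/-- A right connection is not left linear, so a db is rewritten as d(ab) - (da)b before right
linearity is used. -/
theorem RightConnection.eq_of_totalD {c c' : RightConnection X D}
    (h : ∀ p, c.toLinearMap (totalD X D p) = c'.toLinearMap (totalD X D p)) : c = c' := by
  have e : c.toLinearMap = c'.toLinearMap := PreConnection.toLinearMap_ext fun a b =>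
    ⟨totalD X D (a * b) - rightMul X D (totalD X D a) b, fun i => by
      change (D.piece i).d ((D.piece i).inj (X.χ i (a * b))) -
        (D.piece i).d ((D.piece i).inj (X.χ i a)) * (D.piece i).inj (X.χ i b) = _
      rw [_root_.map_mul, (D.piece i).d_inj_mul, add_sub_cancel_left], by
      have hm : c.toLinearMap (rightMul X D (totalD X D a) b) =
          c'.toLinearMap (rightMul X D (totalD X D a) b) :=
        Subtype.ext (by rw [c.map_mul, c'.map_mul, h a])
      rw [map_sub, map_sub, h, hm]⟩
  obtain ⟨⟨_, _, _, _, _⟩, _⟩ := c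
  obtain ⟨⟨_, _, _, _, _⟩, _⟩ := c'
  cases e
  rfl

namespace LeftCovariantDerivative

variable (T : LeftCovariantDerivative X D)

/-- The local operators are `leftHor` with κ built from the potential of D. They are left linear
with dy ↦ Dᵢ(y), so a db is sent to the components of the global form a·D(b), and the pieces glue.
-/
theorem exists_connection (hS : Function.Bijective (antipode k (A := H)))
    (hT : ∀ i, rightIdeal D.fibre hS ≤ LinearMap.ker (T.A i)) : ∃ c : LeftConnection X D,
      ∀ p, (T.toLinearMap (totalIncl X D p) : Families D) = c.toLinearMap (totalD X D p) := by
  obtain ⟨r, hr, hr1⟩ := D.fibre.exists_leftInverse_inj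
  -- The condition on R is exactly what makes κ(h dh') = (1 ⊗ h)a(h') well defined; off the span of
  -- these one-forms κ is an arbitrary linear extension.
  choose κ hκ using fun i => exists_comp_eq_of_ker_le (mulDiff D.fibre) (mulAct (T.potential i))
    fun w hw => LinearMap.mem_ker.2 (mulAct_eq_zero hS D.cov (T.potential_translate i)
      (T.potential_one i) (fun r hr => T.contract_counit_potential (hT i hr))
      (LinearMap.mem_ker.1 hw))
  let N : ∀ i, (D.piece i).Form →ₗ[k] (D.piece i).Form := fun i =>
    horEmb (D.base i) D.fibre ∘ₗ leftHor (D.base i) D.fibre r (κ i)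
  have hN : ∀ i x y, N i ((D.piece i).inj x * (D.piece i).d ((D.piece i).inj y)) =
      (D.piece i).inj x * horEmb (D.base i) D.fibre
        (T.localMap i ((D.base i).inj.toLinearMap.rTensor H y)) := by
    intro i x y
    rw [T.localMap_eq_leftOp, ← horEmb_rTensor_inj_mul, ← leftHor_inj_mul_d _ _ hr hr1 (hκ i)]
    rfl
  refine ⟨⟨PreConnection.ofLocal (N := N) (fun i u => ⟨_, rfl⟩)
    (fun i u hu => leftModuleMap_mem_deg (T.contract_localMap_mem i) (hN i) hu)
    (fun a b => ⟨totalIncl X D a * T.toLinearMap (totalIncl X D b), fun i => ?_⟩)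
    (fun i z => congrArg _ (leftHor_horEmb _ _ hr z))
    (fun i φ u hu => leftModuleMap_translate D.cov (T.localMap_translate i) (hN i) hu φ),
    fun p γ => funext fun i =>
      leftModuleMap_inj_mul (hN i) ((mem_localDeg _).1 γ.2.2 i) (X.χ i p)⟩,
    fun p => funext fun i => ?_⟩
  · rw [hN, T.localMap_inj_χ]; rfl
  · have h := hN i 1 (X.χ i p)
    rw [map_one, one_mul, one_mul, T.localMap_inj_χ] at h
    exact h.symm

end LeftCovariantDerivative

namespace RightCovariantDerivative

variable (T : RightCovariantDerivative X D)

/-- Here κ(dh' h) = a(h')(1 ⊗ h), well defined by the condition on S⁻¹(R). The resulting operators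
are right linear with dy ↦ Dᵢ(y). -/
theorem exists_connection (hS : Function.Bijective (antipode k (A := H)))
    (hT : ∀ i, (rightIdeal D.fibre hS).map (antipodeInv hS) ≤ LinearMap.ker (T.A i)) :
    ∃ c : RightConnection X D,
      ∀ p, (T.toLinearMap (totalIncl X D p) : Families D) = c.toLinearMap (totalD X D p) := by
  obtain ⟨r, hr, hr1⟩ := D.fibre.exists_leftInverse_inj
  choose κ hκ using fun i => exists_comp_eq_of_ker_le (diffMul D.fibre) (actMul (T.potential i))
    fun w hw => LinearMap.mem_ker.2 (actMul_eq_zero hS D.cov (T.potential_translate i)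
      (T.potential_one i)
      (fun r hr => T.contract_counit_potential (hT i (Submodule.mem_map_of_mem hr)))
      (LinearMap.mem_ker.1 hw))
  let N : ∀ i, (D.piece i).Form →ₗ[k] (D.piece i).Form := fun i =>
    horEmb (D.base i) D.fibre ∘ₗ rightHor (D.base i) D.fibre r (κ i)
  have hN : ∀ i x y, N i ((D.piece i).d ((D.piece i).inj y) * (D.piece i).inj x) =
      horEmb (D.base i) D.fibre (T.localMap i ((D.base i).inj.toLinearMap.rTensor H y)) *
        (D.piece i).inj x := by
    intro i x y
    rw [T.localMap_eq_rightOp, ← horEmb_mul_rTensor_inj, ← rightHor_d_mul_inj _ _ hr hr1 (hκ i)]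
    rfl
  have hN1 : ∀ i p, N i ((D.piece i).d ((D.piece i).inj (X.χ i p))) =
      (T.toLinearMap (totalIncl X D p) : Families D) i := by
    intro i p
    have h := hN i 1 (X.χ i p)
    rwa [map_one, mul_one, mul_one, T.localMap_inj_χ] at h
  refine ⟨⟨PreConnection.ofLocal (N := N) (fun i u => ⟨_, rfl⟩)
    (fun i u hu => rightModuleMap_mem_deg (T.contract_localMap_mem i) (hN i) hu)
    -- The global image of a db = d(ab) - (da)b under a right linear map with dp ↦ D(p) is D(ab) -
    -- D(a)b.
    (fun a b => ⟨T.toLinearMap (totalIncl X D (a * b)) -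
      T.toLinearMap (totalIncl X D a) * totalIncl X D b, fun i => ?_⟩)
    (fun i z => congrArg _ (rightHor_horEmb _ _ hr z))
    (fun i φ u hu => rightModuleMap_translate D.cov (T.localMap_translate i) (hN i) hu φ),
    fun p γ => funext fun i =>
      rightModuleMap_mul_inj (hN i) ((mem_localDeg _).1 γ.2.2 i) (X.χ i p)⟩,
    fun p => funext fun i => (hN1 i p).symm⟩
  have h : (D.piece i).inj (X.χ i a) * (D.piece i).d ((D.piece i).inj (X.χ i b)) =
      (D.piece i).d ((D.piece i).inj (X.χ i (a * b))) -
        (D.piece i).d ((D.piece i).inj (X.χ i a)) * (D.piece i).inj (X.χ i b) := by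
    rw [map_mul (X.χ i), (D.piece i).d_inj_mul, add_sub_cancel_left]
  rw [h, map_sub, hN1, hN, T.localMap_inj_χ]; rfl

end RightCovariantDerivative

/-- Injectivity: D|_P returns hor ∘ d, and left linearity determines hor from it. Surjectivity: the
connection constructed from T has the same potential as T, and over each piece both covariant
derivatives are `leftOp` of that potential. -/
theorem LeftConnection.covariantDerivative_bijective
    (hS : Function.Bijective (antipode k (A := H))) :
    Function.Bijective fun c : LeftConnection X D =>
      (⟨c.covariantDerivative, c.rightIdeal_le hS⟩ : {T : LeftCovariantDerivative X D //
        ∀ i, rightIdeal D.fibre hS ≤ LinearMap.ker (T.A i)}) := by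
  constructor
  · intro c c' h
    refine LeftConnection.eq_of_totalD fun p => Subtype.ext ?_
    have h1 : c.covariantDerivative = c'.covariantDerivative := congrArg Subtype.val h
    have h2 : c.horD p = c'.horD p := by
      rw [← c.covariantDerivative_totalIncl, ← c'.covariantDerivative_totalIncl, h1]
    exact congrArg (fun α : horForms X D => (α : Families D)) h2
  · rintro ⟨T, hT⟩
    obtain ⟨c, hc⟩ := T.exists_connection hS hT
    refine ⟨c, Subtype.ext ?_⟩
    have e : c.covariantDerivative.toLinearMap = T.toLinearMap :=
      PreCovariantDerivative.ext_of_localMap fun i γ h => by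
        rw [c.localMap_covariantDerivative, T.localMap_eq_leftOp, PreConnection.potential_eq hc]
    change c.covariantDerivative = T
    generalize c.covariantDerivative = T' at e
    -- All fields other than the linear map are propositions, so equality of the linear maps gives
    -- equality of the structures.
    obtain ⟨⟨_, _, _, _, _⟩, _⟩ := T
    obtain ⟨⟨_, _, _, _, _⟩, _⟩ := T'
    cases e
    rfl

/-- The same argument with `rightOp`; injectivity uses `RightConnection.eq_of_totalD`. -/
theorem RightConnection.covariantDerivative_bijective
    (hS : Function.Bijective (antipode k (A := H))) :
    Function.Bijective fun c : RightConnection X D =>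
      (⟨c.covariantDerivative, c.rightIdeal_map_le hS⟩ : {T : RightCovariantDerivative X D //
        ∀ i, (rightIdeal D.fibre hS).map (antipodeInv hS) ≤ LinearMap.ker (T.A i)}) := by
  constructor
  · intro c c' h
    refine RightConnection.eq_of_totalD fun p => Subtype.ext ?_
    have h1 : c.covariantDerivative = c'.covariantDerivative := congrArg Subtype.val h
    have h2 : c.horD p = c'.horD p := by
      rw [← c.covariantDerivative_totalIncl, ← c'.covariantDerivative_totalIncl, h1]
    exact congrArg (fun α : horForms X D => (α : Families D)) h2
  · rintro ⟨T, hT⟩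
    obtain ⟨c, hc⟩ := T.exists_connection hS hT
    refine ⟨c, Subtype.ext ?_⟩
    have e : c.covariantDerivative.toLinearMap = T.toLinearMap :=
      PreCovariantDerivative.ext_of_localMap fun i γ h => by
        rw [c.localMap_covariantDerivative, T.localMap_eq_rightOp, PreConnection.potential_eq hc]
    change c.covariantDerivative = T
    generalize c.covariantDerivative = T' at e
    obtain ⟨⟨_, _, _, _, _⟩, _⟩ := T
    obtain ⟨⟨_, _, _, _, _⟩, _⟩ := T'
    cases e
    rfl

end Bundle

end

end QuantumBundle

end

theorem proposition12 {H : Type*} {P : Type*} {B : Type*} {I : Type*} [Ring H] [HopfAlgebra ℂ H]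
    (hS : Function.Bijective (HopfAlgebra.antipode ℂ (A := H)))
    [Ring P] [Algebra ℂ P] [Ring B] [Algebra ℂ B] [Fintype I] [DecidableEq I]
    (J : I → Ideal B) [∀ i, (J i).IsTwoSided]
    (X : QuantumBundle.PrincipalBundle ℂ H P J) (D : QuantumBundle.DifferentialStructure ℂ H J) :
    (∃ e : QuantumBundle.LeftConnection X D ≃
        {T : QuantumBundle.LeftCovariantDerivative X D //
          ∀ i, QuantumBundle.rightIdeal D.fibre hS ≤ LinearMap.ker (T.A i)},
      ∀ (c : QuantumBundle.LeftConnection X D) (p : P),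
        ((e c).1.toLinearMap (QuantumBundle.totalIncl X D p) : QuantumBundle.Families D) =
          c.toLinearMap (QuantumBundle.totalD X D p)) ∧
    (∃ e : QuantumBundle.RightConnection X D ≃
        {T : QuantumBundle.RightCovariantDerivative X D //
          ∀ i, (QuantumBundle.rightIdeal D.fibre hS).map (QuantumBundle.antipodeInv hS) ≤
            LinearMap.ker (T.A i)},
      ∀ (c : QuantumBundle.RightConnection X D) (p : P),
        ((e c).1.toLinearMap (QuantumBundle.totalIncl X D p) : QuantumBundle.Families D) =
          c.toLinearMap (QuantumBundle.totalD X D p)) := by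
  refine ⟨⟨Equiv.ofBijective _ (QuantumBundle.LeftConnection.covariantDerivative_bijective hS),
    fun c p => ?_⟩, ⟨Equiv.ofBijective _
      (QuantumBundle.RightConnection.covariantDerivative_bijective hS), fun c p => ?_⟩⟩
  · exact congrArg Subtype.val (c.covariantDerivative_totalIncl p)
  · exact congrArg Subtype.val (c.covariantDerivative_totalIncl p)
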